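/- Let $\Omega\subset\mathbb{R}^3$ be a bounded domain with a Liapunov ($C^{1,\alpha}$, $0<\alpha\le 1$) boundary, let $\lambda\in\mathbb{C}$, $\lambda\neq 0$, and let $1<p<\infty$. Let $W^{p,\operatorname{div}}(\Omega)$ be the space of vector fields $\vec u\in L^p(\Omega;\mathbb{C}^3)$ whose weak divergence lies in $L^p(\Omega)$. Put $\theta(\vec x)=-\dfrac{e^{i\lambda|\vec x|}}{4\pi|\vec x|}$ and \[ \overrightarrow{T}_{2,\lambda}[\vec w](\vec x)=\int_\Omega\bigl[\lambda\,\theta(\vec x-\vec y)\,\vec w(\vec y)-(\operatorname{grad}\theta)(\vec x-\vec y)\times\vec w(\vec y)\bigr]\,d\vec y . \] Then the operator \[ R_\lambda=\frac1\lambda\bigl(I-\operatorname{curl}\overrightarrow{T}_{2,\lambda}\bigr), \] with $\operatorname{curl}$ understood in the weak sense, is a right inverse of $\operatorname{curl}+\lambda I$ on $W^{p,\operatorname{div}}(\Omega)$. That is, for every $\vec g\in W^{p,\operatorname{div}}(\Omega)$: the integral defining $\overrightarrow{T}_{2,\lambda}[\vec g](\vec x)$ converges absolutely for almost every $\vec x\in\Omega$;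 $\overrightarrow{T}_{2,\lambda}[\vec g]$ has a weak curl in $\Omega$ that is a locally integrable function; $R_\lambda\vec g$ belongs to $W^{p,\operatorname{div}}(\Omega)$ and has a weak curl that is a locally integrable function; and \[ (\operatorname{curl}+\lambda I)\,R_\lambda\vec g=\vec g\quad\text{almost everywhere in }\Omega . \] -/

import Mathlib

open MeasureTheory
open scoped ENNReal NNReal ContDiff

/-- Three-dimensional Euclidean space. -/
abbrev R3 : Type := EuclideanSpace ℝ (Fin 3)

/-- Complex three-vectors (the values of the vector fields). -/
abbrev C3 : Type := Fin 3 → ℂ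

/-- A bounded domain (nonempty, open, connected) of `ℝ³` with a Liapunov boundary: for some
`0 < α ≤ 1`, near each boundary point and in suitable Cartesian coordinates (given by the linear
isometry `A`), the domain is the region strictly above the graph of a `C^1` function of two
variables whose differential is Hölder continuous with exponent `α`. -/
structure IsBoundedLiapunovDomain (Ω : Set R3) : Prop where
  isOpen : IsOpen Ω
  isConnected : IsConnected Ω
  isBounded : Bornology.IsBounded Ω
  boundary : ∃ α : ℝ≥0, 0 < α ∧ α ≤ 1 ∧ ∀ x₀ ∈ frontier Ω,
    ∃ (A : R3 ≃ₗᵢ[ℝ] R3) (r : ℝ) (γ : EuclideanSpace ℝ (Fin 2) → ℝ) (C : ℝ≥0),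
      0 < r ∧ ContDiff ℝ 1 γ ∧ HolderWith C α (fderiv ℝ γ) ∧
      Ω ∩ Metric.ball x₀ r =
        {x | γ (!₂[(A x) 0, (A x) 1]) < (A x) 2} ∩ Metric.ball x₀ r

noncomputable section

/-- The classical gradient of a complex-valued function on `ℝ³`. -/
def grad3 (f : R3 → ℂ) (x : R3) : C3 :=
  fun i => fderiv ℝ f x (EuclideanSpace.single i (1 : ℝ))

/-- Complex-valued test functions: the space `C_c^∞(Ω)`. -/
def IsTestFunction (Ω : Set R3) (φ : R3 → ℂ) : Prop :=
  ContDiff ℝ ∞ φ ∧ HasCompactSupport φ ∧ tsupport φ ⊆ Ω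

/-- `v` is the weak curl of `u` in `Ω`:
`∫_Ω φ v = - ∫_Ω grad φ × u` for all test functions `φ`. -/
def HasWeakCurl (Ω : Set R3) (u v : R3 → C3) : Prop :=
  LocallyIntegrableOn u Ω ∧ LocallyIntegrableOn v Ω ∧
    ∀ φ : R3 → ℂ, IsTestFunction Ω φ →
      ∫ x in Ω, φ x • v x = -∫ x in Ω, crossProduct (grad3 φ x) (u x)

/-- `d` is the weak divergence of `u` in `Ω`:
`∫_Ω φ d = - ∫_Ω grad φ · u` for all test functions `φ`. -/
def HasWeakDiv (Ω : Set R3) (u : R3 → C3) (d : R3 → ℂ) : Prop :=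
  LocallyIntegrableOn u Ω ∧ LocallyIntegrableOn d Ω ∧
    ∀ φ : R3 → ℂ, IsTestFunction Ω φ →
      ∫ x in Ω, φ x * d x = -∫ x in Ω, ∑ i, grad3 φ x i * u x i

/-- The space `W^{p,div}(Ω)` of fields in `L^p(Ω)` with weak divergence in `L^p(Ω)`. -/
def MemWdiv (p : ℝ≥0∞) (Ω : Set R3) (u : R3 → C3) : Prop :=
  MemLp u p (volume.restrict Ω) ∧
    ∃ d : R3 → ℂ, MemLp d p (volume.restrict Ω) ∧ HasWeakDiv Ω u d

open Classical in
/-- The operator `curl` in the weak sense: the weak curl of `u` in `Ω` (determined up to equality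
almost everywhere in `Ω`), and the default value `0` if `u` has none. -/
def weakCurl (Ω : Set R3) (u : R3 → C3) : R3 → C3 :=
  if h : ∃ v, HasWeakCurl Ω u v then h.choose else 0

/-- The fundamental solution `θ(x) = - e^{iλ|x|} / (4π|x|)` of the Helmholtz operator `Δ + λ²`. -/
def helmholtzTheta (lam : ℂ) (x : R3) : ℂ :=
  -Complex.exp (Complex.I * lam * (‖x‖ : ℂ)) / (4 * (Real.pi : ℂ) * (‖x‖ : ℂ))

/-- The integrand `λ θ(x-y) w(y) - grad θ(x-y) × w(y)` of the operator `T_{2,λ}`. -/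
def teodorescuIntegrand (lam : ℂ) (w : R3 → C3) (x y : R3) : C3 :=
  (lam * helmholtzTheta lam (x - y)) • w y -
    crossProduct (grad3 (helmholtzTheta lam) (x - y)) (w y)

/-- The component operator `T_{2,λ}` of the `λ`-Teodorescu transform over `Ω`. -/
def teodorescuT2 (lam : ℂ) (Ω : Set R3) (w : R3 → C3) (x : R3) : C3 :=
  ∫ y in Ω, teodorescuIntegrand lam w x y

/-- The operator `R_λ = (1/λ) (I - curl T_{2,λ})`. -/
def rightInverseR (lam : ℂ) (Ω : Set R3) (g : R3 → C3) (x : R3) : C3 :=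
  lam⁻¹ • (g x - weakCurl Ω (teodorescuT2 lam Ω g) x)

end

/-! ### The radial profiles of the Helmholtz kernel -/

/-- The radial profile `-e^{iλr} / (4πr)` of the Helmholtz fundamental solution. -/
noncomputable def radTheta (lam : ℂ) (r : ℝ) : ℂ :=
  -Complex.exp (Complex.I * lam * (r : ℂ)) / (4 * (Real.pi : ℂ) * (r : ℂ))

/-- The function `r⁻¹ Θ'(r)`, where `Θ` is `radTheta`. -/
noncomputable def radSlope (lam : ℂ) (r : ℝ) : ℂ :=
  Complex.exp (Complex.I * lam * (r : ℂ)) * (1 - Complex.I * lam * r) /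
    (4 * (Real.pi : ℂ) * (r : ℂ) ^ 3)

/-- The derivative of `radSlope`. -/
noncomputable def radSlopeDeriv (lam : ℂ) (r : ℝ) : ℂ :=
  Complex.exp (Complex.I * lam * (r : ℂ)) * (lam ^ 2 * r ^ 2 + 3 * Complex.I * lam * r - 3) /
    (4 * (Real.pi : ℂ) * (r : ℂ) ^ 4)

lemma four_pi_ne_zero : (4 * (Real.pi : ℂ)) ≠ 0 := by
  simp [Real.pi_ne_zero]

lemma hasDerivAt_exp_I_mul (lam : ℂ) (r : ℝ) :
    HasDerivAt (fun r : ℝ => Complex.exp (Complex.I * lam * (r : ℂ)))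
      (Complex.exp (Complex.I * lam * (r : ℂ)) * (Complex.I * lam)) r := by
  have h : HasDerivAt (fun r : ℝ => Complex.I * lam * (r : ℂ)) (Complex.I * lam) r := by
    simpa using (Complex.ofRealCLM.hasDerivAt (x := r)).const_mul (Complex.I * lam)
  exact h.cexp

lemma hasDerivAt_radTheta (lam : ℂ) {r : ℝ} (hr : r ≠ 0) :
    HasDerivAt (radTheta lam) (r * radSlope lam r) r := by
  have hr' : (r : ℂ) ≠ 0 := by exact_mod_cast hr
  have h1 : HasDerivAt (fun r : ℝ => 4 * (Real.pi : ℂ) * (r : ℂ)) (4 * (Real.pi : ℂ)) r := by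
    simpa using (Complex.ofRealCLM.hasDerivAt (x := r)).const_mul (4 * (Real.pi : ℂ))
  have h := (hasDerivAt_exp_I_mul lam r).neg.div h1 (mul_ne_zero four_pi_ne_zero hr')
  convert! h using 1
  have := four_pi_ne_zero
  have hpi : (Real.pi : ℂ) ≠ 0 := by simp [Real.pi_ne_zero]
  simp only [radSlope, Pi.neg_apply]
  field_simp
  ring

lemma hasDerivAt_radSlope (lam : ℂ) {r : ℝ} (hr : r ≠ 0) :
    HasDerivAt (radSlope lam) (radSlopeDeriv lam r) r := by
  have hr' : (r : ℂ) ≠ 0 := by exact_mod_cast hr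
  have h0 : HasDerivAt (fun r : ℝ => (r : ℂ)) 1 r := Complex.ofRealCLM.hasDerivAt (x := r)
  have h1 : HasDerivAt (fun r : ℝ => 4 * (Real.pi : ℂ) * (r : ℂ) ^ 3)
      (4 * (Real.pi : ℂ) * (3 * (r : ℂ) ^ 2)) r := by
    simpa using (h0.pow 3).const_mul (4 * (Real.pi : ℂ))
  have h2 : HasDerivAt (fun r : ℝ => 1 - Complex.I * lam * (r : ℂ)) (-(Complex.I * lam)) r := by
    simpa using (h0.const_mul (Complex.I * lam)).const_sub 1
  have h := ((hasDerivAt_exp_I_mul lam r).mul h2).div h1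
    (mul_ne_zero four_pi_ne_zero (pow_ne_zero 3 hr'))
  convert! h using 1
  have hpi : (Real.pi : ℂ) ≠ 0 := by simp [Real.pi_ne_zero]
  simp only [radSlopeDeriv, Pi.mul_apply]
  field_simp
  ring_nf
  simp only [Complex.I_sq]
  ring

lemma three_mul_radSlope_add (lam : ℂ) {r : ℝ} (hr : r ≠ 0) :
    3 * radSlope lam r + r * radSlopeDeriv lam r = -lam ^ 2 * radTheta lam r := by
  have hr' : (r : ℂ) ≠ 0 := by exact_mod_cast hr
  have hpi : (Real.pi : ℂ) ≠ 0 := by simp [Real.pi_ne_zero]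
  simp only [radSlope, radSlopeDeriv, radTheta]
  field_simp
  ring

lemma exists_bound_radial (lam : ℂ) (R : ℝ) : ∃ C : ℝ, 0 < C ∧ ∀ r : ℝ, 0 < r → r ≤ R →
    ‖radTheta lam r‖ ≤ C / r ∧ ‖radSlope lam r‖ ≤ C / r ^ 3 ∧
      ‖radSlopeDeriv lam r‖ ≤ C / r ^ 4 := by
  have key : ∀ f : ℝ → ℂ, Continuous f → ∃ C : ℝ, ∀ r ∈ Set.Icc 0 R, ‖f r‖ ≤ C := fun f hf =>
    isCompact_Icc.exists_bound_of_continuousOn hf.continuousOn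
  obtain ⟨C₁, h₁⟩ := key (fun r => -Complex.exp (Complex.I * lam * (r : ℂ)) / (4 * (Real.pi : ℂ)))
    (by fun_prop)
  obtain ⟨C₂, h₂⟩ := key (fun r => Complex.exp (Complex.I * lam * (r : ℂ)) *
    (1 - Complex.I * lam * r) / (4 * (Real.pi : ℂ))) (by fun_prop)
  obtain ⟨C₃, h₃⟩ := key (fun r => Complex.exp (Complex.I * lam * (r : ℂ)) *
    (lam ^ 2 * r ^ 2 + 3 * Complex.I * lam * r - 3) / (4 * (Real.pi : ℂ))) (by fun_prop)
  refine ⟨|C₁| + |C₂| + |C₃| + 1, by positivity, fun r hr hrR => ?_⟩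
  have m : r ∈ Set.Icc 0 R := ⟨hr.le, hrR⟩
  have b₁ := h₁ r m
  have b₂ := h₂ r m
  have b₃ := h₃ r m
  have a₁ := le_abs_self C₁
  have a₂ := le_abs_self C₂
  have a₃ := le_abs_self C₃
  have p₁ := abs_nonneg C₁
  have p₂ := abs_nonneg C₂
  have p₃ := abs_nonneg C₃
  refine ⟨?_, ?_, ?_⟩
  · rw [radTheta, ← div_div, norm_div, Complex.norm_of_nonneg hr.le]
    gcongr
    linarith
  · rw [radSlope, ← div_div, norm_div, norm_pow, Complex.norm_of_nonneg hr.le]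
    gcongr
    linarith
  · rw [radSlopeDeriv, ← div_div, norm_div, norm_pow, Complex.norm_of_nonneg hr.le]
    gcongr
    linarith

lemma measurable_radTheta (lam : ℂ) : Measurable (radTheta lam) := by
  unfold radTheta; fun_prop

lemma measurable_radSlope (lam : ℂ) : Measurable (radSlope lam) := by
  unfold radSlope; fun_prop

lemma measurable_radSlopeDeriv (lam : ℂ) : Measurable (radSlopeDeriv lam) := by
  unfold radSlopeDeriv; fun_prop

/-! ### The regularised norm -/

/-- The regularised norm `√(|z|² + ε²)`. -/
noncomputable def regNorm (ε : ℝ) (z : R3) : ℝ := √(‖z‖ ^ 2 + ε ^ 2)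

lemma regNorm_zero (z : R3) : regNorm 0 z = ‖z‖ := by simp [regNorm]

lemma regNorm_nonneg (ε : ℝ) (z : R3) : 0 ≤ regNorm ε z := Real.sqrt_nonneg _

lemma regNorm_sq (ε : ℝ) (z : R3) : regNorm ε z ^ 2 = ‖z‖ ^ 2 + ε ^ 2 :=
  Real.sq_sqrt (by positivity)

lemma norm_le_regNorm (ε : ℝ) (z : R3) : ‖z‖ ≤ regNorm ε z :=
  Real.le_sqrt_of_sq_le (by nlinarith [sq_nonneg ε])

lemma abs_le_regNorm (ε : ℝ) (z : R3) : |ε| ≤ regNorm ε z :=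
  Real.le_sqrt_of_sq_le (by rw [sq_abs]; nlinarith [sq_nonneg ‖z‖])

lemma regNorm_le (ε : ℝ) (z : R3) : regNorm ε z ≤ ‖z‖ + |ε| := by
  apply Real.sqrt_le_iff.2
  refine ⟨by positivity, ?_⟩
  have := mul_nonneg (norm_nonneg z) (abs_nonneg ε)
  nlinarith [sq_abs ε]

lemma regNorm_pos_of_left {ε : ℝ} (hε : ε ≠ 0) (z : R3) : 0 < regNorm ε z :=
  (abs_pos.2 hε).trans_le (abs_le_regNorm ε z)

lemma regNorm_pos_of_right (ε : ℝ) {z : R3} (hz : z ≠ 0) : 0 < regNorm ε z :=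
  (norm_pos_iff.2 hz).trans_le (norm_le_regNorm ε z)

lemma continuous_regNorm_comp {X : Type*} [TopologicalSpace X] {f : X → ℝ} {g : X → R3}
    (hf : Continuous f) (hg : Continuous g) : Continuous fun x => regNorm (f x) (g x) :=
  ((hg.norm.pow 2).add (hf.pow 2)).sqrt

lemma abs_coord_le_norm (z : R3) (i : Fin 3) : |z i| ≤ ‖z‖ := by
  simpa using PiLp.norm_apply_le z i

lemma abs_regNorm_sub_le (ε δ : ℝ) (z w : R3) :
    |regNorm ε z - regNorm δ w| ≤ ‖z - w‖ + |ε - δ| := by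
  have key : ∀ (ε : ℝ) (z : R3), regNorm ε z = ‖(⟨‖z‖, ε⟩ : ℂ)‖ := fun ε z => by
    rw [Complex.norm_def, Complex.normSq_mk, regNorm]; ring_nf
  rw [key, key]
  refine (abs_norm_sub_norm_le _ _).trans ?_
  refine (Complex.norm_le_abs_re_add_abs_im _).trans ?_
  simpa using abs_norm_sub_norm_le z w

lemma hasFDerivAt_regNorm {E : Type*} [NormedAddCommGroup E] [NormedSpace ℝ E]
    {f : E → ℝ} {g : E → R3} {f' : E →L[ℝ] ℝ} {g' : E →L[ℝ] R3} {x : E}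
    (hf : HasFDerivAt f f' x) (hg : HasFDerivAt g g' x) (h : 0 < regNorm (f x) (g x)) :
    HasFDerivAt (fun x => regNorm (f x) (g x))
      ((regNorm (f x) (g x))⁻¹ • ((innerSL ℝ (g x)).comp g' + f x • f')) x := by
  have h0 : ‖g x‖ ^ 2 + f x ^ 2 ≠ 0 := by
    rw [← regNorm_sq]; positivity
  have h1 := ((hg.norm_sq).add (hf.pow 2)).sqrt h0
  convert! h1 using 1
  ext v
  simp [regNorm]
  field_simp

lemma hasFDerivAt_regNorm_right {ε : ℝ} {z : R3} (h : 0 < regNorm ε z) :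
    HasFDerivAt (regNorm ε) ((regNorm ε z)⁻¹ • innerSL ℝ z) z := by
  have := hasFDerivAt_regNorm (hasFDerivAt_const ε z) (hasFDerivAt_id z) h
  convert! this using 1
  ext v
  simp

lemma inner_single (z : R3) (i : Fin 3) :
    inner ℝ z (EuclideanSpace.single i (1 : ℝ)) = z i := by
  simp [EuclideanSpace.inner_single_right]

lemma fderiv_radTheta_regNorm (lam : ℂ) {ε : ℝ} {z : R3} (h : 0 < regNorm ε z) :
    HasFDerivAt (fun z => radTheta lam (regNorm ε z))
      (((innerSL ℝ z).smulRight (radSlope lam (regNorm ε z)))) z := by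
  have h1 := (hasDerivAt_radTheta lam h.ne').hasFDerivAt.comp z (hasFDerivAt_regNorm_right h)
  convert! h1 using 1
  ext v
  have : (regNorm ε z : ℂ) ≠ 0 := by exact_mod_cast h.ne'
  simp
  field_simp

lemma fderiv_radSlope_regNorm (lam : ℂ) {ε : ℝ} {z : R3} (h : 0 < regNorm ε z) :
    HasFDerivAt (fun z => radSlope lam (regNorm ε z))
      (((innerSL ℝ z).smulRight ((regNorm ε z : ℂ)⁻¹ * radSlopeDeriv lam (regNorm ε z)))) z := by
  have h1 := (hasDerivAt_radSlope lam h.ne').hasFDerivAt.comp z (hasFDerivAt_regNorm_right h)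
  convert! h1 using 1
  ext v
  simp
  ring

lemma grad3_radTheta_regNorm (lam : ℂ) {ε : ℝ} {z : R3} (h : 0 < regNorm ε z) (i : Fin 3) :
    grad3 (fun z => radTheta lam (regNorm ε z)) z i = z i * radSlope lam (regNorm ε z) := by
  rw [grad3, (fderiv_radTheta_regNorm lam h).fderiv]
  simp [inner_single]

lemma helmholtzTheta_eq (lam : ℂ) : helmholtzTheta lam = fun z => radTheta lam (regNorm 0 z) := by
  ext z; simp [helmholtzTheta, radTheta, regNorm_zero]

lemma grad3_helmholtzTheta (lam : ℂ) {z : R3} (h : z ≠ 0) (i : Fin 3) :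
    grad3 (helmholtzTheta lam) z i = z i * radSlope lam ‖z‖ := by
  rw [helmholtzTheta_eq, grad3_radTheta_regNorm lam (regNorm_pos_of_right 0 h), regNorm_zero]

lemma hasFDerivAt_coord (z : R3) (i : Fin 3) :
    HasFDerivAt (fun z : R3 => ((z i : ℝ) : ℂ))
      (Complex.ofRealCLM.comp (EuclideanSpace.proj i : R3 →L[ℝ] ℝ)) z :=
  (Complex.ofRealCLM.comp (EuclideanSpace.proj i : R3 →L[ℝ] ℝ)).hasFDerivAt

lemma hasFDerivAt_coord_mul_radSlope (lam : ℂ) {ε : ℝ} {z : R3} (h : 0 < regNorm ε z)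
    (i : Fin 3) :
    HasFDerivAt (fun z : R3 => (z i : ℂ) * radSlope lam (regNorm ε z))
      ((z i : ℂ) • (innerSL ℝ z).smulRight
          ((regNorm ε z : ℂ)⁻¹ * radSlopeDeriv lam (regNorm ε z)) +
        radSlope lam (regNorm ε z) •
          (Complex.ofRealCLM.comp (EuclideanSpace.proj i : R3 →L[ℝ] ℝ))) z :=
  (hasFDerivAt_coord z i).mul (fderiv_radSlope_regNorm lam h)

open Filter Topology

/-! ### Test functions -/

lemma contDiff_grad3 {φ : R3 → ℂ} {n : ℕ∞} (h : ContDiff ℝ (n + 1) φ) (i : Fin 3) :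
    ContDiff ℝ n (fun x => grad3 φ x i) :=
  (h.fderiv_right le_rfl).clm_apply contDiff_const

lemma contDiff_infty_grad3 {φ : R3 → ℂ} (h : ContDiff ℝ ∞ φ) (i : Fin 3) :
    ContDiff ℝ ∞ (fun x => grad3 φ x i) :=
  (h.fderiv_right (by simp)).clm_apply contDiff_const

lemma continuous_grad3 {φ : R3 → ℂ} (h : ContDiff ℝ 1 φ) (i : Fin 3) :
    Continuous (fun x => grad3 φ x i) :=
  (contDiff_grad3 (n := 0) (by simpa using h) i).continuous

lemma hasCompactSupport_grad3 {φ : R3 → ℂ} (h : HasCompactSupport φ) (i : Fin 3) :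
    HasCompactSupport (fun x => grad3 φ x i) :=
  h.fderiv_apply (𝕜 := ℝ) _

lemma tsupport_grad3_subset (φ : R3 → ℂ) (i : Fin 3) :
    tsupport (fun x => grad3 φ x i) ⊆ tsupport φ :=
  tsupport_fderiv_apply_subset ℝ _

lemma IsTestFunction.grad3 {Ω : Set R3} {φ : R3 → ℂ} (h : IsTestFunction Ω φ) (i : Fin 3) :
    IsTestFunction Ω (fun x => grad3 φ x i) :=
  ⟨contDiff_infty_grad3 h.1 i, hasCompactSupport_grad3 h.2.1 i,
    (tsupport_grad3_subset φ i).trans h.2.2⟩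

lemma grad3_grad3_comm {φ : R3 → ℂ} (h : ContDiff ℝ 2 φ) (i j : Fin 3) (x : R3) :
    grad3 (fun x => grad3 φ x i) x j = grad3 (fun x => grad3 φ x j) x i := by
  have hd : DifferentiableAt ℝ (fderiv ℝ φ) x :=
    ((h.fderiv_right (m := 1) (by norm_num)).differentiable (by simp)) x
  have key : ∀ a b : Fin 3, grad3 (fun x => grad3 φ x a) x b =
      fderiv ℝ (fderiv ℝ φ) x (EuclideanSpace.single b (1 : ℝ))
        (EuclideanSpace.single a (1 : ℝ)) := by
    intro a b
    simp only [grad3]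
    rw [fderiv_clm_apply hd (differentiableAt_const _)]
    simp
  rw [key, key]
  exact ((h.contDiffAt).isSymmSndFDerivAt (by simp)).eq _ _

lemma grad3_comp_add (φ : R3 → ℂ) (y : R3) (z : R3) (i : Fin 3) :
    grad3 (fun z => φ (z + y)) z i = grad3 φ (z + y) i := by
  simp only [grad3]
  rw [fderiv_comp_add_right]

/-! ### Locally integrable powers of the norm -/

lemma integrableOn_inv_norm_sq (R : ℝ) :
    IntegrableOn (fun z : R3 => (‖z‖ ^ 2)⁻¹) (Metric.ball 0 R) := by
  rw [integrableOn_fun_norm_addHaar volume (f := fun r : ℝ => (r ^ 2)⁻¹)]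
  have : IntegrableOn (fun _ : ℝ => (1 : ℝ)) (Set.Ioo 0 R) := by
    apply integrableOn_const <;> simp
  refine this.congr_fun (fun y hy => ?_) measurableSet_Ioo
  have : y ≠ 0 := hy.1.ne'
  simp [this]

lemma ae_ne_R3 (y : R3) : ∀ᵐ z : R3, z ≠ y := by
  simp [ae_iff, measure_singleton]

/-! ### The regularised kernels and their limits -/

lemma integrable_mul_of_norm_le_inv_norm_sq {ψ K : R3 → ℂ} (hψ : Continuous ψ)
    (hψc : HasCompactSupport ψ) (hK : AEStronglyMeasurable K)
    (hb : ∀ R : ℝ, ∃ C : ℝ, ∀ z : R3, z ≠ 0 → ‖z‖ ≤ R → ‖K z‖ ≤ C / ‖z‖ ^ 2) :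
    Integrable fun z => ψ z * K z := by
  obtain ⟨R, hR⟩ := hψc.isCompact.isBounded.subset_ball 0
  obtain ⟨C, hC⟩ := hb R
  obtain ⟨M, hM⟩ := hψ.bounded_above_of_compact_support hψc
  have h1 : Integrable ((Metric.ball (0 : R3) R).indicator fun z => M * (C * (‖z‖ ^ 2)⁻¹)) :=
    IntegrableOn.integrable_indicator
      (((integrableOn_inv_norm_sq R).const_mul C).const_mul M) measurableSet_ball
  refine h1.mono' (hψ.aestronglyMeasurable.mul hK) ?_
  filter_upwards [ae_ne_R3 0] with z hz
  by_cases hzR : z ∈ Metric.ball (0 : R3) R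
  · rw [Set.indicator_of_mem hzR, norm_mul, ← div_eq_mul_inv]
    have := hC z hz (by simpa using (Metric.mem_ball.1 hzR).le)
    exact mul_le_mul (hM z) this (norm_nonneg _) ((norm_nonneg _).trans (hM z))
  · rw [Set.indicator_of_notMem hzR, image_eq_zero_of_notMem_tsupport (fun h => hzR (hR h))]
    simp

lemma tendsto_integral_mul_kernel {ψ : R3 → ℂ} (hψ : Continuous ψ) (hψc : HasCompactSupport ψ)
    {K : ℝ → R3 → ℂ} (hK : ∀ ε, AEStronglyMeasurable (K ε))
    (hb : ∀ R : ℝ, ∃ C : ℝ, ∀ ε ∈ Set.Ioo (0 : ℝ) 1, ∀ z : R3, z ≠ 0 → ‖z‖ ≤ R →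
      ‖K ε z‖ ≤ C / ‖z‖ ^ 2)
    (hlim : ∀ z : R3, z ≠ 0 → Tendsto (fun ε => K ε z) (𝓝[>] 0) (𝓝 (K 0 z))) :
    Tendsto (fun ε => ∫ z, ψ z * K ε z) (𝓝[>] 0) (𝓝 (∫ z, ψ z * K 0 z)) := by
  obtain ⟨R, hR⟩ := hψc.isCompact.isBounded.subset_ball 0
  obtain ⟨C, hC⟩ := hb R
  obtain ⟨M, hM⟩ := hψ.bounded_above_of_compact_support hψc
  have h1 : Integrable ((Metric.ball (0 : R3) R).indicator fun z => M * (C * (‖z‖ ^ 2)⁻¹)) :=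
    IntegrableOn.integrable_indicator
      (((integrableOn_inv_norm_sq R).const_mul C).const_mul M) measurableSet_ball
  refine tendsto_integral_filter_of_dominated_convergence _ ?_ ?_ h1 ?_
  · exact Eventually.of_forall fun ε => hψ.aestronglyMeasurable.mul (hK ε)
  · filter_upwards [Ioo_mem_nhdsGT (zero_lt_one (α := ℝ))] with ε hε
    filter_upwards [ae_ne_R3 0] with z hz
    by_cases hzR : z ∈ Metric.ball (0 : R3) R
    · rw [Set.indicator_of_mem hzR, norm_mul, ← div_eq_mul_inv]
      have := hC ε hε z hz (by simpa using (Metric.mem_ball.1 hzR).le)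
      exact mul_le_mul (hM z) this (norm_nonneg _) ((norm_nonneg _).trans (hM z))
    · rw [Set.indicator_of_notMem hzR, image_eq_zero_of_notMem_tsupport (fun h => hzR (hR h))]
      simp
  · filter_upwards [ae_ne_R3 0] with z hz
    exact (hlim z hz).const_mul _

lemma measurable_radTheta_regNorm (lam : ℂ) (ε : ℝ) :
    Measurable fun z => radTheta lam (regNorm ε z) :=
  (measurable_radTheta lam).comp (continuous_regNorm_comp continuous_const continuous_id).measurable

lemma measurable_coord_mul_radSlope (lam : ℂ) (ε : ℝ) (i : Fin 3) :
    Measurable fun z : R3 => (z i : ℂ) * radSlope lam (regNorm ε z) := by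
  have h1 := (measurable_radSlope lam).comp
    (continuous_regNorm_comp (X := R3) (continuous_const (y := ε)) continuous_id).measurable
  have h2 : Measurable fun z : R3 => (z i : ℂ) := by fun_prop
  exact h2.mul h1

lemma exists_bound_kernels (lam : ℂ) (R : ℝ) : ∃ C : ℝ, 0 < C ∧ ∀ ε z, 0 < regNorm ε z →
    regNorm ε z ≤ R → ‖radTheta lam (regNorm ε z)‖ ≤ C / regNorm ε z ^ 2 ∧
      ∀ i, ‖(z i : ℂ) * radSlope lam (regNorm ε z)‖ ≤ C / regNorm ε z ^ 2 := by
  obtain ⟨C, hC, h⟩ := exists_bound_radial lam R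
  refine ⟨C * (|R| + 1), by positivity, fun ε z hz hzR => ⟨?_, fun i => ?_⟩⟩
  · refine (h _ hz hzR).1.trans ?_
    rw [div_le_div_iff₀ hz (by positivity)]
    have : regNorm ε z ≤ |R| + 1 := by linarith [le_abs_self R]
    have h2 := mul_nonneg hC.le hz.le
    nlinarith
  · rw [norm_mul, Complex.norm_real, Real.norm_eq_abs]
    have h1 : |z i| ≤ regNorm ε z := (abs_coord_le_norm z i).trans (norm_le_regNorm ε z)
    calc |z i| * ‖radSlope lam (regNorm ε z)‖ ≤ regNorm ε z * (C / regNorm ε z ^ 3) := by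
          gcongr
          exact (h _ hz hzR).2.1
      _ = C / regNorm ε z ^ 2 := by field_simp
      _ ≤ C * (|R| + 1) / regNorm ε z ^ 2 := by
          gcongr
          nlinarith [abs_nonneg R]

lemma exists_bound_kernels_uniform (lam : ℂ) (R : ℝ) : ∃ C : ℝ, 0 < C ∧
    ∀ ε ∈ Set.Ico (0 : ℝ) 1, ∀ z : R3, z ≠ 0 → ‖z‖ ≤ R →
      ‖radTheta lam (regNorm ε z)‖ ≤ C / ‖z‖ ^ 2 ∧
      ∀ i, ‖(z i : ℂ) * radSlope lam (regNorm ε z)‖ ≤ C / ‖z‖ ^ 2 := by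
  obtain ⟨C, hC, h⟩ := exists_bound_kernels lam (R + 1)
  refine ⟨C, hC, fun ε hε z hz hzR => ?_⟩
  have h1 : regNorm ε z ≤ R + 1 := (regNorm_le ε z).trans
    (add_le_add hzR (by rw [abs_of_nonneg hε.1]; exact hε.2.le))
  have h2 := h ε z (regNorm_pos_of_right ε hz) h1
  have hz' := norm_pos_iff.2 hz
  have h3 : C / regNorm ε z ^ 2 ≤ C / ‖z‖ ^ 2 := by
    gcongr
    exact norm_le_regNorm ε z
  exact ⟨h2.1.trans h3, fun i => (h2.2 i).trans h3⟩

lemma tendsto_regNorm (z : R3) : Tendsto (fun ε => regNorm ε z) (𝓝[>] 0) (𝓝 (regNorm 0 z)) :=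
  (continuous_regNorm_comp continuous_id continuous_const).continuousAt.tendsto.mono_left
    nhdsWithin_le_nhds

lemma tendsto_integral_mul_radTheta (lam : ℂ) {ψ : R3 → ℂ} (hψ : Continuous ψ)
    (hψc : HasCompactSupport ψ) :
    Tendsto (fun ε => ∫ z, ψ z * radTheta lam (regNorm ε z)) (𝓝[>] 0)
      (𝓝 (∫ z, ψ z * radTheta lam (regNorm 0 z))) := by
  refine tendsto_integral_mul_kernel (K := fun ε z => radTheta lam (regNorm ε z)) hψ hψc
    (fun ε => (measurable_radTheta_regNorm lam ε).aestronglyMeasurable) (fun R => ?_)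
    fun z hz => ?_
  · obtain ⟨C, -, h⟩ := exists_bound_kernels_uniform lam R
    exact ⟨C, fun ε hε z hz hzR => (h ε ⟨hε.1.le, hε.2⟩ z hz hzR).1⟩
  · exact (hasDerivAt_radTheta lam (regNorm_pos_of_right 0 hz).ne').continuousAt.tendsto.comp
      (tendsto_regNorm z)

lemma tendsto_integral_mul_radSlope (lam : ℂ) {ψ : R3 → ℂ} (hψ : Continuous ψ)
    (hψc : HasCompactSupport ψ) (i : Fin 3) :
    Tendsto (fun ε => ∫ z, ψ z * ((z i : ℂ) * radSlope lam (regNorm ε z))) (𝓝[>] 0)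
      (𝓝 (∫ z, ψ z * ((z i : ℂ) * radSlope lam (regNorm 0 z)))) := by
  refine tendsto_integral_mul_kernel (K := fun ε z => (z i : ℂ) * radSlope lam (regNorm ε z))
    hψ hψc (fun ε => (measurable_coord_mul_radSlope lam ε i).aestronglyMeasurable) (fun R => ?_)
    fun z hz => ?_
  · obtain ⟨C, -, h⟩ := exists_bound_kernels_uniform lam R
    exact ⟨C, fun ε hε z hz hzR => (h ε ⟨hε.1.le, hε.2⟩ z hz hzR).2 i⟩
  · exact ((hasDerivAt_radSlope lam (regNorm_pos_of_right 0 hz).ne').continuousAt.tendsto.comp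
      (tendsto_regNorm z)).const_mul _

/-! ### Integration by parts -/

lemma integral_grad3_mul {χ K : R3 → ℂ} (hχ : ContDiff ℝ 1 χ) (hχc : HasCompactSupport χ)
    (i : Fin 3) (hK : Differentiable ℝ K) (hK' : Continuous fun z => grad3 K z i) :
    ∫ z, grad3 χ z i * K z = -∫ z, χ z * grad3 K z i := by
  have := integral_mul_fderiv_eq_neg_fderiv_mul_of_integrable (μ := (volume : Measure R3))
    (f := χ) (g := K) (v := EuclideanSpace.single i (1 : ℝ))
    (((continuous_grad3 hχ i).mul hK.continuous).integrable_of_hasCompactSupport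
      (hasCompactSupport_grad3 hχc i).mul_right)
    ((hχ.continuous.mul hK').integrable_of_hasCompactSupport hχc.mul_right)
    ((hχ.continuous.mul hK.continuous).integrable_of_hasCompactSupport hχc.mul_right)
    (fun x _ => (hχ.differentiable (by simp)).differentiableAt) (fun x _ => hK x)
  simp only [grad3]
  rw [this, neg_neg]

lemma continuous_radial_regNorm {f : ℝ → ℂ} (hf : ∀ r, r ≠ 0 → ContinuousAt f r) {ε : ℝ}
    (hε : ε ≠ 0) : Continuous fun z : R3 => f (regNorm ε z) :=
  continuous_iff_continuousAt.2 fun z => ContinuousAt.comp (g := f)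
    (hf _ (regNorm_pos_of_left hε z).ne')
    (continuous_regNorm_comp continuous_const continuous_id).continuousAt

lemma continuousAt_radSlopeDeriv (lam : ℂ) (r : ℝ) (hr : r ≠ 0) :
    ContinuousAt (radSlopeDeriv lam) r := by
  have hr' : (4 * (Real.pi : ℂ) * (r : ℂ) ^ 4) ≠ 0 :=
    mul_ne_zero four_pi_ne_zero (pow_ne_zero 4 (by exact_mod_cast hr))
  unfold radSlopeDeriv
  exact ContinuousAt.div (by fun_prop) (by fun_prop) hr'

lemma integral_grad3_mul_radTheta_reg (lam : ℂ) {χ : R3 → ℂ} (hχ : ContDiff ℝ 1 χ)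
    (hχc : HasCompactSupport χ) (i : Fin 3) {ε : ℝ} (hε : ε ≠ 0) :
    ∫ z, grad3 χ z i * radTheta lam (regNorm ε z) =
      -∫ z, χ z * ((z i : ℂ) * radSlope lam (regNorm ε z)) := by
  have h := fun z => grad3_radTheta_regNorm lam (regNorm_pos_of_left hε z) i
  rw [integral_grad3_mul hχ hχc i]
  · simp_rw [h]
  · exact fun z => (fderiv_radTheta_regNorm lam (regNorm_pos_of_left hε z)).differentiableAt
  · simp_rw [h]
    exact Continuous.mul (by fun_prop) (continuous_radial_regNorm
      (fun r hr => (hasDerivAt_radSlope lam hr).continuousAt) hε)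

lemma integral_grad3_mul_radSlope_reg (lam : ℂ) {χ : R3 → ℂ} (hχ : ContDiff ℝ 1 χ)
    (hχc : HasCompactSupport χ) (i : Fin 3) {ε : ℝ} (hε : ε ≠ 0) :
    ∫ z, grad3 χ z i * ((z i : ℂ) * radSlope lam (regNorm ε z)) =
      -∫ z, χ z * (radSlope lam (regNorm ε z) + (z i : ℂ) ^ 2 *
        ((regNorm ε z : ℂ)⁻¹ * radSlopeDeriv lam (regNorm ε z))) := by
  have h : ∀ z, grad3 (fun z => (z i : ℂ) * radSlope lam (regNorm ε z)) z i =
      radSlope lam (regNorm ε z) + (z i : ℂ) ^ 2 *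
        ((regNorm ε z : ℂ)⁻¹ * radSlopeDeriv lam (regNorm ε z)) := fun z => by
    rw [grad3, (hasFDerivAt_coord_mul_radSlope lam (regNorm_pos_of_left hε z) i).fderiv]
    simp [inner_single]
    ring
  rw [integral_grad3_mul hχ hχc i]
  · simp_rw [h]
  · exact fun z =>
      (hasFDerivAt_coord_mul_radSlope lam (regNorm_pos_of_left hε z) i).differentiableAt
  · simp_rw [h]
    refine (continuous_radial_regNorm
      (fun r hr => (hasDerivAt_radSlope lam hr).continuousAt) hε).add
      (Continuous.mul (by fun_prop) (continuous_radial_regNorm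
        (f := fun r => (r : ℂ)⁻¹ * radSlopeDeriv lam r) (fun r hr => ?_) hε))
    exact ((Complex.continuous_ofReal.continuousAt).inv₀ (by exact_mod_cast hr)).mul
      (continuousAt_radSlopeDeriv lam r hr)

/-- Integration by parts against the singular kernel `θ`. -/
lemma integral_grad3_mul_radTheta (lam : ℂ) {χ : R3 → ℂ} (hχ : ContDiff ℝ 1 χ)
    (hχc : HasCompactSupport χ) (i : Fin 3) :
    ∫ z, grad3 χ z i * radTheta lam (regNorm 0 z) =
      -∫ z, χ z * ((z i : ℂ) * radSlope lam (regNorm 0 z)) := by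
  have h1 := tendsto_integral_mul_radTheta lam (continuous_grad3 hχ i)
    (hasCompactSupport_grad3 hχc i)
  have h2 := (tendsto_integral_mul_radSlope lam hχ.continuous hχc i).neg
  refine tendsto_nhds_unique (h1.congr' ?_) h2
  filter_upwards [self_mem_nhdsWithin] with ε hε
  exact integral_grad3_mul_radTheta_reg lam hχ hχc i (ne_of_gt hε)

/-! ### The fundamental solution property -/

/-- The profile of `ε⁻² D⁵ (Δ + λ²) θ_ε`. -/
noncomputable def helmholtzDefect (lam : ℂ) (r : ℝ) : ℂ :=
  Complex.exp (Complex.I * lam * (r : ℂ)) * (3 - 3 * Complex.I * lam * r - lam ^ 2 * r ^ 2) /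
    (4 * (Real.pi : ℂ))

lemma continuous_helmholtzDefect (lam : ℂ) : Continuous (helmholtzDefect lam) := by
  unfold helmholtzDefect; fun_prop

lemma radSlopeDeriv_eq (lam : ℂ) (r : ℝ) :
    radSlopeDeriv lam r = -helmholtzDefect lam r / (r : ℂ) ^ 4 := by
  rw [radSlopeDeriv, helmholtzDefect, ← div_div]
  ring

lemma integral_helmholtz_radTheta_reg (lam : ℂ) {χ : R3 → ℂ} (hχ : ContDiff ℝ 2 χ)
    (hχc : HasCompactSupport χ) {ε : ℝ} (hε : ε ≠ 0) :
    ∫ z, (∑ i, grad3 (fun x => grad3 χ x i) z i + lam ^ 2 * χ z) * radTheta lam (regNorm ε z) =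
      ∫ z, χ z * ((ε : ℂ) ^ 2 * helmholtzDefect lam (regNorm ε z) / (regNorm ε z : ℂ) ^ 5) := by
  have hχ1 : ∀ i, ContDiff ℝ 1 (fun x => grad3 χ x i) := fun i =>
    contDiff_grad3 (n := 1) (by convert! hχ using 1) i
  have hc1 := fun i => hasCompactSupport_grad3 hχc i
  have hc2 := fun i => hasCompactSupport_grad3 (hc1 i) i
  have ct : Continuous fun z => radTheta lam (regNorm ε z) := continuous_radial_regNorm
      (fun r hr => (hasDerivAt_radTheta lam hr).continuousAt) hε
  have cs : Continuous fun z => radSlope lam (regNorm ε z) := continuous_radial_regNorm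
      (fun r hr => (hasDerivAt_radSlope lam hr).continuousAt) hε
  have cd : Continuous fun z => (regNorm ε z : ℂ)⁻¹ * radSlopeDeriv lam (regNorm ε z) :=
    continuous_radial_regNorm (f := fun r => (r : ℂ)⁻¹ * radSlopeDeriv lam r)
      (fun r hr => ((Complex.continuous_ofReal.continuousAt).inv₀ (by exact_mod_cast hr)).mul
      (continuousAt_radSlopeDeriv lam r hr)) hε
  have step : ∀ i, ∫ z, grad3 (fun x => grad3 χ x i) z i * radTheta lam (regNorm ε z) =
      ∫ z, χ z * (radSlope lam (regNorm ε z) + (z i : ℂ) ^ 2 *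
        ((regNorm ε z : ℂ)⁻¹ * radSlopeDeriv lam (regNorm ε z))) := fun i => by
    rw [integral_grad3_mul_radTheta_reg lam (hχ1 i) (hc1 i) i hε,
      integral_grad3_mul_radSlope_reg lam (hχ.of_le (by norm_num)) hχc i hε, neg_neg]
  simp_rw [add_mul, Finset.sum_mul]
  rw [integral_add, integral_finsetSum]
  · simp_rw [step]
    rw [← integral_finsetSum, ← integral_add]
    · congr 1
      ext z
      have hD := regNorm_pos_of_left hε z
      have hD' : (regNorm ε z : ℂ) ≠ 0 := by exact_mod_cast hD.ne'
      have h3 := three_mul_radSlope_add lam hD.ne'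
      have hz : ∑ i, (z i : ℂ) ^ 2 = (regNorm ε z : ℂ) ^ 2 - (ε : ℂ) ^ 2 := by
        have h4 : ∑ i, (z i) ^ 2 = regNorm ε z ^ 2 - ε ^ 2 := by
          rw [regNorm_sq, EuclideanSpace.norm_sq_eq]; simp
        exact_mod_cast h4
      have h5 : lam ^ 2 * radTheta lam (regNorm ε z) =
        -(3 * radSlope lam (regNorm ε z) + regNorm ε z * radSlopeDeriv lam (regNorm ε z)) := by
        rw [h3]; ring
      rw [mul_assoc (lam ^ 2), mul_left_comm (lam ^ 2), h5]
      rw [← Finset.mul_sum, Finset.sum_add_distrib, ← Finset.sum_mul, hz]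
      simp only [Finset.sum_const, Finset.card_univ, Fintype.card_fin, nsmul_eq_mul]
      rw [radSlopeDeriv_eq]
      field_simp
      push_cast
      ring
    · refine integrable_finsetSum _ fun i _ => ?_
      exact (hχ.continuous.mul (cs.add (Continuous.mul (by fun_prop) cd))).integrable_of_hasCompactSupport
        hχc.mul_right
    · exact ((continuous_const.mul hχ.continuous).mul ct).integrable_of_hasCompactSupport
        (hχc.mul_left.mul_right)
    · intro i _
      exact (hχ.continuous.mul (cs.add (Continuous.mul (by fun_prop) cd))).integrable_of_hasCompactSupport
        hχc.mul_right
  · exact fun i _ => ((continuous_grad3 (hχ1 i) i).mul ct).integrable_of_hasCompactSupport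
      (hc2 i).mul_right
  · refine integrable_finsetSum _ fun i _ => ?_
    exact ((continuous_grad3 (hχ1 i) i).mul ct).integrable_of_hasCompactSupport
      (hc2 i).mul_right
  · exact ((continuous_const.mul hχ.continuous).mul ct).integrable_of_hasCompactSupport
        (hχc.mul_left.mul_right)

lemma integrable_regNorm_one_pow : Integrable fun w : R3 => (regNorm 1 w ^ 5)⁻¹ := by
  have h := integrable_rpow_neg_one_add_norm_sq (E := R3) (μ := volume) (r := 5) (by simp; norm_num)
  refine h.congr (Eventually.of_forall fun w => ?_)
  have : regNorm 1 w = (1 + ‖w‖ ^ 2) ^ (1 / 2 : ℝ) := by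
    rw [regNorm, Real.sqrt_eq_rpow]; ring_nf
  simp only
  rw [this, ← Real.rpow_natCast _ 5, ← Real.rpow_mul (by positivity),
    ← Real.rpow_neg (by positivity)]
  norm_num

lemma integral_regNorm_one_pow : ∫ w : R3, (regNorm 1 w ^ 5)⁻¹ = 4 * Real.pi / 3 := by
  have h0 := integral_fun_norm_addHaar (volume : Measure R3) (fun r : ℝ => (√(r ^ 2 + 1 ^ 2) ^ 5)⁻¹)
  have hi := (integrable_fun_norm_addHaar (volume : Measure R3)
    (f := fun r : ℝ => (√(r ^ 2 + 1 ^ 2) ^ 5)⁻¹)).1 integrable_regNorm_one_pow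
  have hlim : Tendsto (fun r : ℝ => (r ^ 2 / (r ^ 2 + 1)) ^ (3 / 2 : ℝ) / 3) atTop
      (𝓝 (1 ^ (3 / 2 : ℝ) / 3)) := by
    refine Tendsto.div_const (Tendsto.rpow_const ?_ (by norm_num)) 3
    have : Tendsto (fun r : ℝ => 1 - (r ^ 2 + 1)⁻¹) atTop (𝓝 (1 - 0)) :=
      tendsto_const_nhds.sub (tendsto_inv_atTop_zero.comp
        ((tendsto_pow_atTop (by norm_num)).atTop_add tendsto_const_nhds))
    rw [sub_zero] at this
    refine this.congr fun r => ?_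
    have : r ^ 2 + 1 ≠ 0 := by positivity
    field_simp
    ring
  have hF : ∀ r ∈ Set.Ioi (0 : ℝ), HasDerivAt
      (fun r : ℝ => (r ^ 2 / (r ^ 2 + 1)) ^ (3 / 2 : ℝ) / 3)
      (r ^ (Module.finrank ℝ R3 - 1) • (√(r ^ 2 + 1 ^ 2) ^ 5)⁻¹) r := by
    intro r hr
    have hr' : 0 < r := hr
    have hp : 0 < r ^ 2 + 1 := by positivity
    have h1 : HasDerivAt (fun r : ℝ => r ^ 2) (2 * r) r := by simpa using hasDerivAt_pow 2 r
    have h2 := ((h1.div (h1.add_const 1) hp.ne').rpow_const (p := 3 / 2)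
      (Or.inl (div_pos (by positivity) hp).ne')).div_const 3
    convert! h2 using 1
    have hs : (r ^ 2 / (r ^ 2 + 1)) ^ ((3 / 2 : ℝ) - 1) = r / √(r ^ 2 + 1) := by
      rw [show (3 / 2 : ℝ) - 1 = 1 / 2 by norm_num, ← Real.sqrt_eq_rpow,
        Real.sqrt_div' _ hp.le, Real.sqrt_sq hr'.le]
    have hq : √(r ^ 2 + 1) ^ 2 = r ^ 2 + 1 := Real.sq_sqrt hp.le
    have hq0 : 0 < √(r ^ 2 + 1) := Real.sqrt_pos.2 hp
    simp only [Pi.div_apply]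
    rw [hs]
    simp only [finrank_euclideanSpace, Fintype.card_fin, one_pow, smul_eq_mul]
    rw [show √(r ^ 2 + 1) ^ 5 = (√(r ^ 2 + 1) ^ 2) ^ 2 * √(r ^ 2 + 1) by ring, hq]
    field_simp
    ring
  have hc : ContinuousWithinAt (fun r : ℝ => (r ^ 2 / (r ^ 2 + 1)) ^ (3 / 2 : ℝ) / 3)
      (Set.Ici 0) 0 := by
    refine ContinuousAt.continuousWithinAt ?_
    refine ContinuousAt.div_const (ContinuousAt.rpow_const ?_ (Or.inr (by norm_num))) 3
    exact ContinuousAt.div (by fun_prop) (by fun_prop) (by norm_num)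
  have h1 := integral_Ioi_of_hasDerivAt_of_tendsto hc hF hi hlim
  have h2 : (volume : Measure R3).real (Metric.ball 0 1) = 4 * Real.pi / 3 := by
    rw [Measure.real, EuclideanSpace.volume_ball_fin_three]
    simp only [ENNReal.ofReal_one, one_pow, one_mul]
    rw [ENNReal.toReal_ofReal (by positivity)]
    ring
  have h3 : ∫ w : R3, (regNorm 1 w ^ 5)⁻¹ = ∫ w : R3, (√(‖w‖ ^ 2 + 1 ^ 2) ^ 5)⁻¹ := rfl
  rw [h3, h0, h1, h2]
  simp
  ring

lemma regNorm_smul {ε : ℝ} (hε : 0 < ε) (w : R3) : regNorm ε (ε • w) = ε * regNorm 1 w := by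
  rw [regNorm, regNorm, norm_smul, Real.norm_eq_abs, abs_of_pos hε,
    show (ε * ‖w‖) ^ 2 + ε ^ 2 = ε ^ 2 * (‖w‖ ^ 2 + 1 ^ 2) by ring, Real.sqrt_mul (by positivity),
    Real.sqrt_sq hε.le]

lemma tendsto_integral_defect (lam : ℂ) {χ : R3 → ℂ} (hχ : Continuous χ)
    (hχc : HasCompactSupport χ) :
    Tendsto (fun ε : ℝ => ∫ z, χ z * ((ε : ℂ) ^ 2 * helmholtzDefect lam (regNorm ε z) /
      (regNorm ε z : ℂ) ^ 5)) (𝓝[>] 0) (𝓝 (χ 0)) := by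
  obtain ⟨R, hR0, hR⟩ := hχc.isCompact.isBounded.subset_ball_lt 0 0
  obtain ⟨M, hM⟩ := hχ.bounded_above_of_compact_support hχc
  obtain ⟨C, hC⟩ := (isCompact_Icc (a := (0 : ℝ)) (b := R + 1)).exists_bound_of_continuousOn
    (continuous_helmholtzDefect lam).continuousOn
  have hscale : ∀ ε : ℝ, 0 < ε → ∫ z, χ z * ((ε : ℂ) ^ 2 * helmholtzDefect lam (regNorm ε z) /
      (regNorm ε z : ℂ) ^ 5) = ∫ w, χ (ε • w) * helmholtzDefect lam (ε * regNorm 1 w) *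
        (((regNorm 1 w ^ 5)⁻¹ : ℝ) : ℂ) := by
    intro ε hε
    have h := Measure.integral_comp_smul (volume : Measure R3) (fun z => χ z * ((ε : ℂ) ^ 2 *
      helmholtzDefect lam (regNorm ε z) / (regNorm ε z : ℂ) ^ 5)) ε
    have hε3 : (0 : ℝ) < ε ^ 3 := by positivity
    simp only [finrank_euclideanSpace, Fintype.card_fin] at h
    rw [abs_of_pos (by positivity)] at h
    have h' : ∫ z, χ z * ((ε : ℂ) ^ 2 * helmholtzDefect lam (regNorm ε z) /
      (regNorm ε z : ℂ) ^ 5) = ε ^ 3 • ∫ w, χ (ε • w) * ((ε : ℂ) ^ 2 *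
      helmholtzDefect lam (regNorm ε (ε • w)) / (regNorm ε (ε • w) : ℂ) ^ 5) := by
      rw [h, smul_smul, mul_inv_cancel₀ hε3.ne', one_smul]
    rw [h', ← integral_smul]
    congr 1
    ext w
    have hw : (regNorm 1 w : ℂ) ≠ 0 := by
      exact_mod_cast (regNorm_pos_of_left one_ne_zero w).ne'
    have hε' : (ε : ℂ) ≠ 0 := by exact_mod_cast hε.ne'
    rw [regNorm_smul hε, Complex.real_smul]
    push_cast
    field_simp
  have hlim : χ 0 = ∫ w : R3, χ 0 * helmholtzDefect lam 0 * (((regNorm 1 w ^ 5)⁻¹ : ℝ) : ℂ) := by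
    rw [integral_const_mul, integral_complex_ofReal, integral_regNorm_one_pow, helmholtzDefect]
    have hpi : (Real.pi : ℂ) ≠ 0 := by simp [Real.pi_ne_zero]
    push_cast
    simp
    field_simp
  rw [hlim]
  have hcongr : (fun ε : ℝ => ∫ w, χ (ε • w) * helmholtzDefect lam (ε * regNorm 1 w) *
        (((regNorm 1 w ^ 5)⁻¹ : ℝ) : ℂ)) =ᶠ[𝓝[>] 0] (fun ε : ℝ => ∫ z, χ z * ((ε : ℂ) ^ 2 *
          helmholtzDefect lam (regNorm ε z) / (regNorm ε z : ℂ) ^ 5)) := by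
    filter_upwards [self_mem_nhdsWithin] with ε hε using (hscale ε hε).symm
  refine Tendsto.congr' hcongr ?_
  have hreg : Continuous (regNorm 1) := continuous_regNorm_comp continuous_const continuous_id
  have hdef := continuous_helmholtzDefect lam
  refine tendsto_integral_filter_of_dominated_convergence
    (fun w => M * C * (regNorm 1 w ^ 5)⁻¹) ?_ ?_ (integrable_regNorm_one_pow.const_mul _) ?_
  · refine Eventually.of_forall fun ε => ?_
    refine AEStronglyMeasurable.mul (Continuous.aestronglyMeasurable (by fun_prop)) ?_
    exact (Complex.continuous_ofReal.comp_aestronglyMeasurable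
      integrable_regNorm_one_pow.aestronglyMeasurable)
  · filter_upwards [Ioo_mem_nhdsGT (zero_lt_one (α := ℝ))] with ε hε
    refine Eventually.of_forall fun w => ?_
    have h5 : 0 ≤ (regNorm 1 w ^ 5)⁻¹ := inv_nonneg.2 (pow_nonneg (regNorm_nonneg _ _) _)
    rw [norm_mul, Complex.norm_of_nonneg h5]
    refine mul_le_mul_of_nonneg_right ?_ h5
    by_cases hw : ε • w ∈ Metric.ball (0 : R3) R
    · rw [norm_mul]
      refine mul_le_mul (hM _) (hC _ ⟨mul_nonneg hε.1.le (regNorm_nonneg _ _), ?_⟩)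
        (norm_nonneg _) ((norm_nonneg _).trans (hM 0))
      rw [← regNorm_smul hε.1]
      refine (regNorm_le _ _).trans ?_
      rw [abs_of_pos hε.1]
      exact add_le_add (by simpa using (Metric.mem_ball.1 hw).le) hε.2.le
    · rw [image_eq_zero_of_notMem_tsupport (fun h => hw (hR h)), zero_mul, norm_zero]
      have hM0 : 0 ≤ M := (norm_nonneg _).trans (hM 0)
      exact mul_nonneg hM0 ((norm_nonneg _).trans (hC 0 ⟨le_rfl, by linarith⟩))
  · refine Eventually.of_forall fun w => ?_
    refine Tendsto.mul_const _ (Tendsto.mul ?_ ?_)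
    · have : ContinuousAt (fun ε : ℝ => χ (ε • w)) 0 := by fun_prop
      simpa using this.tendsto.mono_left nhdsWithin_le_nhds
    · have : ContinuousAt (fun ε : ℝ => helmholtzDefect lam (ε * regNorm 1 w)) 0 := by fun_prop
      simpa using this.tendsto.mono_left nhdsWithin_le_nhds

/-- `θ` is a fundamental solution of `Δ + λ²`. -/
lemma integral_helmholtz_radTheta (lam : ℂ) {χ : R3 → ℂ} (hχ : ContDiff ℝ 2 χ)
    (hχc : HasCompactSupport χ) :
    ∫ z, (∑ i, grad3 (fun x => grad3 χ x i) z i + lam ^ 2 * χ z) * radTheta lam (regNorm 0 z) =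
      χ 0 := by
  have hχ1 : ∀ i, ContDiff ℝ 1 (fun x => grad3 χ x i) := fun i =>
    contDiff_grad3 (n := 1) (by convert! hχ using 1) i
  have hcont : Continuous fun z => ∑ i, grad3 (fun x => grad3 χ x i) z i + lam ^ 2 * χ z :=
    (continuous_finsetSum _ fun i _ => continuous_grad3 (hχ1 i) i).add
      (continuous_const.mul hχ.continuous)
  have hcs : HasCompactSupport fun z =>
      ∑ i, grad3 (fun x => grad3 χ x i) z i + lam ^ 2 * χ z := by
    refine HasCompactSupport.add ?_ hχc.mul_left
    simp only [Fin.sum_univ_three]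
    exact (((hasCompactSupport_grad3 (hasCompactSupport_grad3 hχc 0) 0).add
      (hasCompactSupport_grad3 (hasCompactSupport_grad3 hχc 1) 1)).add
      (hasCompactSupport_grad3 (hasCompactSupport_grad3 hχc 2) 2))
  refine tendsto_nhds_unique ((tendsto_integral_mul_radTheta lam hcont hcs).congr' ?_)
    (tendsto_integral_defect lam hχ.continuous hχc)
  filter_upwards [self_mem_nhdsWithin] with ε hε
  exact integral_helmholtz_radTheta_reg lam hχ hχc (ne_of_gt hε)

/-! ### The Helmholtz potential of a test function -/

/-- The potential `y ↦ ∫ χ(x) θ(x - y) dx`. -/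
noncomputable def potential (lam : ℂ) (χ : R3 → ℂ) (y : R3) : ℂ :=
  ∫ x, χ x * helmholtzTheta lam (x - y)

lemma helmholtzTheta_neg (lam : ℂ) (z : R3) : helmholtzTheta lam (-z) = helmholtzTheta lam z := by
  simp [helmholtzTheta]

lemma measurable_helmholtzTheta (lam : ℂ) : Measurable (helmholtzTheta lam) := by
  rw [helmholtzTheta_eq]; exact measurable_radTheta_regNorm lam 0

lemma locallyIntegrable_helmholtzTheta (lam : ℂ) : LocallyIntegrable (helmholtzTheta lam) := by
  intro z
  refine ⟨Metric.ball 0 (‖z‖ + 1), Metric.isOpen_ball.mem_nhds (by simp), ?_⟩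
  obtain ⟨C, -, h⟩ := exists_bound_kernels_uniform lam (‖z‖ + 1)
  refine ((integrableOn_inv_norm_sq (‖z‖ + 1)).const_mul C).mono'
    (measurable_helmholtzTheta lam).aestronglyMeasurable ?_
  rw [ae_restrict_iff' measurableSet_ball]
  filter_upwards [ae_ne_R3 0] with w hw hwR
  rw [helmholtzTheta_eq, ← div_eq_mul_inv]
  exact (h 0 ⟨le_rfl, one_pos⟩ w hw (by simpa using (Metric.mem_ball.1 hwR).le)).1

lemma potential_eq_convolution (lam : ℂ) (χ : R3 → ℂ) :
    potential lam χ = convolution (helmholtzTheta lam) χ (ContinuousLinearMap.mul ℝ ℂ) volume := by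
  ext y
  rw [potential, convolution_def,
    ← integral_sub_left_eq_self (fun x => χ x * helmholtzTheta lam (x - y)) volume y]
  congr 1
  ext t
  rw [sub_sub_cancel_left, helmholtzTheta_neg, mul_comm]
  rfl

lemma potential_eq_integral_shift (lam : ℂ) (χ : R3 → ℂ) (y : R3) :
    potential lam χ y = ∫ z, χ (z + y) * radTheta lam (regNorm 0 z) := by
  rw [potential, ← integral_add_right_eq_self _ y]
  simp [helmholtzTheta_eq]

lemma contDiff_potential (lam : ℂ) {χ : R3 → ℂ} (hχ : ContDiff ℝ 1 χ)
    (hχc : HasCompactSupport χ) : ContDiff ℝ 1 (potential lam χ) := by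
  rw [potential_eq_convolution]
  exact hχc.contDiff_convolution_right _ (locallyIntegrable_helmholtzTheta lam) hχ

lemma grad3_potential (lam : ℂ) {χ : R3 → ℂ} (hχ : ContDiff ℝ 1 χ)
    (hχc : HasCompactSupport χ) (y : R3) (i : Fin 3) :
    grad3 (potential lam χ) y i = potential lam (fun x => grad3 χ x i) y := by
  rw [grad3, potential_eq_convolution, potential_eq_convolution,
    (hχc.hasFDerivAt_convolution_right (ContinuousLinearMap.mul ℝ ℂ)
      (locallyIntegrable_helmholtzTheta lam) hχ y).fderiv,
    convolution_precompR_apply _ (locallyIntegrable_helmholtzTheta lam) (hχc.fderiv (𝕜 := ℝ))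
      (hχ.continuous_fderiv (by simp))]
  rfl

lemma potential_grad3 (lam : ℂ) {χ : R3 → ℂ} (hχ : ContDiff ℝ 1 χ)
    (hχc : HasCompactSupport χ) (y : R3) (i : Fin 3) :
    potential lam (fun x => grad3 χ x i) y =
      -∫ x, χ x * (((x - y) i : ℝ) * radSlope lam ‖x - y‖) := by
  have h := integral_grad3_mul_radTheta lam (χ := fun z => χ (z + y))
    (hχ.comp (contDiff_id.add contDiff_const)) (hχc.comp_homeomorph (Homeomorph.addRight y)) i
  rw [potential_eq_integral_shift]
  simp_rw [grad3_comp_add] at h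
  rw [h, ← integral_add_right_eq_self (fun x => χ x * _) y]
  simp [regNorm_zero]

lemma potential_helmholtz (lam : ℂ) {χ : R3 → ℂ} (hχ : ContDiff ℝ 2 χ)
    (hχc : HasCompactSupport χ) (y : R3) :
    ∑ i, potential lam (fun x => grad3 (fun x => grad3 χ x i) x i) y +
      lam ^ 2 * potential lam χ y = χ y := by
  have h := integral_helmholtz_radTheta lam (χ := fun z => χ (z + y))
    (hχ.comp (contDiff_id.add contDiff_const)) (hχc.comp_homeomorph (Homeomorph.addRight y))
  have hχ1 : ∀ i, ContDiff ℝ 1 (fun x => grad3 χ x i) := fun i =>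
    contDiff_grad3 (n := 1) (by convert! hχ using 1) i
  have e : ∀ i z, grad3 (fun x => grad3 (fun z => χ (z + y)) x i) z i =
      grad3 (fun x => grad3 χ x i) (z + y) i := fun i z => by
    rw [show (fun x => grad3 (fun z => χ (z + y)) x i) =
      fun x => (fun w => grad3 χ w i) (x + y) from funext fun x => by rw [grad3_comp_add]]
    exact grad3_comp_add (fun w => grad3 χ w i) y z i
  simp_rw [e] at h
  rw [zero_add] at h
  rw [← h]
  simp_rw [potential_eq_integral_shift]
  have hint : ∀ ψ : R3 → ℂ, Continuous ψ → HasCompactSupport ψ →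
      Integrable fun z => ψ (z + y) * radTheta lam (regNorm 0 z) := fun ψ h1 h2 => by
    refine integrable_mul_of_norm_le_inv_norm_sq (h1.comp (by fun_prop))
      (h2.comp_homeomorph (Homeomorph.addRight y))
      (measurable_radTheta_regNorm lam 0).aestronglyMeasurable fun R => ?_
    obtain ⟨C, -, h⟩ := exists_bound_kernels_uniform lam R
    exact ⟨C, fun z hz hzR => (h 0 ⟨le_rfl, one_pos⟩ z hz hzR).1⟩
  have hi : ∀ i, Integrable fun z => grad3 (fun x => grad3 χ x i) (z + y) i *
      radTheta lam (regNorm 0 z) := fun i => hint _ (continuous_grad3 (hχ1 i) i)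
        (hasCompactSupport_grad3 (hasCompactSupport_grad3 hχc i) i)
  rw [← integral_finsetSum _ fun i _ => hi i, ← integral_const_mul, ← integral_add
    (integrable_finsetSum _ fun i _ => hi i) ((hint _ hχ.continuous hχc).const_mul _)]
  congr 1
  ext z
  rw [add_mul, Finset.sum_mul, mul_assoc]

/-! ### Positive kernels acting on `L^p` -/

/-- The nonnegative kernel `k` acts boundedly on `L^p(μ)`. -/
def IsLpKernel {α : Type*} [MeasurableSpace α] (p : ℝ) (μ : Measure α) (k : α → α → ℝ≥0∞) :
    Prop :=
  Measurable (Function.uncurry k) ∧ ∃ C : ℝ≥0∞, C ≠ ⊤ ∧ ∀ f : α → ℝ≥0∞, AEMeasurable f μ →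
    ∫⁻ x, (∫⁻ y, k x y * f y ∂μ) ^ p ∂μ ≤ C * ∫⁻ y, f y ^ p ∂μ

namespace IsLpKernel

variable {α : Type*} [MeasurableSpace α] {p : ℝ} {μ : Measure α} {k l : α → α → ℝ≥0∞}

lemma mono (hk : IsLpKernel p μ k) (hp : 0 ≤ p) (hl : Measurable (Function.uncurry l))
    (h : ∀ᵐ x ∂μ, ∀ᵐ y ∂μ, l x y ≤ k x y) : IsLpKernel p μ l := by
  obtain ⟨-, C, hC, hk⟩ := hk
  refine ⟨hl, C, hC, fun f hf => (lintegral_mono_ae ?_).trans (hk f hf)⟩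
  filter_upwards [h] with x hx
  refine ENNReal.rpow_le_rpow (lintegral_mono_ae ?_) hp
  filter_upwards [hx] with y hy
  gcongr

lemma add [SFinite μ] (hk : IsLpKernel p μ k) (hl : IsLpKernel p μ l) (hp : 1 ≤ p) :
    IsLpKernel p μ (fun x y => k x y + l x y) := by
  obtain ⟨mk, C, hC, hk⟩ := hk
  obtain ⟨ml, D, hD, hl⟩ := hl
  refine ⟨mk.add ml, 2 ^ (p - 1) * (C + D), ?_, fun f hf => ?_⟩
  · exact ENNReal.mul_ne_top (ENNReal.rpow_ne_top_of_nonneg (by linarith) (by simp))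
      (ENNReal.add_ne_top.2 ⟨hC, hD⟩)
  have m : ∀ k : α → α → ℝ≥0∞, Measurable (Function.uncurry k) → ∀ x,
      AEMeasurable (fun y => k x y * f y) μ := fun k hk x =>
    (hk.comp measurable_prodMk_left).aemeasurable.mul hf
  calc ∫⁻ x, (∫⁻ y, (k x y + l x y) * f y ∂μ) ^ p ∂μ
      = ∫⁻ x, ((∫⁻ y, k x y * f y ∂μ) + ∫⁻ y, l x y * f y ∂μ) ^ p ∂μ := by
        simp_rw [add_mul]
        congr 1
        ext x
        rw [lintegral_add_left' (m k mk x)]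
    _ ≤ ∫⁻ x, 2 ^ (p - 1) * ((∫⁻ y, k x y * f y ∂μ) ^ p + (∫⁻ y, l x y * f y ∂μ) ^ p) ∂μ :=
        lintegral_mono fun x => ENNReal.rpow_add_le_mul_rpow_add_rpow _ _ hp
    _ = 2 ^ (p - 1) * ((∫⁻ x, (∫⁻ y, k x y * f y ∂μ) ^ p ∂μ) +
          ∫⁻ x, (∫⁻ y, l x y * f y ∂μ) ^ p ∂μ) := by
        rw [lintegral_const_mul', lintegral_add_left']
        · have h1 : AEMeasurable (fun q : α × α => k q.1 q.2 * f q.2) (μ.prod μ) :=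
            mk.aemeasurable.mul hf.comp_snd
          exact h1.lintegral_prod_right'.pow_const p
        · exact ENNReal.rpow_ne_top_of_nonneg (by linarith) (by simp)
    _ ≤ 2 ^ (p - 1) * (C * ∫⁻ y, f y ^ p ∂μ + D * ∫⁻ y, f y ^ p ∂μ) := by
        gcongr
        · exact hk f hf
        · exact hl f hf
    _ = _ := by ring

lemma const_mul (hk : IsLpKernel p μ k) (hp : 0 ≤ p) {c : ℝ≥0∞} (hc : c ≠ ⊤) :
    IsLpKernel p μ (fun x y => c * k x y) := by
  obtain ⟨mk, C, hC, hk⟩ := hk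
  refine ⟨mk.const_mul c, c ^ p * C,
    ENNReal.mul_ne_top (ENNReal.rpow_ne_top_of_nonneg hp hc) hC, fun f hf => ?_⟩
  simp_rw [mul_assoc, lintegral_const_mul' c _ hc, ENNReal.mul_rpow_of_nonneg _ _ hp]
  rw [lintegral_const_mul' _ _ (ENNReal.rpow_ne_top_of_nonneg hp hc)]
  gcongr
  exact hk f hf

lemma zero (hp : 0 < p) : IsLpKernel p μ (fun _ _ => 0) :=
  ⟨measurable_const, 0, by simp, fun f _ => by simp [hp]⟩

lemma finset_sum [SFinite μ] {ι : Type*} (s : Finset ι) {k : ι → α → α → ℝ≥0∞}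
    (hk : ∀ i ∈ s, IsLpKernel p μ (k i)) (hp : 1 ≤ p) :
    IsLpKernel p μ (fun x y => ∑ i ∈ s, k i x y) := by
  classical
  induction s using Finset.induction_on with
  | empty => simpa using zero (by linarith)
  | insert a s ha ih =>
    simp_rw [Finset.sum_insert ha]
    exact (hk a (Finset.mem_insert_self a s)).add
      (ih fun i hi => hk i (Finset.mem_insert_of_mem hi)) hp

/-- **Schur's test.** -/
lemma of_schur [SFinite μ] {q : ℝ} (hpq : p.HolderConjugate q)
    (hk : Measurable (Function.uncurry k)) {w : α → ℝ≥0∞} (hw : Measurable w)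
    (hw0 : ∀ x, w x ≠ 0) (hw1 : ∀ x, w x ≠ ⊤) {C : ℝ≥0∞} (hC : C ≠ ⊤)
    (h1 : ∀ x, ∫⁻ y, k x y * w y ^ q ∂μ ≤ C * w x ^ q)
    (h2 : ∀ y, ∫⁻ x, k x y * w x ^ p ∂μ ≤ C * w y ^ p) : IsLpKernel p μ k := by
  have hp0 := hpq.pos
  have hq0 := hpq.symm.pos
  have meas : ∀ f : α → ℝ≥0∞, Measurable f →
      ∫⁻ x, (∫⁻ y, k x y * f y ∂μ) ^ p ∂μ ≤ C ^ (p / q) * C * ∫⁻ y, f y ^ p ∂μ := by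
    intro f hf
    have kx : ∀ x, Measurable (k x) := fun x => hk.comp measurable_prodMk_left
    have ky : ∀ y, Measurable fun x => k x y := fun y => hk.comp measurable_prodMk_right
    have hold : ∀ x, (∫⁻ y, k x y * f y ∂μ) ^ p ≤
        C ^ (p / q) * ∫⁻ y, k x y * w x ^ p * (f y ^ p * (w y ^ p)⁻¹) ∂μ := by
      intro x
      have e : ∀ y, k x y * f y =
          (k x y ^ (1 / p) * (f y * (w y)⁻¹)) * (k x y ^ (1 / q) * w y) := fun y => by
        have : k x y ^ (1 / p) * k x y ^ (1 / q) = k x y := by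
          rw [← ENNReal.rpow_add_of_nonneg _ _ (by positivity) (by positivity)]
          have := hpq.inv_add_inv_eq_one
          rw [one_div, one_div, this, ENNReal.rpow_one]
        calc k x y * f y = (k x y ^ (1 / p) * k x y ^ (1 / q)) * f y * ((w y)⁻¹ * w y) := by
              rw [this, ENNReal.inv_mul_cancel (hw0 y) (hw1 y), mul_one]
          _ = _ := by ring
      simp_rw [e]
      have H := ENNReal.lintegral_mul_le_Lp_mul_Lq μ hpq
        (f := fun y => k x y ^ (1 / p) * (f y * (w y)⁻¹)) (g := fun y => k x y ^ (1 / q) * w y)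
        (((kx x).pow_const _).mul (hf.mul hw.inv)).aemeasurable
        (((kx x).pow_const _).mul hw).aemeasurable
      have H2 := ENNReal.rpow_le_rpow H hp0.le
      refine H2.trans ?_
      rw [ENNReal.mul_rpow_of_nonneg _ _ hp0.le, ← ENNReal.rpow_mul, ← ENNReal.rpow_mul,
        one_div_mul_cancel hp0.ne', ENNReal.rpow_one, mul_comm]
      have e1 : ∀ y, (k x y ^ (1 / q) * w y) ^ q = k x y * w y ^ q := fun y => by
        rw [ENNReal.mul_rpow_of_nonneg _ _ hq0.le, ← ENNReal.rpow_mul,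
          one_div_mul_cancel hq0.ne', ENNReal.rpow_one]
      have e2 : ∀ y, (k x y ^ (1 / p) * (f y * (w y)⁻¹)) ^ p = k x y * (f y ^ p * (w y ^ p)⁻¹) :=
        fun y => by
        rw [ENNReal.mul_rpow_of_nonneg _ _ hp0.le, ENNReal.mul_rpow_of_nonneg _ _ hp0.le,
          ← ENNReal.rpow_mul, one_div_mul_cancel hp0.ne', ENNReal.rpow_one, ENNReal.inv_rpow]
      simp_rw [e1, e2]
      have b : (∫⁻ y, k x y * w y ^ q ∂μ) ^ (1 / q * p) ≤ C ^ (p / q) * w x ^ p := by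
        refine (ENNReal.rpow_le_rpow (h1 x) (by positivity)).trans ?_
        rw [ENNReal.mul_rpow_of_nonneg _ _ (by positivity), ← ENNReal.rpow_mul]
        have : q * (1 / q * p) = p := by field_simp
        rw [this]
        have : 1 / q * p = p / q := by ring
        rw [this]
      refine (mul_le_mul_left b _).trans ?_
      rw [mul_assoc, ← lintegral_const_mul _ (f := fun y => k x y * (f y ^ p * (w y ^ p)⁻¹)) (((kx x)).mul ((hf.pow_const _).mul
        (hw.pow_const _).inv))]
      refine le_of_eq ?_
      congr 2
      ext y
      ring
    calc ∫⁻ x, (∫⁻ y, k x y * f y ∂μ) ^ p ∂μ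
        ≤ ∫⁻ x, C ^ (p / q) * ∫⁻ y, k x y * w x ^ p * (f y ^ p * (w y ^ p)⁻¹) ∂μ ∂μ :=
          lintegral_mono hold
      _ = C ^ (p / q) * ∫⁻ y, ∫⁻ x, k x y * w x ^ p * (f y ^ p * (w y ^ p)⁻¹) ∂μ ∂μ := by
          rw [lintegral_const_mul' _ _ (ENNReal.rpow_ne_top_of_nonneg (by positivity) hC),
            lintegral_lintegral_swap]
          exact ((hk.mul ((hw.comp measurable_fst).pow_const _)).mul
            (((hf.comp measurable_snd).pow_const _).mul
              ((hw.comp measurable_snd).pow_const _).inv)).aemeasurable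
      _ ≤ C ^ (p / q) * ∫⁻ y, C * f y ^ p ∂μ := by
          gcongr with y
          rw [lintegral_mul_const _ (f := fun x => k x y * w x ^ p) ((ky y).mul (hw.pow_const _))]
          refine (mul_le_mul_left (h2 y) _).trans ?_
          have w0 : w y ^ p ≠ 0 := by
            simp [ENNReal.rpow_eq_zero_iff, hw0 y, hw1 y]
          have w1 : w y ^ p ≠ ⊤ := ENNReal.rpow_ne_top_of_nonneg hp0.le (hw1 y)
          calc C * w y ^ p * (f y ^ p * (w y ^ p)⁻¹) = C * f y ^ p * (w y ^ p * (w y ^ p)⁻¹) := by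
                ring
            _ ≤ C * f y ^ p := by rw [ENNReal.mul_inv_cancel w0 w1, mul_one]
      _ = _ := by rw [lintegral_const_mul' _ _ hC, mul_assoc]
  refine ⟨hk, C ^ (p / q) * C,
    ENNReal.mul_ne_top (ENNReal.rpow_ne_top_of_nonneg (by positivity) hC) hC, fun f hf => ?_⟩
  have e1 : ∀ x, ∫⁻ y, k x y * f y ∂μ = ∫⁻ y, k x y * hf.mk f y ∂μ := fun x =>
    lintegral_congr_ae (by filter_upwards [hf.ae_eq_mk] with y hy; rw [hy])
  have e2 : ∫⁻ y, f y ^ p ∂μ = ∫⁻ y, hf.mk f y ^ p ∂μ :=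
    lintegral_congr_ae (by filter_upwards [hf.ae_eq_mk] with y hy; rw [hy])
  simp_rw [e1, e2]
  exact meas _ hf.measurable_mk

section Apply

variable {K : α → α → ℂ} {f : α → ℂ}

lemma lintegral_rpow_lt_top (hK : IsLpKernel p μ fun x y => ‖K x y‖ₑ) (hp : 1 < p)
    (hf : MemLp f (ENNReal.ofReal p) μ) :
    ∫⁻ x, (∫⁻ y, ‖K x y‖ₑ * ‖f y‖ₑ ∂μ) ^ p ∂μ < ⊤ := by
  obtain ⟨-, C, hC, h⟩ := hK
  refine (h _ hf.1.enorm).trans_lt (ENNReal.mul_lt_top hC.lt_top ?_)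
  have := (eLpNorm_lt_top_iff_lintegral_rpow_enorm_lt_top (by simp; linarith) (by simp)).1 hf.2
  rwa [ENNReal.toReal_ofReal (by linarith)] at this

lemma aestronglyMeasurable_prod [SFinite μ] (mK : Measurable (Function.uncurry K))
    (hf : AEStronglyMeasurable f μ) :
    AEStronglyMeasurable (fun z : α × α => K z.1 z.2 * f z.2) (μ.prod μ) :=
  mK.aestronglyMeasurable.mul hf.comp_snd

variable [IsFiniteMeasure μ]

lemma integrable_prod (hK : IsLpKernel p μ fun x y => ‖K x y‖ₑ)
    (mK : Measurable (Function.uncurry K)) (hp : 1 < p) (hf : MemLp f (ENNReal.ofReal p) μ) :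
    Integrable (fun z : α × α => K z.1 z.2 * f z.2) (μ.prod μ) := by
  have hm := aestronglyMeasurable_prod mK hf.1
  refine ⟨hm, ?_⟩
  rw [hasFiniteIntegral_iff_enorm, lintegral_prod _ hm.enorm]
  simp_rw [enorm_mul]
  have h := lintegral_rpow_lt_top hK hp hf
  calc ∫⁻ x, ∫⁻ y, ‖K x y‖ₑ * ‖f y‖ₑ ∂μ ∂μ
      ≤ ∫⁻ x, (1 + (∫⁻ y, ‖K x y‖ₑ * ‖f y‖ₑ ∂μ) ^ p) ∂μ := by
        gcongr with x
        generalize ∫⁻ y, ‖K x y‖ₑ * ‖f y‖ₑ ∂μ = a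
        rcases le_total a 1 with h | h
        · exact h.trans le_self_add
        · refine le_add_left ?_
          simpa using ENNReal.rpow_le_rpow_of_exponent_le h hp.le
    _ < ⊤ := by
        rw [lintegral_add_left measurable_const]
        exact ENNReal.add_lt_top.2 ⟨by simp, h⟩

lemma ae_integrable (hK : IsLpKernel p μ fun x y => ‖K x y‖ₑ)
    (mK : Measurable (Function.uncurry K)) (hp : 1 < p) (hf : MemLp f (ENNReal.ofReal p) μ) :
    ∀ᵐ x ∂μ, Integrable (fun y => K x y * f y) μ :=
  (integrable_prod hK mK hp hf).prod_right_ae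

lemma memLp (hK : IsLpKernel p μ fun x y => ‖K x y‖ₑ)
    (mK : Measurable (Function.uncurry K)) (hp : 1 < p) (hf : MemLp f (ENNReal.ofReal p) μ) :
    MemLp (fun x => ∫ y, K x y * f y ∂μ) (ENNReal.ofReal p) μ := by
  refine ⟨(aestronglyMeasurable_prod mK hf.1).integral_prod_right', ?_⟩
  rw [eLpNorm_lt_top_iff_lintegral_rpow_enorm_lt_top (by simp; linarith) (by simp),
    ENNReal.toReal_ofReal (by linarith)]
  refine lt_of_le_of_lt (lintegral_mono fun x => ?_) (lintegral_rpow_lt_top hK hp hf)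
  refine ENNReal.rpow_le_rpow ((enorm_integral_le_lintegral_enorm _).trans ?_) (by linarith)
  simp_rw [enorm_mul]
  exact le_rfl

lemma integral_mul_integral (hK : IsLpKernel p μ fun x y => ‖K x y‖ₑ)
    (mK : Measurable (Function.uncurry K)) (hp : 1 < p) (hf : MemLp f (ENNReal.ofReal p) μ)
    {φ : α → ℂ} (hφ : AEStronglyMeasurable φ μ) {M : ℝ} (hM : ∀ x, ‖φ x‖ ≤ M) :
    Integrable (fun y => (∫ x, φ x * K x y ∂μ) * f y) μ ∧
    ∫ x, φ x * ∫ y, K x y * f y ∂μ ∂μ = ∫ y, (∫ x, φ x * K x y ∂μ) * f y ∂μ := by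
  have h1 : Integrable (fun z : α × α => φ z.1 * (K z.1 z.2 * f z.2)) (μ.prod μ) :=
    (integrable_prod hK mK hp hf).bdd_mul hφ.comp_fst (Eventually.of_forall fun z => hM z.1)
  have e : ∀ y, (∫ x, φ x * K x y ∂μ) * f y = ∫ x, φ x * (K x y * f y) ∂μ := fun y => by
    rw [← integral_mul_const]
    simp_rw [mul_assoc]
  simp_rw [e, ← integral_const_mul]
  exact ⟨h1.integral_prod_right, integral_integral_swap h1⟩

end Apply

end IsLpKernel

/-! ### Elementary integrals for the half-space kernel -/

lemma lintegral_eq_mul_lintegral_scale {c : ℝ} (hc : 0 < c) {f : ℝ → ℝ≥0∞} (hf : Measurable f) :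
    ∫⁻ t, f t = ENNReal.ofReal c * ∫⁻ t, f (c * t) := by
  conv_lhs => rw [← Real.smul_map_volume_mul_left hc.ne']
  rw [lintegral_smul_measure, lintegral_map hf (measurable_const_mul c), abs_of_pos hc,
    smul_eq_mul]

lemma exists_lintegral_abs_add_rpow_le : ∃ C : ℝ≥0∞, C ≠ ⊤ ∧ ∀ a c : ℝ, 0 < c →
    ∫⁻ t : ℝ, ENNReal.ofReal ((|a - t| + c) ^ (-(3 / 2) : ℝ)) ≤
      C * ENNReal.ofReal (c ^ (-(1 / 2) : ℝ)) := by
  refine ⟨∫⁻ t : ℝ, ENNReal.ofReal ((1 + ‖t‖) ^ (-(3 / 2) : ℝ)),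
    (finite_integral_one_add_norm (by simp; norm_num)).ne, fun a c hc => le_of_eq ?_⟩
  rw [lintegral_sub_left_eq_self (fun t : ℝ => ENNReal.ofReal ((|t| + c) ^ (-(3 / 2) : ℝ))) a,
    lintegral_eq_mul_lintegral_scale hc (by fun_prop)]
  have e : ∀ t : ℝ, ENNReal.ofReal ((|c * t| + c) ^ (-(3 / 2) : ℝ)) =
      ENNReal.ofReal (c ^ (-(3 / 2) : ℝ)) * ENNReal.ofReal ((1 + ‖t‖) ^ (-(3 / 2) : ℝ)) := by
    intro t
    rw [← ENNReal.ofReal_mul (by positivity), ← Real.mul_rpow hc.le (by positivity), abs_mul,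
      abs_of_pos hc, Real.norm_eq_abs]
    ring_nf
  simp_rw [e]
  rw [lintegral_const_mul' _ _ ENNReal.ofReal_ne_top, ← mul_assoc,
    ← ENNReal.ofReal_mul hc.le, mul_comm]
  congr 2
  nth_rewrite 1 [← Real.rpow_one c]
  rw [← Real.rpow_add hc]
  norm_num

lemma exists_lintegral_hilbert_le {a : ℝ} (h0 : 0 < a) (h1 : a < 1) : ∃ C : ℝ≥0∞, C ≠ ⊤ ∧
    ∀ s : ℝ, 0 < s → ∫⁻ t in Set.Ioi (0 : ℝ), ENNReal.ofReal ((s + t)⁻¹) * ENNReal.ofReal (t ^ (-a)) ≤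
      C * ENNReal.ofReal (s ^ (-a)) := by
  have hfin : ∫⁻ t, (Set.Ioi (0 : ℝ)).indicator
      (fun t => ENNReal.ofReal ((1 + t)⁻¹) * ENNReal.ofReal (t ^ (-a))) t < ⊤ := by
    rw [lintegral_indicator measurableSet_Ioi, ← Set.Ioc_union_Ioi_eq_Ioi zero_le_one]
    refine (lintegral_union_le _ _ _).trans_lt (ENNReal.add_lt_top.2 ⟨?_, ?_⟩)
    · have h := intervalIntegral.intervalIntegrable_rpow' (a := 0) (b := 1) (r := -a) (by linarith)
      rw [intervalIntegrable_iff_integrableOn_Ioc_of_le zero_le_one] at h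
      refine lt_of_le_of_lt (setLIntegral_mono' measurableSet_Ioc fun t ht => ?_)
        h.lintegral_lt_top
      calc ENNReal.ofReal ((1 + t)⁻¹) * ENNReal.ofReal (t ^ (-a))
          ≤ 1 * ENNReal.ofReal (t ^ (-a)) := by
            gcongr
            rw [ENNReal.ofReal_le_one]
            exact inv_le_one_of_one_le₀ (by linarith [ht.1])
        _ = _ := one_mul _
    · have h := integrableOn_Ioi_rpow_of_lt (a := -1 - a) (by linarith) zero_lt_one
      refine lt_of_le_of_lt (setLIntegral_mono' measurableSet_Ioi fun t ht => ?_)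
        h.lintegral_lt_top
      have ht' : (1 : ℝ) < t := ht
      rw [← ENNReal.ofReal_mul (by positivity), sub_eq_add_neg, Real.rpow_add (by linarith),
        Real.rpow_neg_one]
      gcongr
      linarith
  refine ⟨_, hfin.ne, fun s hs => le_of_eq ?_⟩
  rw [← lintegral_indicator measurableSet_Ioi, lintegral_eq_mul_lintegral_scale hs]
  · have e : ∀ t : ℝ, (Set.Ioi (0 : ℝ)).indicator
        (fun t => ENNReal.ofReal ((s + t)⁻¹) * ENNReal.ofReal (t ^ (-a))) (s * t) =
        ENNReal.ofReal (s ^ (-1 - a)) * (Set.Ioi (0 : ℝ)).indicator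
          (fun t => ENNReal.ofReal ((1 + t)⁻¹) * ENNReal.ofReal (t ^ (-a))) t := by
      intro t
      by_cases ht : 0 < t
      · have hst : 0 < s * t := mul_pos hs ht
        rw [Set.indicator_of_mem (Set.mem_Ioi.2 hst), Set.indicator_of_mem (Set.mem_Ioi.2 ht),
          ← ENNReal.ofReal_mul (by positivity), ← ENNReal.ofReal_mul (by positivity),
          ← ENNReal.ofReal_mul (by positivity), Real.mul_rpow hs.le ht.le, sub_eq_add_neg,
          Real.rpow_add hs, Real.rpow_neg_one, show s + s * t = s * (1 + t) by ring, mul_inv]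
        ring_nf
      · have hst : ¬ 0 < s * t := by
          rw [mul_pos_iff_of_pos_left hs]; exact ht
        rw [Set.indicator_of_notMem (by simpa using hst), Set.indicator_of_notMem (by simpa using ht),
          mul_zero]
    simp_rw [e]
    rw [lintegral_const_mul' _ _ ENNReal.ofReal_ne_top, ← mul_assoc, ← ENNReal.ofReal_mul hs.le,
      mul_comm]
    congr 2
    nth_rewrite 1 [← Real.rpow_one s]
    rw [← Real.rpow_add hs]
    ring_nf
  · exact Measurable.indicator (by fun_prop) measurableSet_Ioi

/-- The model kernel on the half-space `{(a, t) : t > 0}`. -/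
noncomputable def halfSpaceKernel (u v : (ℝ × ℝ) × ℝ) : ℝ≥0∞ :=
  if 0 < u.2 ∧ 0 < v.2 then
    ENNReal.ofReal ((|u.1.1 - v.1.1| + (u.2 + v.2)) ^ (-(3 / 2) : ℝ)) *
      ENNReal.ofReal ((|u.1.2 - v.1.2| + (u.2 + v.2)) ^ (-(3 / 2) : ℝ))
  else 0

/-- The weight for Schur's test on the half-space. -/
noncomputable def halfSpaceWeight (a : ℝ) (v : (ℝ × ℝ) × ℝ) : ℝ≥0∞ :=
  if 0 < v.2 then ENNReal.ofReal (v.2 ^ (-a)) else 1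

lemma measurable_halfSpaceKernel : Measurable (Function.uncurry halfSpaceKernel) := by
  unfold halfSpaceKernel Function.uncurry
  refine Measurable.ite ?_ (by fun_prop) measurable_const
  exact (measurableSet_lt measurable_const (measurable_snd.comp measurable_fst)).inter
    (measurableSet_lt measurable_const (measurable_snd.comp measurable_snd))

lemma measurable_halfSpaceWeight (a : ℝ) : Measurable (halfSpaceWeight a) := by
  unfold halfSpaceWeight
  exact Measurable.ite (measurableSet_lt measurable_const (by fun_prop)) (by fun_prop)
    measurable_const

lemma halfSpaceKernel_comm (u v : (ℝ × ℝ) × ℝ) : halfSpaceKernel u v = halfSpaceKernel v u := by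
  simp only [halfSpaceKernel, abs_sub_comm u.1.1, abs_sub_comm u.1.2, add_comm u.2,
    and_comm (a := 0 < u.2)]

lemma halfSpaceWeight_ne_zero (a : ℝ) (v : (ℝ × ℝ) × ℝ) : halfSpaceWeight a v ≠ 0 := by
  unfold halfSpaceWeight
  split_ifs with h
  · simpa using Real.rpow_pos_of_pos h _
  · exact one_ne_zero

lemma halfSpaceWeight_ne_top (a : ℝ) (v : (ℝ × ℝ) × ℝ) : halfSpaceWeight a v ≠ ⊤ := by
  unfold halfSpaceWeight
  split_ifs with h <;> simp

lemma halfSpaceWeight_rpow (a : ℝ) {r : ℝ} (hr : 0 ≤ r) (v : (ℝ × ℝ) × ℝ) :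
    halfSpaceWeight a v ^ r = halfSpaceWeight (a * r) v := by
  unfold halfSpaceWeight
  split_ifs with h
  · rw [ENNReal.ofReal_rpow_of_nonneg (by positivity) hr, ← Real.rpow_mul h.le, neg_mul]
  · simp

lemma exists_lintegral_halfSpaceKernel_le {a : ℝ} (h0 : 0 < a) (h1 : a < 1) :
    ∃ C : ℝ≥0∞, C ≠ ⊤ ∧ ∀ u, ∫⁻ v, halfSpaceKernel u v * halfSpaceWeight a v ≤
      C * halfSpaceWeight a u := by
  obtain ⟨C₁, hC₁, H₁⟩ := exists_lintegral_abs_add_rpow_le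
  obtain ⟨C₂, hC₂, H₂⟩ := exists_lintegral_hilbert_le h0 h1
  refine ⟨C₁ * C₁ * C₂, by finiteness, fun u => ?_⟩
  by_cases hu : 0 < u.2
  swap
  · simp [halfSpaceKernel, hu]
  have hm : Measurable fun v => halfSpaceKernel u v * halfSpaceWeight a v :=
    (measurable_halfSpaceKernel.comp measurable_prodMk_left).mul (measurable_halfSpaceWeight a)
  rw [Measure.volume_eq_prod, lintegral_prod_symm _ hm.aemeasurable]
  have inner : ∀ t : ℝ, ∫⁻ b : ℝ × ℝ, halfSpaceKernel u (b, t) * halfSpaceWeight a (b, t) ≤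
      (Set.Ioi (0 : ℝ)).indicator (fun t => C₁ * C₁ * (ENNReal.ofReal ((u.2 + t)⁻¹) *
        ENNReal.ofReal (t ^ (-a)))) t := by
    intro t
    by_cases ht : 0 < t
    swap
    · simp [halfSpaceKernel, ht]
    have hc : 0 < u.2 + t := by linarith
    rw [Set.indicator_of_mem (Set.mem_Ioi.2 ht)]
    simp only [halfSpaceKernel, halfSpaceWeight, hu, ht, and_self, if_true]
    rw [lintegral_mul_const' _ _ ENNReal.ofReal_ne_top, Measure.volume_eq_prod,
      lintegral_prod_mul (f := fun b : ℝ =>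
        ENNReal.ofReal ((|u.1.1 - b| + (u.2 + t)) ^ (-(3 / 2) : ℝ)))
        (g := fun b : ℝ => ENNReal.ofReal ((|u.1.2 - b| + (u.2 + t)) ^ (-(3 / 2) : ℝ)))
        (by fun_prop) (by fun_prop)]
    refine (mul_le_mul_left (mul_le_mul' (H₁ u.1.1 _ hc) (H₁ u.1.2 _ hc)) _).trans
      (le_of_eq ?_)
    have : ENNReal.ofReal ((u.2 + t) ^ (-(1 / 2) : ℝ)) * ENNReal.ofReal ((u.2 + t) ^ (-(1 / 2) : ℝ)) =
        ENNReal.ofReal ((u.2 + t)⁻¹) := by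
      rw [← ENNReal.ofReal_mul (by positivity), ← Real.rpow_add hc, ← Real.rpow_neg_one]
      norm_num
    rw [← this]
    ring
  refine (lintegral_mono inner).trans ?_
  rw [lintegral_indicator measurableSet_Ioi, lintegral_const_mul' _ _ (by finiteness),
    mul_assoc (C₁ * C₁)]
  gcongr
  refine (H₂ _ hu).trans (le_of_eq ?_)
  simp [halfSpaceWeight, hu]

lemma MeasureTheory.MeasurePreserving.isLpKernel_comp_halfSpaceKernel {p q : ℝ}
    (hpq : p.HolderConjugate q) {F : R3 → (ℝ × ℝ) × ℝ} (hF : MeasurePreserving F) (Ω : Set R3) :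
    IsLpKernel p (volume.restrict Ω) fun x y => halfSpaceKernel (F x) (F y) := by
  have hp0 := hpq.pos
  have hq0 := hpq.symm.pos
  have hp1 := hpq.lt
  have hq1 := hpq.symm.lt
  have hp1' : 1 / p < 1 := by rw [div_lt_one hp0]; exact hp1
  have hq1' : 1 / q < 1 := by rw [div_lt_one hq0]; exact hq1
  obtain ⟨C, hC, H⟩ := exists_lintegral_halfSpaceKernel_le (a := 1 / p) (by positivity) hp1'
  obtain ⟨D, hD, H'⟩ := exists_lintegral_halfSpaceKernel_le (a := 1 / q) (by positivity) hq1'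
  have hFm := hF.measurable
  have key : ∀ (a : ℝ) (u : (ℝ × ℝ) × ℝ),
      ∫⁻ y in Ω, halfSpaceKernel u (F y) * halfSpaceWeight a (F y) ≤
        ∫⁻ v, halfSpaceKernel u v * halfSpaceWeight a v := fun a u => by
    refine (setLIntegral_le_lintegral _ _).trans (le_of_eq ?_)
    exact hF.lintegral_comp (f := fun v => halfSpaceKernel u v * halfSpaceWeight a v)
      ((measurable_halfSpaceKernel.comp measurable_prodMk_left).mul (measurable_halfSpaceWeight a))
  refine IsLpKernel.of_schur hpq (w := fun x => halfSpaceWeight (1 / (p * q)) (F x)) (C := C + D)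
    (measurable_halfSpaceKernel.comp (hFm.prodMap hFm))
    ((measurable_halfSpaceWeight _).comp hFm) (fun x => halfSpaceWeight_ne_zero _ _)
    (fun x => halfSpaceWeight_ne_top _ _) (by finiteness) (fun x => ?_) fun y => ?_
  · simp_rw [halfSpaceWeight_rpow _ hq0.le]
    have : 1 / (p * q) * q = 1 / p := by field_simp
    rw [this]
    refine ((key _ _).trans (H _)).trans ?_
    gcongr
    exact le_self_add
  · simp_rw [halfSpaceWeight_rpow _ hp0.le, halfSpaceKernel_comm _ (F y)]
    have : 1 / (p * q) * p = 1 / q := by field_simp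
    rw [this]
    refine ((key _ _).trans (H' _)).trans ?_
    gcongr
    exact le_add_self

/-! ### Flattening a graph -/

/-- Coordinates in which the region above the graph of `γ` becomes a half-space. -/
noncomputable def flattenGraph (A : R3 ≃ₗᵢ[ℝ] R3) (γ : EuclideanSpace ℝ (Fin 2) → ℝ) (x : R3) :
    (ℝ × ℝ) × ℝ :=
  (((A x) 0, (A x) 1), (A x) 2 - γ (!₂[(A x) 0, (A x) 1]))

lemma continuous_toLp_pair : Continuous fun b : ℝ × ℝ => (!₂[b.1, b.2] : EuclideanSpace ℝ (Fin 2)) := by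
  refine (PiLp.continuous_toLp 2 _).comp (continuous_pi fun i => ?_)
  fin_cases i
  · exact continuous_fst
  · exact continuous_snd

lemma measurePreserving_flattenGraph (A : R3 ≃ₗᵢ[ℝ] R3) {γ : EuclideanSpace ℝ (Fin 2) → ℝ}
    (hγ : Continuous γ) : MeasurePreserving (flattenGraph A γ) := by
  have h1 : MeasurePreserving A := A.measurePreserving
  have h2 : MeasurePreserving (fun x : R3 => (WithLp.ofLp x : Fin 3 → ℝ)) :=
    PiLp.volume_preserving_ofLp (Fin 3)
  have h3 := volume_preserving_piFinSuccAbove (fun _ : Fin 3 => ℝ) 2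
  have h4 : MeasurePreserving (Prod.map (id : ℝ → ℝ) (MeasurableEquiv.finTwoArrow (α := ℝ)))
      (volume.prod volume) (volume.prod volume) :=
    (MeasurePreserving.id volume).prod (volume_preserving_finTwoArrow ℝ)
  have h5 : MeasurePreserving (Prod.swap : ℝ × (ℝ × ℝ) → (ℝ × ℝ) × ℝ) (volume.prod volume)
    (volume.prod volume) := Measure.measurePreserving_swap
  have h6 : MeasurePreserving (fun v : (ℝ × ℝ) × ℝ => (v.1, v.2 - γ (!₂[v.1.1, v.1.2])))
      (volume.prod volume) (volume.prod volume) := by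
    refine (MeasurePreserving.id (volume : Measure (ℝ × ℝ))).skew_product
      (g := fun b t => t - γ (!₂[b.1, b.2])) ?_ (Eventually.of_forall fun b => ?_)
    · exact (continuous_snd.sub (hγ.comp
        (continuous_toLp_pair.comp continuous_fst))).measurable
    · exact (measurePreserving_sub_right volume (γ (!₂[b.1, b.2]))).map_eq
  have h := h6.comp (h5.comp (h4.comp (h3.comp (h2.comp h1))))
  exact h

/-- Near a point `x₀`, the distance to the complement controls the height above the graph. -/
lemma exists_height_le_infDist {Ω : Set R3} {x₀ : R3} (hx₀ : x₀ ∉ Ω) {A : R3 ≃ₗᵢ[ℝ] R3} {r : ℝ}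
    {γ : EuclideanSpace ℝ (Fin 2) → ℝ} (hr : 0 < r) (hγ : ContDiff ℝ 1 γ)
    (hΩ : Ω ∩ Metric.ball x₀ r =
      {x | γ (!₂[(A x) 0, (A x) 1]) < (A x) 2} ∩ Metric.ball x₀ r) :
    ∃ δ : ℝ, 0 < δ ∧ ∃ L : ℝ, 0 ≤ L ∧ ∀ x ∈ Ω ∩ Metric.ball x₀ δ,
      0 < (flattenGraph A γ x).2 ∧ (flattenGraph A γ x).2 ≤ L * Metric.infDist x Ωᶜ ∧
      ∀ y ∈ Metric.ball x₀ δ, |(flattenGraph A γ x).2 - (flattenGraph A γ y).2| ≤ L * ‖x - y‖ := by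
  have hs : ContDiff ℝ 1 fun x => (flattenGraph A γ x).2 := by
    have hA : ContDiff ℝ 1 A := A.contDiff
    have hc : ∀ i, ContDiff ℝ 1 fun x => (A x) i := fun i =>
      (EuclideanSpace.proj i : R3 →L[ℝ] ℝ).contDiff.comp hA
    refine (hc 2).sub (hγ.comp ?_)
    rw [contDiff_euclidean]
    intro i
    fin_cases i
    · exact hc 0
    · exact hc 1
  obtain ⟨K, t, ht, hK⟩ := hs.contDiffAt.exists_lipschitzOnWith (x := x₀)
  obtain ⟨r', hr', hrt⟩ := Metric.mem_nhds_iff.1 ht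
  have hK' : ∀ x ∈ Metric.ball x₀ r', ∀ y ∈ Metric.ball x₀ r',
      |(flattenGraph A γ x).2 - (flattenGraph A γ y).2| ≤ K * ‖x - y‖ := fun x hx y hy => by
    have := hK.dist_le_mul x (hrt hx) y (hrt hy)
    rwa [Real.dist_eq, dist_eq_norm] at this
  have hpos : ∀ x ∈ Metric.ball x₀ r, x ∈ Ω ↔ 0 < (flattenGraph A γ x).2 := fun x hx => by
    have : x ∈ Ω ∩ Metric.ball x₀ r ↔ x ∈ {x | γ (!₂[(A x) 0, (A x) 1]) < (A x) 2} ∩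
      Metric.ball x₀ r := by rw [hΩ]
    simpa [hx, flattenGraph] using this
  refine ⟨min r r' / 2, by positivity, K, K.2, fun x hx => ⟨?_, ?_, fun y hy => ?_⟩⟩
  · exact (hpos x (Metric.ball_subset_ball (by linarith [min_le_left r r', lt_min hr hr']) hx.2)).1 hx.1
  · have hne : (Ωᶜ).Nonempty := ⟨x₀, hx₀⟩
    have hxd : dist x x₀ < min r r' / 2 := Metric.mem_ball.1 hx.2
    have hlt : Metric.infDist x Ωᶜ < min r r' / 2 :=
      (Metric.infDist_le_dist_of_mem hx₀).trans_lt hxd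
    refine le_of_forall_gt_imp_ge_of_dense fun c hc => ?_
    rcases eq_or_lt_of_le (NNReal.coe_nonneg K) with h0 | h0
    · obtain ⟨z, hz, hzd⟩ := (Metric.infDist_lt_iff hne).1 hlt
      have hzx : dist z x₀ < min r r' := by
        linarith [dist_triangle z x x₀, dist_comm z x]
      have hz' := (hpos z (Metric.mem_ball.2 (hzx.trans_le (min_le_left _ _)))).not.1 hz
      have := hK' x (Metric.mem_ball.2 (by linarith [min_le_right r r', lt_min hr hr'])) z
        (Metric.mem_ball.2 (hzx.trans_le (min_le_right _ _)))
      rw [← h0, zero_mul] at this hc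
      linarith [(abs_le.1 this).2]
    · have hc' : Metric.infDist x Ωᶜ < c / K := by rwa [lt_div_iff₀' h0]
      obtain ⟨z, hz, hzd⟩ := (Metric.infDist_lt_iff hne).1 (lt_min hlt hc')
      have hz1 := hzd.trans_le (min_le_left _ _)
      have hz2 := hzd.trans_le (min_le_right _ _)
      have hzx : dist z x₀ < min r r' := by
        linarith [dist_triangle z x x₀, dist_comm z x]
      have hz' := (hpos z (Metric.mem_ball.2 (hzx.trans_le (min_le_left _ _)))).not.1 hz
      have := hK' x (Metric.mem_ball.2 (by linarith [min_le_right r r', lt_min hr hr'])) z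
        (Metric.mem_ball.2 (hzx.trans_le (min_le_right _ _)))
      rw [← dist_eq_norm] at this
      rw [lt_div_iff₀' h0] at hz2
      linarith [(abs_le.1 this).2]
  · exact hK' x (Metric.ball_subset_ball (by linarith [min_le_right r r', lt_min hr hr']) hx.2) y
      (Metric.ball_subset_ball (by linarith [min_le_right r r', lt_min hr hr']) hy)

/-- The kernel `D(x, y)⁻³`, where `D(x, y)² = |x - y|² + dist(y, Ωᶜ)²`. -/
noncomputable def boundaryKernel (Ω : Set R3) (x y : R3) : ℝ≥0∞ :=
  ENNReal.ofReal ((regNorm (Metric.infDist y Ωᶜ) (x - y) ^ 3)⁻¹)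

lemma measurable_boundaryKernel (Ω : Set R3) :
    Measurable (Function.uncurry (boundaryKernel Ω)) := by
  have : Continuous fun q : R3 × R3 => regNorm (Metric.infDist q.2 Ωᶜ) (q.1 - q.2) :=
    continuous_regNorm_comp ((Metric.continuous_infDist_pt _).comp continuous_snd) (by fun_prop)
  exact (ENNReal.measurable_ofReal.comp ((this.measurable.pow_const 3).inv))

lemma exists_boundaryKernel_le_halfSpaceKernel {Ω : Set R3} {x₀ : R3} (hx₀ : x₀ ∉ Ω)
    {A : R3 ≃ₗᵢ[ℝ] R3} {r : ℝ}
    {γ : EuclideanSpace ℝ (Fin 2) → ℝ} (hr : 0 < r) (hγ : ContDiff ℝ 1 γ)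
    (hΩ : Ω ∩ Metric.ball x₀ r =
      {x | γ (!₂[(A x) 0, (A x) 1]) < (A x) 2} ∩ Metric.ball x₀ r) :
    ∃ δ : ℝ, 0 < δ ∧ ∃ C : ℝ≥0∞, C ≠ ⊤ ∧ ∀ x ∈ Ω ∩ Metric.ball x₀ δ, ∀ y ∈ Ω ∩ Metric.ball x₀ δ,
      boundaryKernel Ω x y ≤ C * halfSpaceKernel (flattenGraph A γ x) (flattenGraph A γ y) := by
  obtain ⟨δ, hδ, L, hL, h⟩ := exists_height_le_infDist hx₀ hr hγ hΩ
  refine ⟨δ, hδ, ENNReal.ofReal ((3 * L + 1) ^ 3), ENNReal.ofReal_ne_top, fun x hx y hy => ?_⟩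
  obtain ⟨hx0, hxL, hxy⟩ := h x hx
  obtain ⟨hy0, hyL, -⟩ := h y hy
  have hxy := hxy y hy.2
  set D := regNorm (Metric.infDist y Ωᶜ) (x - y) with hD
  set c := (flattenGraph A γ x).2 + (flattenGraph A γ y).2 with hc
  have hc0 : 0 < c := by positivity
  have d1 : ‖x - y‖ ≤ D := norm_le_regNorm _ _
  have d2 : Metric.infDist y Ωᶜ ≤ D := (le_abs_self _).trans (abs_le_regNorm _ _)
  have l1 := mul_le_mul_of_nonneg_left d1 hL
  have l2 := mul_le_mul_of_nonneg_left d2 hL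
  have hcD : c ≤ 3 * L * D := by
    have := (abs_le.1 hxy).2
    linarith
  have hcoord : ∀ i, |(A x) i - (A y) i| ≤ D := fun i => by
    have h1 := abs_coord_le_norm (A x - A y) i
    rw [← map_sub, A.norm_map] at h1
    rw [map_sub] at h1
    exact h1.trans d1
  have hD0 : 0 < D := by
    by_contra hneg
    have : D = 0 := le_antisymm (not_lt.1 hneg) (regNorm_nonneg _ _)
    rw [this] at hcD
    linarith
  have key : ∀ i, ((3 * L + 1) * D) ^ (-(3 / 2) : ℝ) ≤ (|(A x) i - (A y) i| + c) ^ (-(3 / 2) : ℝ) :=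
    fun i => by
    refine Real.rpow_le_rpow_of_nonpos (by positivity) ?_ (by norm_num)
    linarith [hcoord i]
  have e : boundaryKernel Ω x y = ENNReal.ofReal ((3 * L + 1) ^ 3) *
      (ENNReal.ofReal (((3 * L + 1) * D) ^ (-(3 / 2) : ℝ)) *
        ENNReal.ofReal (((3 * L + 1) * D) ^ (-(3 / 2) : ℝ))) := by
    rw [← ENNReal.ofReal_mul (by positivity), ← ENNReal.ofReal_mul (by positivity),
      ← Real.rpow_add (by positivity), boundaryKernel, ← hD]
    congr 1
    have : (-(3 / 2) + -(3 / 2) : ℝ) = -(3 : ℕ) := by norm_num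
    rw [this, Real.rpow_neg (by positivity), Real.rpow_natCast]
    field_simp
  rw [e, halfSpaceKernel, if_pos ⟨hx0, hy0⟩]
  exact mul_le_mul' le_rfl (mul_le_mul' (ENNReal.ofReal_le_ofReal (key 0))
    (ENNReal.ofReal_le_ofReal (key 1)))

lemma boundaryKernel_le_of_le {Ω : Set R3} {x y : R3} {δ : ℝ} (hδ : 0 < δ)
    (h : δ ≤ regNorm (Metric.infDist y Ωᶜ) (x - y)) :
    boundaryKernel Ω x y ≤ ENNReal.ofReal ((δ ^ 3)⁻¹) := by
  unfold boundaryKernel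
  gcongr

lemma isLpKernel_const {α : Type*} [MeasurableSpace α] {p q : ℝ} (hpq : p.HolderConjugate q)
    (μ : Measure α) [IsFiniteMeasure μ] {c : ℝ≥0∞} (hc : c ≠ ⊤) :
    IsLpKernel p μ fun _ _ => c := by
  refine IsLpKernel.of_schur hpq measurable_const (w := fun _ => 1) measurable_const (by simp)
    (by simp) (C := c * μ Set.univ) (by finiteness) ?_ ?_ <;> simp

/-- `D(x, y)⁻³` acts boundedly on `L^p(Ω)`. -/
lemma isLpKernel_boundaryKernel {Ω : Set R3} (hΩ : IsBoundedLiapunovDomain Ω) {p q : ℝ}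
    (hpq : p.HolderConjugate q) : IsLpKernel p (volume.restrict Ω) (boundaryKernel Ω) := by
  obtain ⟨α, -, -, hloc⟩ := hΩ.boundary
  have hcomp : IsCompact (frontier Ω) := Metric.isCompact_of_isClosed_isBounded isClosed_frontier
    (hΩ.isBounded.closure.subset frontier_subset_closure)
  have hfin : IsFiniteMeasure (volume.restrict Ω) :=
    ⟨by simpa using hΩ.isBounded.measure_lt_top⟩
  have hloc' : ∀ x₀ : frontier Ω, ∃ δ : ℝ, 0 < δ ∧ ∃ k, IsLpKernel p (volume.restrict Ω) k ∧
      ∀ x ∈ Ω ∩ Metric.ball (x₀ : R3) δ, ∀ y ∈ Ω ∩ Metric.ball (x₀ : R3) δ,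
        boundaryKernel Ω x y ≤ k x y := by
    rintro ⟨x₀, hx₀⟩
    obtain ⟨A, r, γ, -, hr, hγ, -, hg⟩ := hloc x₀ hx₀
    have hx₀' : x₀ ∉ Ω := fun h => by
      rw [hΩ.isOpen.frontier_eq] at hx₀
      exact hx₀.2 h
    obtain ⟨δ, hδ, C, hC, h⟩ := exists_boundaryKernel_le_halfSpaceKernel hx₀' hr hγ hg
    exact ⟨δ, hδ, _, ((measurePreserving_flattenGraph A
      hγ.continuous).isLpKernel_comp_halfSpaceKernel hpq Ω).const_mul hpq.nonneg hC, h⟩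
  choose δ hδ k hk hle using hloc'
  obtain ⟨t, ht⟩ := hcomp.elim_finite_subcover (fun x₀ : frontier Ω => Metric.ball (x₀ : R3) (δ x₀))
    (fun _ => Metric.isOpen_ball) fun x hx => Set.mem_iUnion.2 ⟨⟨x, hx⟩, Metric.mem_ball_self (hδ _)⟩
  obtain ⟨ε, hε, hleb⟩ := lebesgue_number_lemma_of_metric
    (c := fun i : t => Metric.ball ((i : frontier Ω) : R3) (δ i)) hcomp
    (fun _ => Metric.isOpen_ball) (fun x hx => by
      obtain ⟨i, hi, hxi⟩ := Set.mem_iUnion₂.1 (ht hx)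
      exact Set.mem_iUnion.2 ⟨⟨i, hi⟩, hxi⟩)
  have hsum := (IsLpKernel.finset_sum t (fun i _ => hk i) hpq.lt.le).add
    (isLpKernel_const hpq (volume.restrict Ω) (c := ENNReal.ofReal (((ε / 2) ^ 3)⁻¹))
      ENNReal.ofReal_ne_top) hpq.lt.le
  refine hsum.mono hpq.nonneg (measurable_boundaryKernel Ω) ?_
  have hmem := ae_restrict_mem (μ := (volume : Measure R3)) hΩ.isOpen.measurableSet
  filter_upwards [hmem] with x hx
  filter_upwards [hmem] with y hy
  by_cases hD : ε / 2 ≤ regNorm (Metric.infDist y Ωᶜ) (x - y)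
  · exact (boundaryKernel_le_of_le (by positivity) hD).trans le_add_self
  · push Not at hD
    have hne : Ω ≠ Set.univ := fun h => by
      have := hΩ.isBounded
      rw [h] at this
      exact NormedSpace.unbounded_univ ℝ R3 this
    obtain ⟨z, hz, hzd⟩ := exists_mem_frontier_infDist_compl_eq_dist hy hne
    obtain ⟨i, hi⟩ := hleb z hz
    have h1 : dist y z < ε / 2 := by
      rw [← hzd]
      exact ((le_abs_self _).trans (abs_le_regNorm _ _)).trans_lt hD
    have h2 : dist x y < ε / 2 := by
      rw [dist_eq_norm]
      exact (norm_le_regNorm _ _).trans_lt hD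
    have h3 : dist x z < ε := by linarith [dist_triangle x y z]
    refine le_trans ?_ le_self_add
    refine (hle i x ⟨hx, hi (Metric.mem_ball.2 h3)⟩ y
      ⟨hy, hi (Metric.mem_ball.2 (by linarith))⟩).trans ?_
    exact Finset.single_le_sum (f := fun i => k i x y) (fun _ _ => zero_le) i.2

/-- The kernel `|x - y|⁻²` acts boundedly on `L^p(Ω)`. -/
lemma isLpKernel_inv_norm_sq {Ω : Set R3} (hΩ : Bornology.IsBounded Ω) {p q : ℝ}
    (hpq : p.HolderConjugate q) :
    IsLpKernel p (volume.restrict Ω) fun x y => ENNReal.ofReal ((‖x - y‖ ^ 2)⁻¹) := by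
  have hb : ∀ x : R3, ∫⁻ y in Ω, ENNReal.ofReal ((‖x - y‖ ^ 2)⁻¹) ≤
      (∫⁻ z in Metric.ball (0 : R3) 1, ENNReal.ofReal ((‖z‖ ^ 2)⁻¹)) + volume Ω := by
    intro x
    calc ∫⁻ y in Ω, ENNReal.ofReal ((‖x - y‖ ^ 2)⁻¹)
        ≤ ∫⁻ y in Ω, ((Metric.ball (0 : R3) 1).indicator
            (fun z => ENNReal.ofReal ((‖z‖ ^ 2)⁻¹)) (x - y) + 1) := by
          gcongr with y
          by_cases h : x - y ∈ Metric.ball (0 : R3) 1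
          · rw [Set.indicator_of_mem h]
            exact le_self_add
          · rw [Set.indicator_of_notMem h, zero_add, ENNReal.ofReal_le_one]
            refine inv_le_one_of_one_le₀ (one_le_pow₀ ?_)
            simpa using h
      _ ≤ (∫⁻ y, (Metric.ball (0 : R3) 1).indicator
            (fun z => ENNReal.ofReal ((‖z‖ ^ 2)⁻¹)) (x - y)) + volume Ω := by
          rw [lintegral_add_right _ measurable_const]
          gcongr
          · exact Measure.restrict_le_self
          · simp
      _ = _ := by
          rw [lintegral_sub_left_eq_self ((Metric.ball (0 : R3) 1).indicator
            fun z => ENNReal.ofReal ((‖z‖ ^ 2)⁻¹)) x, lintegral_indicator measurableSet_ball]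
  refine IsLpKernel.of_schur hpq (by fun_prop) (w := fun _ => 1) measurable_const (by simp)
    (by simp) (C := (∫⁻ z in Metric.ball (0 : R3) 1, ENNReal.ofReal ((‖z‖ ^ 2)⁻¹)) + volume Ω)
    (ENNReal.add_ne_top.2 ⟨(integrableOn_inv_norm_sq 1).lintegral_lt_top.ne,
      hΩ.measure_lt_top.ne⟩) (fun x => ?_) fun y => ?_
  · simpa using hb x
  · simp_rw [norm_sub_rev _ y]
    simpa using hb y

/-! ### Lipschitz functions as test functions for the weak divergence -/

lemma norm_grad3_le_of_lipschitz {f : R3 → ℂ} {L : ℝ≥0} (hf : LipschitzWith L f) (x : R3)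
    (i : Fin 3) : ‖grad3 f x i‖ ≤ L := by
  refine ((fderiv ℝ f x).le_opNorm _).trans ?_
  simpa using norm_fderiv_le_of_lipschitz ℝ hf

lemma measurable_grad3 (f : R3 → ℂ) (i : Fin 3) : Measurable fun x => grad3 f x i :=
  measurable_fderiv_apply_const ℝ f _

section Mollify

open ContinuousLinearMap

lemma norm_normed_convolution_le (φ : ContDiffBump (0 : R3)) {h : R3 → ℂ} {M : ℝ}
    (hM : ∀ x, ‖h x‖ ≤ M) (x : R3) :
    ‖convolution (φ.normed volume) h (lsmul ℝ ℝ) volume x‖ ≤ M := by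
  rw [convolution_def]
  refine (norm_integral_le_of_norm_le (g := fun t => φ.normed volume t * M)
    (φ.integrable_normed.mul_const M) (Eventually.of_forall fun t => ?_)).trans ?_
  · rw [lsmul_apply, norm_smul, Real.norm_of_nonneg (φ.nonneg_normed t)]
    exact mul_le_mul_of_nonneg_left (hM _) (φ.nonneg_normed t)
  · rw [integral_mul_const, φ.integral_normed, one_mul]

lemma grad3_normed_convolution (φ : ContDiffBump (0 : R3)) {f : R3 → ℂ} {L : ℝ≥0}
    (hf : LipschitzWith L f) (x : R3) (i : Fin 3) :
    grad3 (convolution (φ.normed volume) f (lsmul ℝ ℝ) volume) x i =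
      convolution (φ.normed volume) (fun x => grad3 f x i) (lsmul ℝ ℝ) volume x := by
  have hφc : Continuous (φ.normed (volume : Measure R3)) := φ.contDiff_normed (n := 0).continuous
  have hφm := hφc.aestronglyMeasurable (μ := (volume : Measure R3))
  have hmeas : Measurable (fderiv ℝ f) := measurable_fderiv ℝ f
  have key := hasFDerivAt_integral_of_dominated_loc_of_lip (𝕜 := ℝ) (μ := (volume : Measure R3))
    (F := fun x t => φ.normed volume t • f (x - t)) (x₀ := x) (s := Set.univ)
    (F' := fun t => φ.normed volume t • fderiv ℝ f (x - t))
    (bound := fun t => φ.normed volume t * L) univ_mem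
    (Eventually.of_forall fun y => (hφc.smul (hf.continuous.comp (by fun_prop))).aestronglyMeasurable)
    ((hφc.smul (hf.continuous.comp (by fun_prop))).integrable_of_hasCompactSupport
      φ.hasCompactSupport_normed.smul_right)
    (hφm.smul (hmeas.comp (measurable_const.sub measurable_id)).aestronglyMeasurable)
    (Eventually.of_forall fun t => by
      refine LipschitzOnWith.of_dist_le_mul fun y _ z _ => ?_
      have h := hf.dist_le_mul (y - t) (z - t)
      rw [dist_eq_norm, ← smul_sub, norm_smul, Real.coe_nnabs, ← dist_eq_norm, abs_mul,
        Real.norm_eq_abs, NNReal.abs_eq, mul_assoc]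
      rw [dist_sub_right] at h
      exact mul_le_mul_of_nonneg_left h (abs_nonneg _))
    (φ.integrable_normed.mul_const _)
    (by
      have h := (quasiMeasurePreserving_sub_left_of_right_invariant (volume : Measure R3) x).ae
        hf.ae_differentiableAt
      filter_upwards [h] with t ht
      have h1 : HasFDerivAt (fun y : R3 => f (y - t)) (fderiv ℝ f (x - t)) x := by
        simpa using! ht.hasFDerivAt.comp x ((hasFDerivAt_id x).sub_const t)
      exact h1.const_smul (φ.normed volume t))
  have e : convolution (φ.normed volume) f (lsmul ℝ ℝ) volume =
      fun x => ∫ t, φ.normed volume t • f (x - t) := rfl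
  rw [grad3, e, key.2.fderiv, ContinuousLinearMap.integral_apply key.1]
  rfl

end Mollify

lemma HasWeakDiv.integral_lipschitz_of_hasCompactSupport {Ω : Set R3} {g : R3 → C3} {d : R3 → ℂ}
    (h : HasWeakDiv Ω g d) (hg : IntegrableOn g Ω) (hd : IntegrableOn d Ω) (hΩ : IsOpen Ω)
    {f : R3 → ℂ} {L : ℝ≥0} (hf : LipschitzWith L f) (hfc : HasCompactSupport f)
    (hfΩ : tsupport f ⊆ Ω) :
    ∫ x in Ω, f x * d x = -∫ x in Ω, ∑ i, grad3 f x i * g x i := by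
  obtain ⟨δ, hδ, hδΩ⟩ := hfc.isCompact.exists_cthickening_subset_open hΩ hfΩ
  let φ : ℕ → ContDiffBump (0 : R3) := fun n =>
    ⟨δ / 2 / (n + 1), δ / (n + 1), by positivity, by
      have : (0 : ℝ) < n + 1 := by positivity
      gcongr
      linarith⟩
  have hout : ∀ n, (φ n).rOut = δ / (n + 1) := fun n => rfl
  have hlim : Tendsto (fun n => (φ n).rOut) atTop (𝓝 0) := by
    simp_rw [hout]
    simpa [div_eq_mul_inv] using
      (tendsto_one_div_add_atTop_nhds_zero_nat (𝕜 := ℝ)).const_mul δ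
  let F : ℕ → R3 → ℂ := fun n =>
    convolution ((φ n).normed volume) f (ContinuousLinearMap.lsmul ℝ ℝ) volume
  have htest : ∀ n, IsTestFunction Ω (F n) := by
    intro n
    refine ⟨(φ n).hasCompactSupport_normed.contDiff_convolution_left _ (φ n).contDiff_normed
      hf.continuous.locallyIntegrable, (φ n).hasCompactSupport_normed.convolution _ hfc, ?_⟩
    refine Set.Subset.trans (closure_minimal ?_ (Metric.isClosed_cthickening (δ := δ))) hδΩ
    refine (support_convolution_subset _).trans ?_
    rintro _ ⟨a, ha, b, hb, rfl⟩
    rw [(φ n).support_normed_eq] at ha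
    refine Metric.mem_cthickening_of_dist_le _ b _ _ (subset_tsupport _ hb) ?_
    have : ‖a‖ < δ / (n + 1) := by simpa [hout] using ha
    simp only [dist_eq_norm, add_sub_cancel_right]
    refine this.le.trans (div_le_self hδ.le (by linarith [Nat.cast_nonneg (α := ℝ) n]))
  obtain ⟨M, hM⟩ := hf.continuous.bounded_above_of_compact_support hfc
  have hgi : ∀ i, IntegrableOn (fun x => g x i) Ω := fun i => hg.eval i
  have hFc : ∀ n, Continuous (F n) := fun n => (htest n).1.continuous
  have l1 : Tendsto (fun n => ∫ x in Ω, F n x * d x) atTop (𝓝 (∫ x in Ω, f x * d x)) := by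
    refine tendsto_integral_of_dominated_convergence (fun x => M * ‖d x‖)
      (fun n => (hFc n).aestronglyMeasurable.mul hd.1) (hd.norm.const_mul M)
      (fun n => Eventually.of_forall fun x => ?_) (Eventually.of_forall fun x => ?_)
    · rw [norm_mul]
      exact mul_le_mul_of_nonneg_right (norm_normed_convolution_le _ hM x) (norm_nonneg _)
    · exact (ContDiffBump.convolution_tendsto_right_of_continuous hlim hf.continuous x).mul_const _
  have hae : ∀ᵐ x, ∀ i, Tendsto (fun n => grad3 (F n) x i) atTop (𝓝 (grad3 f x i)) := by
    rw [ae_all_iff]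
    intro i
    have hloc : LocallyIntegrable fun x => grad3 f x i := by
      refine (locallyIntegrable_const (L : ℝ)).mono (measurable_grad3 f i).aestronglyMeasurable ?_
      refine Eventually.of_forall fun x => ?_
      simpa using norm_grad3_le_of_lipschitz hf x i
    have := ContDiffBump.ae_convolution_tendsto_right_of_locallyIntegrable (K := 2) hlim
      (Eventually.of_forall fun n => by
        change δ / (n + 1) ≤ 2 * (δ / 2 / (n + 1))
        apply le_of_eq; ring) hloc
    filter_upwards [this] with x hx
    simpa only [F, grad3_normed_convolution _ hf] using hx
  have l2 : Tendsto (fun n => -∫ x in Ω, ∑ i, grad3 (F n) x i * g x i) atTop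
      (𝓝 (-∫ x in Ω, ∑ i, grad3 f x i * g x i)) := by
    refine Tendsto.neg (tendsto_integral_of_dominated_convergence
      (fun x => ∑ i, L * ‖g x i‖) (fun n => ?_)
      (integrable_finsetSum _ fun i _ => (hgi i).norm.const_mul _)
      (fun n => Eventually.of_forall fun x => ?_) ?_)
    · exact Finset.aestronglyMeasurable_fun_sum _ fun i _ =>
        (measurable_grad3 _ i).aestronglyMeasurable.mul (hgi i).1
    · refine (norm_sum_le _ _).trans (Finset.sum_le_sum fun i _ => ?_)
      rw [norm_mul]
      refine mul_le_mul_of_nonneg_right ?_ (norm_nonneg _)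
      rw [grad3_normed_convolution _ hf]
      exact norm_normed_convolution_le _ (fun x => norm_grad3_le_of_lipschitz hf x i) x
    · filter_upwards [ae_restrict_of_ae hae] with x hx
      exact tendsto_finsetSum _ fun i _ => (hx i).mul_const _
  exact tendsto_nhds_unique (l1.congr fun n => h.2.2 _ (htest n)) l2

/-- A Lipschitz cut-off of the distance: `0` for `t ≤ ε` and `1` for `t ≥ 2ε`. -/
noncomputable def cutoff (ε t : ℝ) : ℝ := min 1 (max 0 (t / ε - 1))

lemma cutoff_nonneg (ε t : ℝ) : 0 ≤ cutoff ε t := le_min zero_le_one (le_max_left _ _)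

lemma cutoff_le_one (ε t : ℝ) : cutoff ε t ≤ 1 := min_le_left _ _

lemma cutoff_eq_one {ε t : ℝ} (hε : 0 < ε) (h : 2 * ε ≤ t) : cutoff ε t = 1 := by
  have : 2 ≤ t / ε := by rwa [le_div_iff₀ hε]
  rw [cutoff, min_eq_left]
  exact le_max_of_le_right (by linarith)

lemma cutoff_eq_zero {ε t : ℝ} (hε : 0 < ε) (h : t ≤ ε) : cutoff ε t = 0 := by
  have : t / ε ≤ 1 := by rwa [div_le_one hε]
  rw [cutoff, max_eq_left (by linarith), min_eq_right zero_le_one]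

lemma abs_cutoff_sub_le {ε : ℝ} (hε : 0 < ε) (s t : ℝ) :
    |cutoff ε s - cutoff ε t| ≤ |s - t| / ε := by
  have h1 : |cutoff ε s - cutoff ε t| ≤ |(s / ε - 1) - (t / ε - 1)| := by
    unfold cutoff
    refine (abs_min_sub_min_le_max _ _ _ _).trans ?_
    refine max_le (by simp) ((abs_max_sub_max_le_max _ _ _ _).trans (max_le (by simp) le_rfl))
  refine h1.trans (le_of_eq ?_)
  rw [sub_sub_sub_cancel_right, ← sub_div, abs_div, abs_of_pos hε]

lemma norm_le_mul_infDist {S : Set R3} (hS : S.Nonempty) (hc : IsClosed S) {f : R3 → ℂ} {L : ℝ≥0}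
    (hf : LipschitzWith L f) (h0 : ∀ x ∈ S, f x = 0) (x : R3) :
    ‖f x‖ ≤ L * Metric.infDist x S := by
  obtain ⟨z, hz, hd⟩ := hc.exists_infDist_eq_dist hS x
  rw [hd]
  simpa [h0 z hz] using hf.dist_le_mul x z

lemma lipschitzWith_cutoff_mul {S : Set R3} (hS : S.Nonempty) (hc : IsClosed S) {f : R3 → ℂ}
    {L : ℝ≥0} (hf : LipschitzWith L f) (h0 : ∀ x ∈ S, f x = 0) {ε : ℝ} (hε : 0 < ε) :
    LipschitzWith (3 * L) fun x => (cutoff ε (Metric.infDist x S) : ℂ) * f x := by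
  refine LipschitzWith.of_dist_le_mul fun x y => ?_
  wlog hxy : Metric.infDist y S ≤ Metric.infDist x S generalizing x y
  · rw [dist_comm, dist_comm x y]
    exact this y x (le_of_not_ge hxy)
  set a := cutoff ε (Metric.infDist x S)
  set b := cutoff ε (Metric.infDist y S)
  have e : (a : ℂ) * f x - b * f y = a * (f x - f y) + ((a - b : ℝ) : ℂ) * f y := by
    push_cast; ring
  have h1 : ‖(a : ℂ) * (f x - f y)‖ ≤ L * dist x y := by
    rw [norm_mul, Complex.norm_of_nonneg (cutoff_nonneg _ _), ← dist_eq_norm]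
    calc a * dist (f x) (f y) ≤ 1 * dist (f x) (f y) := by
          gcongr
          exact cutoff_le_one _ _
      _ ≤ _ := by rw [one_mul]; exact hf.dist_le_mul x y
  have h2 : ‖((a - b : ℝ) : ℂ) * f y‖ ≤ 2 * L * dist x y := by
    rw [norm_mul, Complex.norm_real, Real.norm_eq_abs]
    rcases le_total (2 * ε) (Metric.infDist y S) with h | h
    · have ha : a = 1 := cutoff_eq_one hε (h.trans hxy)
      have hb : b = 1 := cutoff_eq_one hε h
      rw [ha, hb, sub_self, abs_zero, zero_mul]
      positivity
    · have hab : |a - b| ≤ dist x y / ε := by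
        refine (abs_cutoff_sub_le hε _ _).trans ?_
        gcongr
        simpa [Real.dist_eq] using (Metric.lipschitz_infDist_pt S).dist_le_mul x y
      have hfy : ‖f y‖ ≤ L * (2 * ε) := (norm_le_mul_infDist hS hc hf h0 y).trans
        (mul_le_mul_of_nonneg_left h L.2)
      calc |a - b| * ‖f y‖ ≤ dist x y / ε * (L * (2 * ε)) := by gcongr
        _ = 2 * L * dist x y := by field_simp
  rw [dist_eq_norm, e]
  refine (norm_add_le _ _).trans ?_
  rw [NNReal.coe_mul, NNReal.coe_ofNat]
  linarith

lemma HasWeakDiv.integral_lipschitz {Ω : Set R3} {g : R3 → C3} {d : R3 → ℂ}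
    (h : HasWeakDiv Ω g d) (hg : IntegrableOn g Ω) (hd : IntegrableOn d Ω) (hΩ : IsOpen Ω)
    (hb : Bornology.IsBounded Ω) {f : R3 → ℂ} {L : ℝ≥0} (hf : LipschitzWith L f)
    (h0 : ∀ x ∉ Ω, f x = 0) :
    ∫ x in Ω, f x * d x = -∫ x in Ω, ∑ i, grad3 f x i * g x i := by
  have hne : (Ωᶜ).Nonempty := by
    rw [Set.nonempty_compl]
    rintro rfl
    exact NormedSpace.unbounded_univ ℝ R3 hb
  have hcl : IsClosed Ωᶜ := hΩ.isClosed_compl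
  let F : ℕ → R3 → ℂ := fun n x =>
    (cutoff (1 / (n + 1)) (Metric.infDist x Ωᶜ) : ℂ) * f x
  have hε : ∀ n : ℕ, (0 : ℝ) < 1 / (n + 1) := fun n => by positivity
  have hFL : ∀ n, LipschitzWith (3 * L) (F n) := fun n =>
    lipschitzWith_cutoff_mul hne hcl hf h0 (hε n)
  have hFt : ∀ n, tsupport (F n) ⊆ {x | 1 / ((n : ℝ) + 1) ≤ Metric.infDist x Ωᶜ} := fun n => by
    refine closure_minimal (fun x hx => ?_)
      (isClosed_le continuous_const (Metric.continuous_infDist_pt _))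
    by_contra hneg
    simp only [Set.mem_ofPred_eq, not_le] at hneg
    exact hx (by simp only [F, cutoff_eq_zero (hε n) hneg.le]; simp)
  have hsub : ∀ n : ℕ, {x : R3 | 1 / ((n : ℝ) + 1) ≤ Metric.infDist x Ωᶜ} ⊆ Ω := fun n x hx => by
    by_contra hneg
    have hx' : 1 / ((n : ℝ) + 1) ≤ Metric.infDist x Ωᶜ := hx
    rw [Metric.infDist_zero_of_mem hneg] at hx'
    exact absurd hx' (not_le.2 (hε n))
  have hFc : ∀ n, HasCompactSupport (F n) := fun n =>
    Metric.isCompact_of_isClosed_isBounded (isClosed_tsupport _)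
      (hb.subset ((hFt n).trans (hsub n)))
  have hfin : ∀ x ∈ Ω, ∀ᶠ n in atTop, F n =ᶠ[𝓝 x] f := fun x hx => by
    have hpos : 0 < Metric.infDist x Ωᶜ :=
      (hcl.notMem_iff_infDist_pos hne).1 (by simpa using hx)
    have hl : Tendsto (fun n : ℕ => 2 * (1 / ((n : ℝ) + 1))) atTop (𝓝 (2 * 0)) :=
      tendsto_one_div_add_atTop_nhds_zero_nat.const_mul 2
    rw [mul_zero] at hl
    filter_upwards [hl.eventually_lt_const hpos] with n hn
    filter_upwards [(Metric.continuous_infDist_pt Ωᶜ).continuousAt.eventually_const_lt hn]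
      with y hy
    simp only [F, cutoff_eq_one (hε n) hy.le]
    simp
  have hgi : ∀ i, IntegrableOn (fun x => g x i) Ω := fun i => hg.eval i
  have hfc : HasCompactSupport f := by
    refine Metric.isCompact_of_isClosed_isBounded (isClosed_tsupport _) (hb.closure.subset ?_)
    refine closure_mono fun x hx => ?_
    by_contra hneg
    exact hx (h0 x hneg)
  obtain ⟨M, hM⟩ := hf.continuous.bounded_above_of_compact_support hfc
  have l1 : Tendsto (fun n => ∫ x in Ω, F n x * d x) atTop (𝓝 (∫ x in Ω, f x * d x)) := by
    refine tendsto_integral_of_dominated_convergence (fun x => M * ‖d x‖)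
      (fun n => (hFL n).continuous.aestronglyMeasurable.mul hd.1) (hd.norm.const_mul M)
      (fun n => Eventually.of_forall fun x => ?_) ?_
    · rw [norm_mul]
      refine mul_le_mul_of_nonneg_right ?_ (norm_nonneg _)
      simp only [F]
      rw [norm_mul, Complex.norm_of_nonneg (cutoff_nonneg _ _)]
      exact (mul_le_of_le_one_left (norm_nonneg _) (cutoff_le_one _ _)).trans (hM x)
    · filter_upwards [ae_restrict_mem hΩ.measurableSet] with x hx
      refine tendsto_const_nhds.congr' ?_
      filter_upwards [hfin x hx] with n hn
      rw [hn.eq_of_nhds]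
  have l2 : Tendsto (fun n => -∫ x in Ω, ∑ i, grad3 (F n) x i * g x i) atTop
      (𝓝 (-∫ x in Ω, ∑ i, grad3 f x i * g x i)) := by
    refine Tendsto.neg (tendsto_integral_of_dominated_convergence
      (fun x => ∑ i, ((3 * L : ℝ≥0) : ℝ) * ‖g x i‖) (fun n => ?_)
      (integrable_finsetSum _ fun i _ => (hgi i).norm.const_mul _)
      (fun n => Eventually.of_forall fun x => ?_) ?_)
    · exact Finset.aestronglyMeasurable_fun_sum _ fun i _ =>
        (measurable_grad3 _ i).aestronglyMeasurable.mul (hgi i).1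
    · refine (norm_sum_le _ _).trans (Finset.sum_le_sum fun i _ => ?_)
      rw [norm_mul]
      exact mul_le_mul_of_nonneg_right (norm_grad3_le_of_lipschitz (hFL n) x i) (norm_nonneg _)
    · filter_upwards [ae_restrict_mem hΩ.measurableSet] with x hx
      refine tendsto_const_nhds.congr' ?_
      filter_upwards [hfin x hx] with n hn
      simp only [grad3, hn.fderiv_eq]
  exact tendsto_nhds_unique (l1.congr fun n => h.integral_lipschitz_of_hasCompactSupport hg hd hΩ
    (hFL n) (hFc n) ((hFt n).trans (hsub n))) l2

/-- A function that is Lipschitz on the closure of a bounded open set and vanishes on its boundary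
may be used as a test function for the weak divergence. -/
lemma HasWeakDiv.integral_lipschitzOn {Ω : Set R3} {g : R3 → C3} {d : R3 → ℂ}
    (h : HasWeakDiv Ω g d) (hg : IntegrableOn g Ω) (hd : IntegrableOn d Ω) (hΩ : IsOpen Ω)
    (hb : Bornology.IsBounded Ω) {f : R3 → ℂ} {L : ℝ≥0} (hf : LipschitzOnWith L f (closure Ω))
    (h0 : ∀ x ∈ frontier Ω, f x = 0) :
    ∫ x in Ω, f x * d x = -∫ x in Ω, ∑ i, grad3 f x i * g x i := by
  have hne : Ω ≠ Set.univ := by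
    rintro rfl
    exact NormedSpace.unbounded_univ ℝ R3 hb
  have hLip : LipschitzWith L (Ω.indicator f) := by
    have key : ∀ x ∈ Ω, ∀ y ∉ Ω, ‖f x‖ ≤ L * dist x y := fun x hx y hy => by
      obtain ⟨z, hz, hd⟩ := exists_mem_frontier_infDist_compl_eq_dist hx hne
      have h1 := hf.dist_le_mul x (subset_closure hx) z (frontier_subset_closure hz)
      rw [h0 z hz, dist_zero_right, ← hd] at h1
      exact h1.trans (mul_le_mul_of_nonneg_left (Metric.infDist_le_dist_of_mem hy) L.2)
    refine LipschitzWith.of_dist_le_mul fun x y => ?_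
    by_cases hx : x ∈ Ω <;> by_cases hy : y ∈ Ω
    · simpa [hx, hy] using hf.dist_le_mul x (subset_closure hx) y (subset_closure hy)
    · simpa [hx, hy] using key x hx y hy
    · rw [dist_comm, dist_comm x y]
      simpa [hx, hy] using key y hy x hx
    · simp only [hx, hy, not_false_eq_true, Set.indicator_of_notMem, dist_self]
      positivity
  have := h.integral_lipschitz hg hd hΩ hb hLip fun x hx => Set.indicator_of_notMem hx f
  have e : ∀ x ∈ Ω, Ω.indicator f =ᶠ[𝓝 x] f := fun x hx => by
    filter_upwards [hΩ.mem_nhds hx] with y hy using Set.indicator_of_mem hy f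
  rw [setIntegral_congr_fun (g := fun x => f x * d x) hΩ.measurableSet
    fun x hx => by simp only [(e x hx).eq_of_nhds]] at this
  rw [this]
  congr 1
  refine setIntegral_congr_fun hΩ.measurableSet fun x hx => ?_
  simp only [grad3, (e x hx).fderiv_eq]

/-! ### The kernels of the representation of `grad div` -/

/-- The `i`-th component of `grad θ`, as a kernel. -/
noncomputable def thetaGrad (lam : ℂ) (i : Fin 3) (x y : R3) : ℂ :=
  (((x - y) i : ℝ) : ℂ) * radSlope lam ‖x - y‖

/-- A regularisation of `thetaGrad` away from the complement of `Ω`. -/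
noncomputable def bdryGrad (lam : ℂ) (Ω : Set R3) (i : Fin 3) (x y : R3) : ℂ :=
  (((x - y) i : ℝ) : ℂ) * radSlope lam (regNorm (Metric.infDist y Ωᶜ) (x - y))

/-- The derivative of `bdryGrad` in the second variable. -/
noncomputable def bdryGradDeriv (lam : ℂ) (Ω : Set R3) (i : Fin 3) (x y : R3) : R3 →L[ℝ] ℂ :=
  (-radSlope lam (regNorm (Metric.infDist y Ωᶜ) (x - y))) •
      (Complex.ofRealCLM.comp (EuclideanSpace.proj i : R3 →L[ℝ] ℝ)) +
    ((((x - y) i : ℝ) : ℂ) * radSlopeDeriv lam (regNorm (Metric.infDist y Ωᶜ) (x - y)) *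
      (regNorm (Metric.infDist y Ωᶜ) (x - y) : ℂ)⁻¹) •
      Complex.ofRealCLM.comp (-innerSL ℝ (x - y) +
        Metric.infDist y Ωᶜ • fderiv ℝ (fun y => Metric.infDist y Ωᶜ) y)

/-- The second derivatives `∂_{y_j} ∂_{x_i}` of the regularised kernel. -/
noncomputable def bdryHess (lam : ℂ) (Ω : Set R3) (i j : Fin 3) (x y : R3) : ℂ :=
  bdryGradDeriv lam Ω i x y (EuclideanSpace.single j (1 : ℝ))

lemma continuous_regNorm_infDist (Ω : Set R3) :
    Continuous fun q : R3 × R3 => regNorm (Metric.infDist q.2 Ωᶜ) (q.1 - q.2) :=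
  continuous_regNorm_comp ((Metric.continuous_infDist_pt _).comp continuous_snd) (by fun_prop)

lemma measurable_thetaGrad (lam : ℂ) (i : Fin 3) : Measurable (Function.uncurry (thetaGrad lam i)) := by
  have h1 : Measurable fun q : R3 × R3 => (((q.1 - q.2) i : ℝ) : ℂ) := by fun_prop
  exact h1.mul ((measurable_radSlope lam).comp (by fun_prop))

lemma measurable_bdryGrad (lam : ℂ) (Ω : Set R3) (i : Fin 3) :
    Measurable (Function.uncurry (bdryGrad lam Ω i)) := by
  have h1 : Measurable fun q : R3 × R3 => (((q.1 - q.2) i : ℝ) : ℂ) := by fun_prop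
  exact h1.mul ((measurable_radSlope lam).comp (continuous_regNorm_infDist Ω).measurable)

lemma bdryHess_eq (lam : ℂ) (Ω : Set R3) (i j : Fin 3) (x y : R3) : bdryHess lam Ω i j x y =
    -radSlope lam (regNorm (Metric.infDist y Ωᶜ) (x - y)) *
      ((EuclideanSpace.single j (1 : ℝ) : R3) i : ℂ) +
    (((x - y) i : ℝ) : ℂ) * radSlopeDeriv lam (regNorm (Metric.infDist y Ωᶜ) (x - y)) *
      (regNorm (Metric.infDist y Ωᶜ) (x - y) : ℂ)⁻¹ *
      ((-(x - y) j + Metric.infDist y Ωᶜ *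
        fderiv ℝ (fun y => Metric.infDist y Ωᶜ) y (EuclideanSpace.single j (1 : ℝ)) : ℝ) : ℂ) := by
  simp [bdryHess, bdryGradDeriv, inner_single]
  ring

lemma measurable_bdryHess (lam : ℂ) (Ω : Set R3) (i j : Fin 3) :
    Measurable (Function.uncurry (bdryHess lam Ω i j)) := by
  have hD := (continuous_regNorm_infDist Ω).measurable
  have h1 : Measurable fun q : R3 × R3 => (((q.1 - q.2) i : ℝ) : ℂ) := by fun_prop
  have h2 : Measurable fun q : R3 × R3 => (q.1 - q.2) j := by fun_prop
  have h3 : Measurable fun q : R3 × R3 => Metric.infDist q.2 Ωᶜ :=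
    ((Metric.continuous_infDist_pt _).comp continuous_snd).measurable
  have h4 : Measurable fun q : R3 × R3 => fderiv ℝ (fun y => Metric.infDist y Ωᶜ) q.2
      (EuclideanSpace.single j (1 : ℝ)) :=
    (measurable_fderiv_apply_const ℝ (fun y : R3 => Metric.infDist y Ωᶜ)
      (EuclideanSpace.single j (1 : ℝ))).comp measurable_snd
  have e : Function.uncurry (bdryHess lam Ω i j) = fun q : R3 × R3 =>
      bdryHess lam Ω i j q.1 q.2 := rfl
  rw [e]
  simp_rw [bdryHess_eq]
  exact ((((measurable_radSlope lam).comp hD).neg).mul measurable_const).add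
    (((h1.mul ((measurable_radSlopeDeriv lam).comp hD)).mul
      (Complex.measurable_ofReal.comp hD).inv).mul
        (Complex.measurable_ofReal.comp (h2.neg.add (h3.mul h4))))

lemma exists_regNorm_infDist_le {Ω : Set R3} (hne : (Ωᶜ).Nonempty) (R : ℝ) :
    ∃ R' : ℝ, ∀ x ∈ Metric.closedBall (0 : R3) R, ∀ y ∈ Metric.closedBall (0 : R3) R,
      ‖x - y‖ ≤ R' ∧ regNorm (Metric.infDist y Ωᶜ) (x - y) ≤ R' := by
  obtain ⟨x₀, hx₀⟩ := hne
  refine ⟨3 * R + ‖x₀‖, fun x hx y hy => ?_⟩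
  rw [mem_closedBall_zero_iff] at hx hy
  have h1 : ‖x - y‖ ≤ 2 * R := (norm_sub_le x y).trans (by linarith)
  have h2 : Metric.infDist y Ωᶜ ≤ R + ‖x₀‖ := (Metric.infDist_le_dist_of_mem hx₀).trans (by
    rw [dist_eq_norm]
    exact (norm_sub_le _ _).trans (by linarith))
  have h3 : regNorm (Metric.infDist y Ωᶜ) (x - y) ≤ ‖x - y‖ + Metric.infDist y Ωᶜ := by
    simpa [abs_of_nonneg Metric.infDist_nonneg] using regNorm_le (Metric.infDist y Ωᶜ) (x - y)
  have := norm_nonneg x₀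
  have := norm_nonneg x
  exact ⟨by linarith, by linarith⟩

lemma abs_fderiv_infDist_le (S : Set R3) (y : R3) (j : Fin 3) :
    |fderiv ℝ (fun y => Metric.infDist y S) y (EuclideanSpace.single j (1 : ℝ))| ≤ 1 := by
  have h := (fderiv ℝ (fun y => Metric.infDist y S) y).le_opNorm (EuclideanSpace.single j (1 : ℝ))
  have h2 := norm_fderiv_le_of_lipschitz ℝ (Metric.lipschitz_infDist_pt S) (x₀ := y)
  have h3 : ‖(EuclideanSpace.single j (1 : ℝ) : R3)‖ = 1 := by simp
  rw [h3, mul_one] at h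
  exact h.trans (by simpa using h2)

lemma exists_bound_kernels_domain (lam : ℂ) {Ω : Set R3} (hb : Bornology.IsBounded Ω)
    (hne : (Ωᶜ).Nonempty) : ∃ C : ℝ, 0 < C ∧ ∀ x ∈ Ω, ∀ y ∈ Ω,
      ‖helmholtzTheta lam (x - y)‖ ≤ C * (‖x - y‖ ^ 2)⁻¹ ∧
      (∀ i, ‖thetaGrad lam i x y‖ ≤ C * (‖x - y‖ ^ 2)⁻¹) ∧
      (∀ i, ‖bdryGrad lam Ω i x y‖ ≤ C * (‖x - y‖ ^ 2)⁻¹) ∧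
      ∀ i j, ‖bdryHess lam Ω i j x y‖ ≤
        C * (regNorm (Metric.infDist y Ωᶜ) (x - y) ^ 3)⁻¹ := by
  obtain ⟨R, hR⟩ := hb.subset_closedBall 0
  obtain ⟨R', hR'⟩ := exists_regNorm_infDist_le hne R
  obtain ⟨C, hC, h⟩ := exists_bound_kernels lam R'
  obtain ⟨C', hC', h'⟩ := exists_bound_radial lam R'
  refine ⟨C + 3 * C', by positivity, fun x hx y hy => ?_⟩
  obtain ⟨hxy, hD⟩ := hR' x (hR hx) y (hR hy)
  have hinv : 0 ≤ (‖x - y‖ ^ 2)⁻¹ := by positivity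
  have hmul : C * (‖x - y‖ ^ 2)⁻¹ ≤ (C + 3 * C') * (‖x - y‖ ^ 2)⁻¹ :=
    mul_le_mul_of_nonneg_right (by linarith) hinv
  have hleft : ‖helmholtzTheta lam (x - y)‖ ≤ (C + 3 * C') * (‖x - y‖ ^ 2)⁻¹ ∧
      (∀ i, ‖thetaGrad lam i x y‖ ≤ (C + 3 * C') * (‖x - y‖ ^ 2)⁻¹) ∧
      (∀ i, ‖bdryGrad lam Ω i x y‖ ≤ (C + 3 * C') * (‖x - y‖ ^ 2)⁻¹) := by
    by_cases hz : x - y = 0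
    · simp [helmholtzTheta, thetaGrad, bdryGrad, hz]
    have hp0 : 0 < regNorm 0 (x - y) := regNorm_pos_of_right 0 hz
    have hp := regNorm_pos_of_right (Metric.infDist y Ωᶜ) hz
    have h0 := h 0 (x - y) hp0 (by rwa [regNorm_zero])
    have h1 := h (Metric.infDist y Ωᶜ) (x - y) hp hD
    rw [regNorm_zero, div_eq_mul_inv] at h0
    refine ⟨?_, fun i => (h0.2 i).trans hmul, fun i => (h1.2 i).trans (le_trans ?_ hmul)⟩
    · rw [helmholtzTheta_eq]
      simp only [regNorm_zero]
      exact h0.1.trans hmul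
    · rw [← div_eq_mul_inv]
      have hz' : 0 < ‖x - y‖ := norm_pos_iff.2 hz
      gcongr
      exact norm_le_regNorm _ _
  refine ⟨hleft.1, hleft.2.1, hleft.2.2, fun i j => ?_⟩
  set D := regNorm (Metric.infDist y Ωᶜ) (x - y) with hDdef
  rcases (regNorm_nonneg (Metric.infDist y Ωᶜ) (x - y)).eq_or_lt with h0 | h0
  · have hD0 : D = 0 := h0.symm
    rw [bdryHess_eq, ← hDdef, hD0]
    simp [radSlope]
  · have hD0 : 0 < D := h0
    have hs := h' D hD0 hD
    have c1 : ∀ i, |(x - y) i| ≤ D := fun i => (abs_coord_le_norm _ i).trans (norm_le_regNorm _ _)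
    have c2 : |Metric.infDist y Ωᶜ| ≤ D := abs_le_regNorm _ _
    have b1 : ‖-radSlope lam D * ((EuclideanSpace.single j (1 : ℝ) : R3) i : ℂ)‖ ≤ C' / D ^ 3 := by
      rw [norm_mul, norm_neg, Complex.norm_real, Real.norm_eq_abs]
      have : |(EuclideanSpace.single j (1 : ℝ) : R3) i| ≤ 1 := by
        refine (abs_coord_le_norm _ i).trans (by simp)
      exact (mul_le_of_le_one_right (norm_nonneg _) this).trans hs.2.1
    have b3 : |-(x - y) j + Metric.infDist y Ωᶜ *
        fderiv ℝ (fun y => Metric.infDist y Ωᶜ) y (EuclideanSpace.single j (1 : ℝ))| ≤ 2 * D := by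
      refine (abs_add_le _ _).trans ?_
      rw [abs_neg, abs_mul]
      have := mul_le_of_le_one_right (abs_nonneg (Metric.infDist y Ωᶜ))
        (abs_fderiv_infDist_le Ωᶜ y j)
      linarith [c1 j]
    have b2 : ‖(((x - y) i : ℝ) : ℂ) * radSlopeDeriv lam D * (D : ℂ)⁻¹ *
        ((-(x - y) j + Metric.infDist y Ωᶜ *
        fderiv ℝ (fun y => Metric.infDist y Ωᶜ) y (EuclideanSpace.single j (1 : ℝ)) : ℝ) : ℂ)‖ ≤
        2 * C' / D ^ 3 := by
      rw [norm_mul, norm_mul, norm_mul, norm_inv, Complex.norm_real, Complex.norm_real,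
        Complex.norm_real, Real.norm_eq_abs, Real.norm_eq_abs, Real.norm_eq_abs, abs_of_pos hD0]
      calc _ ≤ D * (C' / D ^ 4) * D⁻¹ * (2 * D) := by
            gcongr
            · exact c1 i
            · exact hs.2.2
        _ = 2 * C' / D ^ 3 := by field_simp
    rw [bdryHess_eq, ← hDdef]
    refine (norm_add_le _ _).trans ((add_le_add b1 b2).trans ?_)
    rw [← div_eq_mul_inv, ← add_div]
    exact div_le_div_of_nonneg_right (by linarith) (by positivity)

section LpKernels

variable {Ω : Set R3} {p q : ℝ}

lemma isLpKernel_of_le_inv_norm_sq (hΩ : IsOpen Ω) (hb : Bornology.IsBounded Ω)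
    (hpq : p.HolderConjugate q) {K : R3 → R3 → ℂ} (mK : Measurable (Function.uncurry K)) {C : ℝ}
    (h : ∀ x ∈ Ω, ∀ y ∈ Ω, ‖K x y‖ ≤ C * (‖x - y‖ ^ 2)⁻¹) :
    IsLpKernel p (volume.restrict Ω) fun x y => ‖K x y‖ₑ := by
  refine ((isLpKernel_inv_norm_sq hb hpq).const_mul hpq.nonneg
    (ENNReal.ofReal_ne_top (r := C))).mono hpq.nonneg mK.enorm ?_
  filter_upwards [ae_restrict_mem hΩ.measurableSet] with x hx
  filter_upwards [ae_restrict_mem hΩ.measurableSet] with y hy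
  rw [← ofReal_norm, ← ENNReal.ofReal_mul' (by positivity)]
  exact ENNReal.ofReal_le_ofReal (h x hx y hy)

lemma isLpKernel_of_le_boundaryKernel (hΩ : IsBoundedLiapunovDomain Ω)
    (hpq : p.HolderConjugate q) {K : R3 → R3 → ℂ} (mK : Measurable (Function.uncurry K)) {C : ℝ}
    (h : ∀ x ∈ Ω, ∀ y ∈ Ω, ‖K x y‖ ≤ C * (regNorm (Metric.infDist y Ωᶜ) (x - y) ^ 3)⁻¹) :
    IsLpKernel p (volume.restrict Ω) fun x y => ‖K x y‖ₑ := by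
  refine ((isLpKernel_boundaryKernel hΩ hpq).const_mul hpq.nonneg
    (ENNReal.ofReal_ne_top (r := C))).mono hpq.nonneg mK.enorm ?_
  filter_upwards [ae_restrict_mem hΩ.isOpen.measurableSet] with x hx
  filter_upwards [ae_restrict_mem hΩ.isOpen.measurableSet] with y hy
  rw [← ofReal_norm, boundaryKernel, ← ENNReal.ofReal_mul'
    (inv_nonneg.2 (pow_nonneg (regNorm_nonneg _ _) _))]
  exact ENNReal.ofReal_le_ofReal (h x hx y hy)

lemma IsBoundedLiapunovDomain.nonempty_compl (hΩ : IsBoundedLiapunovDomain Ω) :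
    (Ωᶜ).Nonempty := by
  rw [Set.nonempty_compl]
  rintro rfl
  exact NormedSpace.unbounded_univ ℝ R3 hΩ.isBounded

lemma measurable_helmholtzTheta_sub (lam : ℂ) :
    Measurable (Function.uncurry fun x y : R3 => helmholtzTheta lam (x - y)) :=
  (measurable_helmholtzTheta lam).comp (measurable_fst.sub measurable_snd)

lemma isLpKernel_theta (hΩ : IsBoundedLiapunovDomain Ω) (hpq : p.HolderConjugate q) (lam : ℂ) :
    IsLpKernel p (volume.restrict Ω) fun x y => ‖helmholtzTheta lam (x - y)‖ₑ := by
  obtain ⟨C, -, h⟩ := exists_bound_kernels_domain lam hΩ.isBounded hΩ.nonempty_compl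
  exact isLpKernel_of_le_inv_norm_sq hΩ.isOpen hΩ.isBounded hpq
    (measurable_helmholtzTheta_sub lam) fun x hx y hy => (h x hx y hy).1

lemma isLpKernel_thetaGrad (hΩ : IsBoundedLiapunovDomain Ω) (hpq : p.HolderConjugate q) (lam : ℂ)
    (i : Fin 3) : IsLpKernel p (volume.restrict Ω) fun x y => ‖thetaGrad lam i x y‖ₑ := by
  obtain ⟨C, -, h⟩ := exists_bound_kernels_domain lam hΩ.isBounded hΩ.nonempty_compl
  exact isLpKernel_of_le_inv_norm_sq hΩ.isOpen hΩ.isBounded hpq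
    (measurable_thetaGrad lam i) fun x hx y hy => (h x hx y hy).2.1 i

lemma isLpKernel_bdryGrad (hΩ : IsBoundedLiapunovDomain Ω) (hpq : p.HolderConjugate q) (lam : ℂ)
    (i : Fin 3) : IsLpKernel p (volume.restrict Ω) fun x y => ‖bdryGrad lam Ω i x y‖ₑ := by
  obtain ⟨C, -, h⟩ := exists_bound_kernels_domain lam hΩ.isBounded hΩ.nonempty_compl
  exact isLpKernel_of_le_inv_norm_sq hΩ.isOpen hΩ.isBounded hpq
    (measurable_bdryGrad lam Ω i) fun x hx y hy => (h x hx y hy).2.2.1 i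

lemma isLpKernel_bdryHess (hΩ : IsBoundedLiapunovDomain Ω) (hpq : p.HolderConjugate q) (lam : ℂ)
    (i j : Fin 3) : IsLpKernel p (volume.restrict Ω) fun x y => ‖bdryHess lam Ω i j x y‖ₑ := by
  obtain ⟨C, -, h⟩ := exists_bound_kernels_domain lam hΩ.isBounded hΩ.nonempty_compl
  exact isLpKernel_of_le_boundaryKernel hΩ hpq
    (measurable_bdryHess lam Ω i j) fun x hx y hy => (h x hx y hy).2.2.2 i j

end LpKernels

/-! ### The derivative of the regularised potential -/

lemma hasFDerivAt_bdryGrad (lam : ℂ) {Ω : Set R3} (i : Fin 3) {x y : R3}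
    (hD : 0 < regNorm (Metric.infDist y Ωᶜ) (x - y))
    (hρ : DifferentiableAt ℝ (fun y => Metric.infDist y Ωᶜ) y) :
    HasFDerivAt (fun y => bdryGrad lam Ω i x y) (bdryGradDeriv lam Ω i x y) y := by
  have h1 : HasFDerivAt (fun y : R3 => x - y) (-ContinuousLinearMap.id ℝ R3) y := by
    simpa using (hasFDerivAt_id y).const_sub x
  have h2 := (hasDerivAt_radSlope lam hD.ne').hasFDerivAt.comp y
    (hasFDerivAt_regNorm hρ.hasFDerivAt h1 hD)
  have h3 := (hasFDerivAt_coord (x - y) i).comp y h1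
  convert! h3.mul h2 using 1
  ext v
  simp [bdryGradDeriv]
  ring

lemma infDist_le_two_mul_regNorm (S : Set R3) (x y : R3) :
    Metric.infDist x S ≤ 2 * regNorm (Metric.infDist y S) (x - y) := by
  have h1 := Metric.infDist_le_infDist_add_dist (s := S) (x := x) (y := y)
  rw [dist_eq_norm] at h1
  have h2 := norm_le_regNorm (Metric.infDist y S) (x - y)
  have h3 := (le_abs_self _).trans (abs_le_regNorm (Metric.infDist y S) (x - y))
  linarith

lemma exists_lipschitz_bdryGrad (lam : ℂ) {Ω : Set R3} (hne : (Ωᶜ).Nonempty) {c : ℝ} (hc : 0 < c)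
    (R : ℝ) (i : Fin 3) : ∃ C : ℝ, 0 ≤ C ∧ ∀ x ∈ Metric.closedBall (0 : R3) R,
      c ≤ Metric.infDist x Ωᶜ → ∀ y ∈ Metric.closedBall (0 : R3) R,
        ‖bdryGrad lam Ω i x y‖ ≤ C ∧ ∀ z ∈ Metric.closedBall (0 : R3) R,
          ‖bdryGrad lam Ω i x y - bdryGrad lam Ω i x z‖ ≤ C * ‖y - z‖ := by
  obtain ⟨R', hR'⟩ := exists_regNorm_infDist_le hne R
  obtain ⟨C, hC, h⟩ := exists_bound_radial lam R'
  have hc2 : 0 < c / 2 := by positivity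
  have hlip : ∀ r ∈ Set.Icc (c / 2) R', ∀ s ∈ Set.Icc (c / 2) R',
      ‖radSlope lam r - radSlope lam s‖ ≤ C / (c / 2) ^ 4 * ‖r - s‖ := fun r hr s hs => by
    refine (convex_Icc (c / 2) R').norm_image_sub_le_of_norm_hasDerivWithin_le
      (f' := radSlopeDeriv lam)
      (fun t ht => (hasDerivAt_radSlope lam (hc2.trans_le ht.1).ne').hasDerivWithinAt)
      (fun t ht => ?_) hs hr
    refine (h t (hc2.trans_le ht.1) ht.2).2.2.trans ?_
    gcongr
    exact ht.1
  have hbd : ∀ r ∈ Set.Icc (c / 2) R', ‖radSlope lam r‖ ≤ C / (c / 2) ^ 3 := fun r hr => by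
    refine (h r (hc2.trans_le hr.1) hr.2).2.1.trans ?_
    gcongr
    exact hr.1
  have hP : 0 ≤ C / (c / 2) ^ 4 := by positivity
  have hQ : 0 ≤ C / (c / 2) ^ 3 := by positivity
  refine ⟨|R'| * (C / (c / 2) ^ 3) + (|R'| * (C / (c / 2) ^ 4 * 2) + C / (c / 2) ^ 3),
    by positivity, fun x hx hxc y hy => ?_⟩
  have hmem : ∀ w ∈ Metric.closedBall (0 : R3) R,
      regNorm (Metric.infDist w Ωᶜ) (x - w) ∈ Set.Icc (c / 2) R' := fun w hw =>
    ⟨by linarith [infDist_le_two_mul_regNorm Ωᶜ x w], (hR' x hx w hw).2⟩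
  have hcoord : ∀ w ∈ Metric.closedBall (0 : R3) R, |(x - w) i| ≤ |R'| := fun w hw =>
    ((abs_coord_le_norm _ i).trans (hR' x hx w hw).1).trans (le_abs_self _)
  refine ⟨?_, fun z hz => ?_⟩
  · rw [bdryGrad, norm_mul, Complex.norm_real, Real.norm_eq_abs]
    have := mul_le_mul (hcoord y hy) (hbd _ (hmem y hy)) (norm_nonneg _) (abs_nonneg _)
    have h2 : 0 ≤ |R'| * (C / (c / 2) ^ 4 * 2) + C / (c / 2) ^ 3 := by positivity
    linarith
  · have e : bdryGrad lam Ω i x y - bdryGrad lam Ω i x z = (((x - y) i : ℝ) : ℂ) *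
        (radSlope lam (regNorm (Metric.infDist y Ωᶜ) (x - y)) -
          radSlope lam (regNorm (Metric.infDist z Ωᶜ) (x - z))) +
        (((z - y) i : ℝ) : ℂ) * radSlope lam (regNorm (Metric.infDist z Ωᶜ) (x - z)) := by
      simp only [bdryGrad, PiLp.sub_apply]
      push_cast
      ring
    have hD : ‖regNorm (Metric.infDist y Ωᶜ) (x - y) - regNorm (Metric.infDist z Ωᶜ) (x - z)‖ ≤
        2 * ‖y - z‖ := by
      refine (abs_regNorm_sub_le _ _ _ _).trans ?_
      have h1 : |Metric.infDist y Ωᶜ - Metric.infDist z Ωᶜ| ≤ ‖y - z‖ := by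
        simpa [Real.dist_eq, dist_eq_norm] using
          (Metric.lipschitz_infDist_pt Ωᶜ).dist_le_mul y z
      rw [sub_sub_sub_cancel_left, norm_sub_rev z y]
      linarith
    have t1 : ‖(((x - y) i : ℝ) : ℂ) * (radSlope lam (regNorm (Metric.infDist y Ωᶜ) (x - y)) -
          radSlope lam (regNorm (Metric.infDist z Ωᶜ) (x - z)))‖ ≤
        |R'| * (C / (c / 2) ^ 4 * 2) * ‖y - z‖ := by
      rw [norm_mul, Complex.norm_real, Real.norm_eq_abs, mul_assoc]
      refine mul_le_mul (hcoord y hy) ?_ (norm_nonneg _) (abs_nonneg _)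
      refine (hlip _ (hmem y hy) _ (hmem z hz)).trans ?_
      rw [mul_assoc]
      exact mul_le_mul_of_nonneg_left hD hP
    have t2 : ‖(((z - y) i : ℝ) : ℂ) * radSlope lam (regNorm (Metric.infDist z Ωᶜ) (x - z))‖ ≤
        C / (c / 2) ^ 3 * ‖y - z‖ := by
      rw [norm_mul, Complex.norm_real, Real.norm_eq_abs, mul_comm, norm_sub_rev y z]
      exact mul_le_mul (hbd _ (hmem z hz)) (abs_coord_le_norm _ i) (abs_nonneg _) hQ
    rw [e]
    refine (norm_add_le _ _).trans ((add_le_add t1 t2).trans ?_)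
    have : 0 ≤ |R'| * (C / (c / 2) ^ 3) * ‖y - z‖ := by positivity
    linarith

/-- The regularised potential `y ↦ ∫ φ(x) k_i(x, y) dx`. -/
noncomputable def bdryPotential (lam : ℂ) (Ω : Set R3) (i : Fin 3) (φ : R3 → ℂ) (y : R3) : ℂ :=
  ∫ x, φ x * bdryGrad lam Ω i x y

lemma IsTestFunction.exists_le_infDist {Ω : Set R3} {φ : R3 → ℂ} (hφ : IsTestFunction Ω φ)
    (hΩ : IsOpen Ω) (hne : (Ωᶜ).Nonempty) :
    ∃ c : ℝ, 0 < c ∧ ∀ x ∈ tsupport φ, c ≤ Metric.infDist x Ωᶜ := by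
  obtain ⟨δ, hδ, h⟩ := hφ.2.1.isCompact.exists_cthickening_subset_open hΩ hφ.2.2
  refine ⟨δ, hδ, fun x hx => (Metric.le_infDist hne).2 fun z hz => ?_⟩
  by_contra hneg
  push Not at hneg
  exact hz (h (Metric.mem_cthickening_of_dist_le z x δ _ hx (by rw [dist_comm]; exact hneg.le)))

lemma measurable_bdryGradDeriv_left (lam : ℂ) (Ω : Set R3) (i : Fin 3) (y : R3) :
    Measurable fun x => bdryGradDeriv lam Ω i x y := by
  have hD : Measurable fun x : R3 => regNorm (Metric.infDist y Ωᶜ) (x - y) :=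
    (continuous_regNorm_comp continuous_const (by fun_prop)).measurable
  have h1 : Measurable fun x : R3 => (((x - y) i : ℝ) : ℂ) := by fun_prop
  have h2 : Continuous fun x : R3 => (Complex.ofRealCLM.comp (-innerSL ℝ (x - y) +
        Metric.infDist y Ωᶜ • fderiv ℝ (fun y => Metric.infDist y Ωᶜ) y) : R3 →L[ℝ] ℂ) := by
    refine continuous_const.clm_comp (Continuous.add ?_ continuous_const)
    exact ((innerSL ℝ).continuous.comp (by fun_prop)).neg
  exact (((measurable_radSlope lam).comp hD).neg.smul_const _).add
    (((h1.mul ((measurable_radSlopeDeriv lam).comp hD)).mul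
      (Complex.measurable_ofReal.comp hD).inv).smul h2.measurable)

lemma grad3_fun_add {f h : R3 → ℂ} {y : R3} (hf : DifferentiableAt ℝ f y)
    (hh : DifferentiableAt ℝ h y) (j : Fin 3) :
    grad3 (fun y => f y + h y) y j = grad3 f y j + grad3 h y j := by
  rw [grad3, fderiv_fun_add hf hh]
  rfl

section BdryPotential

variable {Ω : Set R3} {φ : R3 → ℂ}

lemma exists_lipschitz_mul_bdryGrad (lam : ℂ) (hΩ : IsOpen Ω) (hne : (Ωᶜ).Nonempty)
    (hφ : IsTestFunction Ω φ) {R : ℝ} (hR : Ω ⊆ Metric.closedBall 0 R) (i : Fin 3) :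
    ∃ C : ℝ, 0 ≤ C ∧ ∀ x : R3, ∀ y ∈ Metric.closedBall (0 : R3) R,
      ‖φ x * bdryGrad lam Ω i x y‖ ≤ ‖φ x‖ * C ∧ ∀ z ∈ Metric.closedBall (0 : R3) R,
      ‖φ x * bdryGrad lam Ω i x y - φ x * bdryGrad lam Ω i x z‖ ≤ ‖φ x‖ * C * ‖y - z‖ := by
  obtain ⟨c, hc, hcK⟩ := hφ.exists_le_infDist hΩ hne
  obtain ⟨C, hC, h⟩ := exists_lipschitz_bdryGrad lam hne hc R i
  refine ⟨C, hC, fun x y hy => ?_⟩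
  by_cases hx : x ∈ tsupport φ
  · have hx' := h x (hR (hφ.2.2 hx)) (hcK x hx) y hy
    refine ⟨?_, fun z hz => ?_⟩
    · rw [norm_mul]
      exact mul_le_mul_of_nonneg_left hx'.1 (norm_nonneg _)
    · rw [← mul_sub, norm_mul, mul_assoc]
      exact mul_le_mul_of_nonneg_left (hx'.2 z hz) (norm_nonneg _)
  · simp [image_eq_zero_of_notMem_tsupport hx]

lemma integrable_mul_bdryGrad (lam : ℂ) (hΩ : IsOpen Ω) (hne : (Ωᶜ).Nonempty)
    (hφ : IsTestFunction Ω φ) {R : ℝ} (hR : Ω ⊆ Metric.closedBall 0 R) (i : Fin 3) {y : R3}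
    (hy : y ∈ Metric.closedBall (0 : R3) R) : Integrable fun x => φ x * bdryGrad lam Ω i x y := by
  obtain ⟨C, -, h⟩ := exists_lipschitz_mul_bdryGrad lam hΩ hne hφ hR i
  refine ((hφ.1.continuous.integrable_of_hasCompactSupport hφ.2.1).norm.mul_const C).mono'
    (hφ.1.continuous.aestronglyMeasurable.mul
      ((measurable_bdryGrad lam Ω i).comp measurable_prodMk_right).aestronglyMeasurable)
    (Eventually.of_forall fun x => (h x y hy).1)

lemma exists_lipschitzOnWith_bdryPotential (lam : ℂ) (hΩ : IsOpen Ω) (hne : (Ωᶜ).Nonempty)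
    (hφ : IsTestFunction Ω φ) {R : ℝ} (hR : Ω ⊆ Metric.closedBall 0 R) (i : Fin 3) :
    ∃ L : ℝ≥0, LipschitzOnWith L (bdryPotential lam Ω i φ) (Metric.closedBall 0 R) := by
  obtain ⟨C, hC, h⟩ := exists_lipschitz_mul_bdryGrad lam hΩ hne hφ hR i
  have hi := (hφ.1.continuous.integrable_of_hasCompactSupport
    (μ := (volume : Measure R3)) hφ.2.1).norm
  refine ⟨⟨(∫ x, ‖φ x‖) * C, mul_nonneg (integral_nonneg fun _ => norm_nonneg _) hC⟩,
    LipschitzOnWith.of_dist_le_mul fun y hy z hz => ?_⟩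
  rw [dist_eq_norm, dist_eq_norm, bdryPotential, bdryPotential, ← integral_sub
    (integrable_mul_bdryGrad lam hΩ hne hφ hR i hy) (integrable_mul_bdryGrad lam hΩ hne hφ hR i hz)]
  refine (norm_integral_le_of_norm_le ((hi.mul_const C).mul_const ‖y - z‖)
    (Eventually.of_forall fun x => (h x y hy).2 z hz)).trans (le_of_eq ?_)
  rw [integral_mul_const, integral_mul_const]
  rfl

lemma grad3_bdryPotential (lam : ℂ) (hΩ : IsOpen Ω) (hne : (Ωᶜ).Nonempty)
    (hφ : IsTestFunction Ω φ) {R : ℝ} (hR : Ω ⊆ Metric.closedBall 0 R) (i : Fin 3) {y : R3}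
    (hy : y ∈ Metric.ball (0 : R3) R)
    (hρ : DifferentiableAt ℝ (fun y => Metric.infDist y Ωᶜ) y) :
    DifferentiableAt ℝ (bdryPotential lam Ω i φ) y ∧
      ∀ j, grad3 (bdryPotential lam Ω i φ) y j = ∫ x, φ x * bdryHess lam Ω i j x y := by
  obtain ⟨C, hC, h⟩ := exists_lipschitz_mul_bdryGrad lam hΩ hne hφ hR i
  obtain ⟨c, hc, hcK⟩ := hφ.exists_le_infDist hΩ hne
  have hi := (hφ.1.continuous.integrable_of_hasCompactSupport
    (μ := (volume : Measure R3)) hφ.2.1).norm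
  have hm : ∀ y, AEStronglyMeasurable (fun x => φ x * bdryGrad lam Ω i x y) := fun y =>
    hφ.1.continuous.aestronglyMeasurable.mul
      ((measurable_bdryGrad lam Ω i).comp measurable_prodMk_right).aestronglyMeasurable
  have key := hasFDerivAt_integral_of_dominated_loc_of_lip (𝕜 := ℝ) (μ := (volume : Measure R3))
    (F := fun y x => φ x * bdryGrad lam Ω i x y) (x₀ := y) (s := Metric.ball (0 : R3) R)
    (F' := fun x => φ x • bdryGradDeriv lam Ω i x y) (bound := fun x => ‖φ x‖ * C)
    (Metric.isOpen_ball.mem_nhds hy) (Eventually.of_forall hm)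
    (integrable_mul_bdryGrad lam hΩ hne hφ hR i (Metric.ball_subset_closedBall hy))
    (hφ.1.continuous.aestronglyMeasurable.smul
      (measurable_bdryGradDeriv_left lam Ω i y).aestronglyMeasurable)
    (Eventually.of_forall fun x => by
      refine LipschitzOnWith.of_dist_le_mul fun z hz w hw => ?_
      rw [dist_eq_norm, dist_eq_norm, Real.coe_nnabs, abs_of_nonneg (by positivity)]
      exact (h x z (Metric.ball_subset_closedBall hz)).2 w (Metric.ball_subset_closedBall hw))
    (hi.mul_const C)
    (Eventually.of_forall fun x => by
      by_cases hx : x ∈ tsupport φ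
      · have hD : 0 < regNorm (Metric.infDist y Ωᶜ) (x - y) := by
          linarith [infDist_le_two_mul_regNorm Ωᶜ x y, hcK x hx]
        exact (hasFDerivAt_bdryGrad lam i hD hρ).const_mul (φ x)
      · have h0 : φ x = 0 := image_eq_zero_of_notMem_tsupport hx
        have e : φ x • bdryGradDeriv lam Ω i x y = 0 := by ext v; simp [h0]
        rw [e]
        simpa [h0] using hasFDerivAt_const (0 : ℂ) y)
  have e : bdryPotential lam Ω i φ = fun y => ∫ x, φ x * bdryGrad lam Ω i x y := rfl
  refine ⟨e ▸ key.2.differentiableAt, fun j => ?_⟩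
  rw [grad3, e, key.2.fderiv, ContinuousLinearMap.integral_apply key.1]
  rfl

lemma bdryPotential_of_notMem (lam : ℂ) (hφ : IsTestFunction Ω φ) (i : Fin 3) {y : R3}
    (hy : y ∉ Ω) : bdryPotential lam Ω i φ y = -potential lam (fun x => grad3 φ x i) y := by
  rw [potential_grad3 lam (hφ.1.of_le (by simp)) hφ.2.1, neg_neg, bdryPotential]
  simp only [bdryGrad, Metric.infDist_zero_of_mem (show y ∈ Ωᶜ from hy), regNorm_zero]

lemma IsTestFunction.setIntegral_mul (hφ : IsTestFunction Ω φ) (f : R3 → ℂ) :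
    ∫ x in Ω, φ x * f x = ∫ x, φ x * f x :=
  setIntegral_eq_integral_of_forall_compl_eq_zero fun x hx => by
    rw [image_eq_zero_of_notMem_tsupport fun h => hx (hφ.2.2 h), zero_mul]

/-- Testing the weak divergence of `g` with the difference of the potential of `∂_i φ` and its
regularisation. -/
lemma HasWeakDiv.integral_potential {g : R3 → C3} {d : R3 → ℂ}
    (h : HasWeakDiv Ω g d) (hg : IntegrableOn g Ω) (hd : IntegrableOn d Ω) (hΩ : IsOpen Ω)
    (hb : Bornology.IsBounded Ω) (hne : (Ωᶜ).Nonempty) (lam : ℂ) (hφ : IsTestFunction Ω φ)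
    (i : Fin 3) :
    ∫ y in Ω, (potential lam (fun x => grad3 φ x i) y + bdryPotential lam Ω i φ y) * d y =
      -∫ y in Ω, ∑ j, (potential lam (fun x => grad3 (fun x => grad3 φ x i) x j) y +
        ∫ x, φ x * bdryHess lam Ω i j x y) * g y j := by
  obtain ⟨R, hR⟩ := hb.closure.subset_ball (0 : R3)
  have hRΩ : Ω ⊆ Metric.closedBall 0 R :=
    subset_closure.trans (hR.trans Metric.ball_subset_closedBall)
  obtain ⟨L, hL⟩ := exists_lipschitzOnWith_bdryPotential lam hΩ hne hφ hRΩ i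
  have hp : ContDiff ℝ 1 (potential lam (fun x => grad3 φ x i)) :=
    contDiff_potential lam ((hφ.grad3 i).1.of_le (by simp)) (hφ.grad3 i).2.1
  obtain ⟨L', hL'⟩ := hp.contDiffOn.exists_lipschitzOnWith (by simp)
    (convex_closedBall (0 : R3) R) (isCompact_closedBall _ _)
  have hsub : closure Ω ⊆ Metric.closedBall 0 R := hR.trans Metric.ball_subset_closedBall
  have key := h.integral_lipschitzOn hg hd hΩ hb
    (f := fun y => potential lam (fun x => grad3 φ x i) y + bdryPotential lam Ω i φ y)
    ((hL'.mono hsub).add (hL.mono hsub)) fun y hy => by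
      rw [hΩ.frontier_eq] at hy
      rw [bdryPotential_of_notMem lam hφ i hy.2, add_neg_cancel]
  rw [key]
  congr 1
  refine setIntegral_congr_ae hΩ.measurableSet ?_
  filter_upwards [(Metric.lipschitz_infDist_pt Ωᶜ).ae_differentiableAt] with y hy hyΩ
  obtain ⟨h1, h2⟩ := grad3_bdryPotential lam hΩ hne hφ hRΩ i (hR (subset_closure hyΩ)) hy
  refine Finset.sum_congr rfl fun j _ => ?_
  rw [← h2 j, ← grad3_potential lam ((hφ.grad3 i).1.of_le (by simp)) (hφ.grad3 i).2.1]
  rw [grad3_fun_add ((hp.differentiable (by simp)) y) h1]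

end BdryPotential

/-! ### The gradient of the divergence of the volume potential -/

/-- The gradient of `div ∫_Ω θ(· - y) g(y) dy` in `Ω`, where `d = div g`. -/
noncomputable def gradDivPotential (lam : ℂ) (Ω : Set R3) (g : R3 → C3) (d : R3 → ℂ) (x : R3) :
    C3 := fun i =>
  (∫ y in Ω, thetaGrad lam i x y * d y) - (∫ y in Ω, bdryGrad lam Ω i x y * d y) -
    ∑ j, ∫ y in Ω, bdryHess lam Ω i j x y * g y j

section GradDiv

variable {Ω : Set R3} {p q : ℝ} {g : R3 → C3} {d : R3 → ℂ}

lemma memLp_gradDivPotential (hΩ : IsBoundedLiapunovDomain Ω) (hpq : p.HolderConjugate q)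
    (hg : MemLp g (ENNReal.ofReal p) (volume.restrict Ω))
    (hd : MemLp d (ENNReal.ofReal p) (volume.restrict Ω)) (lam : ℂ) :
    MemLp (gradDivPotential lam Ω g d) (ENNReal.ofReal p) (volume.restrict Ω) := by
  have hfin : IsFiniteMeasure (volume.restrict Ω) :=
    ⟨by simpa using hΩ.isBounded.measure_lt_top⟩
  refine MemLp.of_eval fun i => ?_
  refine MemLp.sub (MemLp.sub ?_ ?_) (memLp_finsetSum _ fun j _ => ?_)
  · exact (isLpKernel_thetaGrad hΩ hpq lam i).memLp (measurable_thetaGrad lam i) hpq.lt hd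
  · exact (isLpKernel_bdryGrad hΩ hpq lam i).memLp (measurable_bdryGrad lam Ω i) hpq.lt hd
  · exact (isLpKernel_bdryHess hΩ hpq lam i j).memLp (measurable_bdryHess lam Ω i j) hpq.lt
      (hg.eval j)

lemma integral_mul_gradDivPotential (hΩ : IsBoundedLiapunovDomain Ω) (hpq : p.HolderConjugate q)
    (hg : MemLp g (ENNReal.ofReal p) (volume.restrict Ω))
    (hd : MemLp d (ENNReal.ofReal p) (volume.restrict Ω)) (h : HasWeakDiv Ω g d) (lam : ℂ)
    {φ : R3 → ℂ} (hφ : IsTestFunction Ω φ) (i : Fin 3) :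
    ∫ x in Ω, φ x * gradDivPotential lam Ω g d x i =
      ∫ y in Ω, ∑ j, potential lam (fun x => grad3 (fun x => grad3 φ x i) x j) y * g y j := by
  have hfin : IsFiniteMeasure (volume.restrict Ω) :=
    ⟨by simpa using hΩ.isBounded.measure_lt_top⟩
  have hp1 : 1 ≤ ENNReal.ofReal p := by simpa using hpq.lt.le
  have hgi : IntegrableOn g Ω := hg.integrable hp1
  have hdi : IntegrableOn d Ω := hd.integrable hp1
  have hgj : ∀ j, MemLp (fun y => g y j) (ENNReal.ofReal p) (volume.restrict Ω) :=
    fun j => hg.eval j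
  have hφm : AEStronglyMeasurable φ (volume.restrict Ω) := hφ.1.continuous.aestronglyMeasurable
  obtain ⟨M, hM⟩ := hφ.1.continuous.bounded_above_of_compact_support hφ.2.1
  have hbdd : ∀ f : R3 → ℂ, MemLp f (ENNReal.ofReal p) (volume.restrict Ω) →
      IntegrableOn (fun x => φ x * f x) Ω := fun f hf =>
    (hf.integrable hp1).bdd_mul hφm (Eventually.of_forall hM)
  have mA := (isLpKernel_thetaGrad hΩ hpq lam i).memLp (measurable_thetaGrad lam i) hpq.lt hd
  have mB := (isLpKernel_bdryGrad hΩ hpq lam i).memLp (measurable_bdryGrad lam Ω i) hpq.lt hd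
  have mC := fun j => (isLpKernel_bdryHess hΩ hpq lam i j).memLp (measurable_bdryHess lam Ω i j)
    hpq.lt (hgj j)
  obtain ⟨iA, eA⟩ := (isLpKernel_thetaGrad hΩ hpq lam i).integral_mul_integral
    (measurable_thetaGrad lam i) hpq.lt hd hφm hM
  obtain ⟨iB, eB⟩ := (isLpKernel_bdryGrad hΩ hpq lam i).integral_mul_integral
    (measurable_bdryGrad lam Ω i) hpq.lt hd hφm hM
  have eC := fun j => (isLpKernel_bdryHess hΩ hpq lam i j).integral_mul_integral
    (measurable_bdryHess lam Ω i j) hpq.lt (hgj j) hφm hM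
  have lhs : ∫ x in Ω, φ x * gradDivPotential lam Ω g d x i =
      (∫ y in Ω, (∫ x in Ω, φ x * thetaGrad lam i x y) * d y) -
      (∫ y in Ω, (∫ x in Ω, φ x * bdryGrad lam Ω i x y) * d y) -
      ∑ j, ∫ y in Ω, (∫ x in Ω, φ x * bdryHess lam Ω i j x y) * g y j := by
    simp only [gradDivPotential, mul_sub, Finset.mul_sum]
    rw [integral_sub, integral_sub (hbdd _ mA) (hbdd _ mB), eA, eB, integral_finsetSum]
    · congr 1
      exact Finset.sum_congr rfl fun j _ => (eC j).2
    · exact fun j _ => hbdd _ (mC j)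
    · exact (hbdd _ mA).sub (hbdd _ mB)
    · exact integrable_finsetSum _ fun j _ => hbdd _ (mC j)
  have hpot : ∀ y, ∫ x in Ω, φ x * thetaGrad lam i x y =
      -potential lam (fun x => grad3 φ x i) y := fun y => by
    rw [hφ.setIntegral_mul, potential_grad3 lam (hφ.1.of_le (by simp)) hφ.2.1, neg_neg]
    rfl
  have key := h.integral_potential hgi hdi hΩ.isOpen hΩ.isBounded hΩ.nonempty_compl lam hφ i
  have iP : ∀ j, IntegrableOn (fun y =>
      potential lam (fun x => grad3 (fun x => grad3 φ x i) x j) y * g y j) Ω := fun j => by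
    have hc : Continuous (potential lam (fun x => grad3 (fun x => grad3 φ x i) x j)) :=
      (contDiff_potential lam (((hφ.grad3 i).grad3 j).1.of_le (by simp))
        ((hφ.grad3 i).grad3 j).2.1).continuous
    obtain ⟨M', hM'⟩ := (hΩ.isBounded.isCompact_closure).exists_bound_of_continuousOn hc.continuousOn
    refine ((hgj j).integrable hp1).bdd_mul hc.aestronglyMeasurable (c := M') ?_
    filter_upwards [ae_restrict_mem hΩ.isOpen.measurableSet] with y hy
      using hM' y (subset_closure hy)
  have iC : ∀ j, IntegrableOn (fun y => (∫ x, φ x * bdryHess lam Ω i j x y) * g y j) Ω :=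
    fun j => by
    have := (eC j).1
    simp_rw [hφ.setIntegral_mul] at this
    exact this
  rw [lhs]
  have e1 : (∫ y in Ω, (∫ x in Ω, φ x * thetaGrad lam i x y) * d y) -
      (∫ y in Ω, (∫ x in Ω, φ x * bdryGrad lam Ω i x y) * d y) =
      -∫ y in Ω, (potential lam (fun x => grad3 φ x i) y + bdryPotential lam Ω i φ y) * d y := by
    rw [← integral_sub iA iB, ← integral_neg]
    congr 1
    ext y
    rw [hpot, hφ.setIntegral_mul, bdryPotential]
    ring
  rw [e1, key, neg_neg]
  simp_rw [add_mul, Finset.sum_add_distrib]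
  rw [integral_add (integrable_finsetSum _ fun j _ => iP j)
    (integrable_finsetSum _ fun j _ => iC j), integral_finsetSum _ fun j _ => iC j]
  simp_rw [hφ.setIntegral_mul]
  rw [add_sub_cancel_right]

end GradDiv

/-! ### Weak curls in components -/

lemma crossProduct_apply_cyclic (a b : C3) (k : Fin 3) :
    crossProduct a b k = a (k + 1) * b (k + 2) - a (k + 2) * b (k + 1) := by
  fin_cases k <;> simp [cross_apply]

section WeakCurl

variable {Ω : Set R3} {u v w : R3 → C3} {φ : R3 → ℂ}

lemma IsTestFunction.integrableOn_mul (hφ : IsTestFunction Ω φ) {f : R3 → ℂ}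
    (hf : IntegrableOn f Ω) : IntegrableOn (fun x => φ x * f x) Ω := by
  obtain ⟨M, hM⟩ := hφ.1.continuous.bounded_above_of_compact_support hφ.2.1
  exact hf.bdd_mul hφ.1.continuous.aestronglyMeasurable (Eventually.of_forall hM)

lemma hasWeakCurl_iff (hu : IntegrableOn u Ω) (hv : IntegrableOn v Ω) :
    HasWeakCurl Ω u v ↔ ∀ φ : R3 → ℂ, IsTestFunction Ω φ → ∀ k : Fin 3,
      ∫ x in Ω, φ x * v x k = (∫ x in Ω, grad3 φ x (k + 2) * u x (k + 1)) -
        ∫ x in Ω, grad3 φ x (k + 1) * u x (k + 2) := by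
  have hu' : ∀ k, IntegrableOn (fun x => u x k) Ω := fun k => hu.eval k
  have hv' : ∀ k, IntegrableOn (fun x => v x k) Ω := fun k => hv.eval k
  have key : ∀ φ : R3 → ℂ, IsTestFunction Ω φ →
      ((∫ x in Ω, φ x • v x = -∫ x in Ω, crossProduct (grad3 φ x) (u x)) ↔ ∀ k : Fin 3,
      ∫ x in Ω, φ x * v x k = (∫ x in Ω, grad3 φ x (k + 2) * u x (k + 1)) -
        ∫ x in Ω, grad3 φ x (k + 1) * u x (k + 2)) := by
    intro φ hφ
    have i1 : ∀ a b, IntegrableOn (fun x => grad3 φ x a * u x b) Ω := fun a b =>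
      (hφ.grad3 a).integrableOn_mul (hu' b)
    rw [funext_iff]
    refine forall_congr' fun k => ?_
    have e1 : (∫ x in Ω, φ x • v x) k = ∫ x in Ω, φ x * v x k := by
      exact eval_integral (f := fun x => φ x • v x) (fun k => hφ.integrableOn_mul (hv' k)) k
    have e2 : (∫ x in Ω, crossProduct (grad3 φ x) (u x)) k =
        (∫ x in Ω, grad3 φ x (k + 1) * u x (k + 2)) -
          ∫ x in Ω, grad3 φ x (k + 2) * u x (k + 1) := by
      rw [eval_integral]
      · simp_rw [crossProduct_apply_cyclic]
        rw [integral_sub (i1 _ _) (i1 _ _)]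
      · intro j
        simp_rw [crossProduct_apply_cyclic]
        exact (i1 _ _).sub (i1 _ _)
    rw [e1, Pi.neg_apply, e2, neg_sub]
  constructor
  · rintro ⟨-, -, h⟩ φ hφ
    exact (key φ hφ).1 (h φ hφ)
  · intro h
    exact ⟨hu.locallyIntegrableOn, hv.locallyIntegrableOn, fun φ hφ => (key φ hφ).2 (h φ hφ)⟩

lemma integrable_smul_of_locallyIntegrableOn {f : R3 → C3} (hφ : IsTestFunction Ω φ)
    (hf : LocallyIntegrableOn f Ω) : Integrable fun x => φ x • f x := by
  have hK := hf.integrableOn_compact_subset hφ.2.2 hφ.2.1.isCompact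
  obtain ⟨M, hM⟩ := hφ.1.continuous.bounded_above_of_compact_support hφ.2.1
  have h1 : IntegrableOn (fun x => φ x • f x) (tsupport φ) :=
    Integrable.bdd_smul hK M hφ.1.continuous.aestronglyMeasurable (Eventually.of_forall hM)
  refine (integrableOn_iff_integrable_of_support_subset fun x hx => ?_).1 h1
  by_contra hneg
  exact hx (by simp [image_eq_zero_of_notMem_tsupport hneg])

lemma HasWeakCurl.ae_eq (hΩ : IsOpen Ω) (hv : HasWeakCurl Ω u v) (hw : HasWeakCurl Ω u w) :
    v =ᵐ[volume.restrict Ω] w := by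
  have hloc : LocallyIntegrableOn (v - w) Ω := hv.2.1.sub hw.2.1
  have key := hΩ.ae_eq_zero_of_integral_contDiff_smul_eq_zero hloc fun ψ hψ hψc hψΩ => by
    have hsub : tsupport (fun x => (ψ x : ℂ)) ⊆ tsupport ψ :=
      closure_mono fun x hx h => hx (by simp [h])
    have hφ : IsTestFunction Ω fun x => (ψ x : ℂ) :=
      ⟨Complex.ofRealCLM.contDiff.comp hψ, hψc.of_isClosed_subset (isClosed_tsupport _) hsub,
        hsub.trans hψΩ⟩
    have hset : ∀ f : R3 → C3, ∫ x in Ω, (ψ x : ℂ) • f x = ∫ x, (ψ x : ℂ) • f x := fun f =>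
      setIntegral_eq_integral_of_forall_compl_eq_zero fun x hx => by
        rw [image_eq_zero_of_notMem_tsupport (f := fun x => (ψ x : ℂ)) fun h => hx (hφ.2.2 h),
          zero_smul]
    have e : ∀ x, ψ x • (v - w) x = (ψ x : ℂ) • v x - (ψ x : ℂ) • w x := fun x => by
      ext k
      simp [mul_sub]
    simp_rw [e]
    rw [integral_sub (integrable_smul_of_locallyIntegrableOn hφ hv.2.1)
      (integrable_smul_of_locallyIntegrableOn hφ hw.2.1), ← hset, ← hset, hv.2.2 _ hφ, hw.2.2 _ hφ,
      sub_self]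
  rw [EventuallyEq, ae_restrict_iff' hΩ.measurableSet]
  filter_upwards [key] with x hx hxΩ
  simpa [sub_eq_zero] using hx hxΩ

lemma HasWeakCurl.weakCurl (h : HasWeakCurl Ω u v) : HasWeakCurl Ω u (weakCurl Ω u) := by
  have hex : ∃ v, HasWeakCurl Ω u v := ⟨v, h⟩
  rw [_root_.weakCurl, dif_pos hex]
  exact hex.choose_spec

end WeakCurl

/-! ### The Teodorescu transform in components -/

/-- The components of `T_{2,λ}[g]` as sums of scalar potentials. -/
noncomputable def teodorescuComponents (lam : ℂ) (Ω : Set R3) (g : R3 → C3) (x : R3) : C3 :=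
  fun k => lam * (∫ y in Ω, helmholtzTheta lam (x - y) * g y k) -
    ((∫ y in Ω, thetaGrad lam (k + 1) x y * g y (k + 2)) -
      ∫ y in Ω, thetaGrad lam (k + 2) x y * g y (k + 1))

/-- The pairing of the potential of `χ` with the `j`-th component of `g`. -/
noncomputable def potentialPairing (lam : ℂ) (Ω : Set R3) (g : R3 → C3) (χ : R3 → ℂ)
    (j : Fin 3) : ℂ :=
  ∫ y in Ω, potential lam χ y * g y j

section Teodorescu

variable {Ω : Set R3} {p q : ℝ} {g : R3 → C3} {d : R3 → ℂ}

lemma teodorescuIntegrand_ae (lam : ℂ) (Ω : Set R3) (g : R3 → C3) (x : R3) :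
    ∀ᵐ y ∂(volume.restrict Ω), ∀ k, teodorescuIntegrand lam g x y k =
      lam * (helmholtzTheta lam (x - y) * g y k) -
        (thetaGrad lam (k + 1) x y * g y (k + 2) - thetaGrad lam (k + 2) x y * g y (k + 1)) := by
  filter_upwards [ae_restrict_of_ae (ae_ne_R3 x)] with y hy k
  have hxy : x - y ≠ 0 := sub_ne_zero.2 hy.symm
  simp only [teodorescuIntegrand, Pi.sub_apply, Pi.smul_apply, smul_eq_mul,
    crossProduct_apply_cyclic, grad3_helmholtzTheta lam hxy, thetaGrad]
  ring

lemma ae_integrable_components (hΩ : IsBoundedLiapunovDomain Ω) (hpq : p.HolderConjugate q)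
    (hg : MemLp g (ENNReal.ofReal p) (volume.restrict Ω)) (lam : ℂ) :
    ∀ᵐ x ∂(volume.restrict Ω),
      (∀ k, IntegrableOn (fun y => helmholtzTheta lam (x - y) * g y k) Ω) ∧
        ∀ i k, IntegrableOn (fun y => thetaGrad lam i x y * g y k) Ω := by
  have hfin : IsFiniteMeasure (volume.restrict Ω) :=
    ⟨by simpa using hΩ.isBounded.measure_lt_top⟩
  have hgk : ∀ k, MemLp (fun y => g y k) (ENNReal.ofReal p) (volume.restrict Ω) :=
    fun k => hg.eval k
  rw [eventually_and, eventually_all]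
  refine ⟨fun k => (isLpKernel_theta hΩ hpq lam).ae_integrable
    (measurable_helmholtzTheta_sub lam) hpq.lt (hgk k), ?_⟩
  simp_rw [eventually_all]
  exact fun i k => (isLpKernel_thetaGrad hΩ hpq lam i).ae_integrable
    (measurable_thetaGrad lam i) hpq.lt (hgk k)

lemma ae_integrableOn_teodorescuIntegrand (hΩ : IsBoundedLiapunovDomain Ω)
    (hpq : p.HolderConjugate q) (hg : MemLp g (ENNReal.ofReal p) (volume.restrict Ω)) (lam : ℂ) :
    ∀ᵐ x ∂(volume.restrict Ω), IntegrableOn (teodorescuIntegrand lam g x) Ω ∧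
      teodorescuT2 lam Ω g x = teodorescuComponents lam Ω g x := by
  filter_upwards [ae_integrable_components hΩ hpq hg lam] with x hx
  obtain ⟨h1, h2⟩ := hx
  have hae := teodorescuIntegrand_ae lam Ω g x
  have hk : ∀ k, Integrable (fun y => teodorescuIntegrand lam g x y k) (volume.restrict Ω) := by
    intro k
    refine (((h1 k).const_mul lam).sub ((h2 (k + 1) (k + 2)).sub (h2 (k + 2) (k + 1)))).congr ?_
    filter_upwards [hae] with y hy using (hy k).symm
  refine ⟨Integrable.of_eval hk, ?_⟩
  ext k
  have h3 : IntegrableOn (fun y => thetaGrad lam (k + 1) x y * g y (k + 2) -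
      thetaGrad lam (k + 2) x y * g y (k + 1)) Ω := (h2 _ _).sub (h2 _ _)
  rw [teodorescuT2, eval_integral hk, teodorescuComponents,
    integral_congr_ae (hae.mono fun y hy => hy k), integral_sub ((h1 k).const_mul lam) h3,
    integral_const_mul,
    integral_sub (h2 (k + 1) (k + 2)) (h2 (k + 2) (k + 1))]

lemma memLp_teodorescuComponents (hΩ : IsBoundedLiapunovDomain Ω)
    (hpq : p.HolderConjugate q) (hg : MemLp g (ENNReal.ofReal p) (volume.restrict Ω)) (lam : ℂ) :
    MemLp (teodorescuComponents lam Ω g) (ENNReal.ofReal p) (volume.restrict Ω) := by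
  have hfin : IsFiniteMeasure (volume.restrict Ω) :=
    ⟨by simpa using hΩ.isBounded.measure_lt_top⟩
  have hgk : ∀ k, MemLp (fun y => g y k) (ENNReal.ofReal p) (volume.restrict Ω) :=
    fun k => hg.eval k
  have h2 := fun i k => (isLpKernel_thetaGrad hΩ hpq lam i).memLp
    (measurable_thetaGrad lam i) hpq.lt (hgk k)
  exact MemLp.of_eval fun k => ((((isLpKernel_theta hΩ hpq lam).memLp
    (measurable_helmholtzTheta_sub lam) hpq.lt (hgk k)).const_mul lam).sub
      ((h2 (k + 1) (k + 2)).sub (h2 (k + 2) (k + 1))))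

lemma integral_mul_teodorescuComponents (hΩ : IsBoundedLiapunovDomain Ω)
    (hpq : p.HolderConjugate q) (hg : MemLp g (ENNReal.ofReal p) (volume.restrict Ω)) (lam : ℂ)
    {χ : R3 → ℂ} (hχ : IsTestFunction Ω χ) (k : Fin 3) :
    ∫ x in Ω, χ x * teodorescuComponents lam Ω g x k =
      lam * potentialPairing lam Ω g χ k +
        (potentialPairing lam Ω g (fun x => grad3 χ x (k + 1)) (k + 2) -
          potentialPairing lam Ω g (fun x => grad3 χ x (k + 2)) (k + 1)) := by
  have hfin : IsFiniteMeasure (volume.restrict Ω) :=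
    ⟨by simpa using hΩ.isBounded.measure_lt_top⟩
  have hp1 : 1 ≤ ENNReal.ofReal p := by simpa using hpq.lt.le
  have hgk : ∀ k, MemLp (fun y => g y k) (ENNReal.ofReal p) (volume.restrict Ω) :=
    fun k => hg.eval k
  have hχm : AEStronglyMeasurable χ (volume.restrict Ω) := hχ.1.continuous.aestronglyMeasurable
  obtain ⟨M, hM⟩ := hχ.1.continuous.bounded_above_of_compact_support hχ.2.1
  have m1 := (isLpKernel_theta hΩ hpq lam).memLp (measurable_helmholtzTheta_sub lam) hpq.lt (hgk k)
  have m2 := fun i k => (isLpKernel_thetaGrad hΩ hpq lam i).memLp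
    (measurable_thetaGrad lam i) hpq.lt (hgk k)
  have e1 := ((isLpKernel_theta hΩ hpq lam).integral_mul_integral
    (measurable_helmholtzTheta_sub lam) hpq.lt (hgk k) hχm hM).2
  have e2 := fun i k => ((isLpKernel_thetaGrad hΩ hpq lam i).integral_mul_integral
    (measurable_thetaGrad lam i) hpq.lt (hgk k) hχm hM).2
  have p1 : ∀ y, ∫ x in Ω, χ x * helmholtzTheta lam (x - y) = potential lam χ y := fun y =>
    hχ.setIntegral_mul _
  have p2 : ∀ i y, ∫ x in Ω, χ x * thetaGrad lam i x y =
      -potential lam (fun x => grad3 χ x i) y := fun i y => by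
    rw [hχ.setIntegral_mul, potential_grad3 lam (hχ.1.of_le (by simp)) hχ.2.1, neg_neg]
    rfl
  simp_rw [p1] at e1
  simp_rw [p2, neg_mul, integral_neg] at e2
  have i1 := hχ.integrableOn_mul (m1.integrable hp1)
  have i2 := fun i k => hχ.integrableOn_mul ((m2 i k).integrable hp1)
  have e : ∀ x, χ x * teodorescuComponents lam Ω g x k =
      lam * (χ x * ∫ y in Ω, helmholtzTheta lam (x - y) * g y k) -
      (χ x * (∫ y in Ω, thetaGrad lam (k + 1) x y * g y (k + 2)) -
        χ x * ∫ y in Ω, thetaGrad lam (k + 2) x y * g y (k + 1)) := fun x => by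
    rw [teodorescuComponents]; ring
  have i3 : IntegrableOn (fun x => χ x * (∫ y in Ω, thetaGrad lam (k + 1) x y * g y (k + 2)) -
      χ x * ∫ y in Ω, thetaGrad lam (k + 2) x y * g y (k + 1)) Ω := (i2 _ _).sub (i2 _ _)
  simp_rw [e]
  rw [integral_sub (i1.const_mul lam) i3, integral_const_mul,
    integral_sub (i2 _ _) (i2 _ _), e1, e2, e2]
  simp only [potentialPairing]
  ring

lemma integrableOn_potential_mul (hb : Bornology.IsBounded Ω) (hΩ : IsOpen Ω)
    (hg : IntegrableOn g Ω) (lam : ℂ) {χ : R3 → ℂ} (hχ : IsTestFunction Ω χ) (j : Fin 3) :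
    IntegrableOn (fun y => potential lam χ y * g y j) Ω := by
  have hc : Continuous (potential lam χ) :=
    (contDiff_potential lam (hχ.1.of_le (by simp)) hχ.2.1).continuous
  obtain ⟨M, hM⟩ := hb.isCompact_closure.exists_bound_of_continuousOn hc.continuousOn
  refine (hg.eval j).bdd_mul hc.aestronglyMeasurable (c := M) ?_
  filter_upwards [ae_restrict_mem hΩ.measurableSet] with y hy using hM y (subset_closure hy)

lemma integral_mul_eq_potentialPairing (hb : Bornology.IsBounded Ω) (hΩ : IsOpen Ω)
    (hg : IntegrableOn g Ω) (lam : ℂ) {φ : R3 → ℂ} (hφ : IsTestFunction Ω φ) (k : Fin 3) :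
    ∫ x in Ω, φ x * g x k =
      ∑ i, potentialPairing lam Ω g (fun x => grad3 (fun x => grad3 φ x i) x i) k +
        lam ^ 2 * potentialPairing lam Ω g φ k := by
  have hi : ∀ i, IntegrableOn (fun y =>
      potential lam (fun x => grad3 (fun x => grad3 φ x i) x i) y * g y k) Ω := fun i =>
    integrableOn_potential_mul hb hΩ hg lam ((hφ.grad3 i).grad3 i) k
  simp only [potentialPairing]
  rw [← integral_finsetSum _ fun i _ => hi i, ← integral_const_mul, ← integral_add
    (integrable_finsetSum _ fun i _ => hi i)
    ((integrableOn_potential_mul hb hΩ hg lam hφ k).const_mul _)]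
  congr 1
  ext y
  rw [← potential_helmholtz lam (hφ.1.of_le (by norm_cast)) hφ.2.1 y, add_mul,
    Finset.sum_mul, mul_assoc]

lemma integral_mul_gradDivPotential_eq (hΩ : IsBoundedLiapunovDomain Ω)
    (hpq : p.HolderConjugate q) (hg : MemLp g (ENNReal.ofReal p) (volume.restrict Ω))
    (hd : MemLp d (ENNReal.ofReal p) (volume.restrict Ω)) (h : HasWeakDiv Ω g d) (lam : ℂ)
    {φ : R3 → ℂ} (hφ : IsTestFunction Ω φ) (k : Fin 3) :
    ∫ x in Ω, φ x * gradDivPotential lam Ω g d x k =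
      ∑ j, potentialPairing lam Ω g (fun x => grad3 (fun x => grad3 φ x k) x j) j := by
  have hfin : IsFiniteMeasure (volume.restrict Ω) :=
    ⟨by simpa using hΩ.isBounded.measure_lt_top⟩
  have hp1 : 1 ≤ ENNReal.ofReal p := by simpa using hpq.lt.le
  rw [integral_mul_gradDivPotential hΩ hpq hg hd h lam hφ k, integral_finsetSum]
  · rfl
  · exact fun j _ => integrableOn_potential_mul hΩ.isBounded hΩ.isOpen (hg.integrable hp1) lam
      ((hφ.grad3 k).grad3 j) j

lemma IsTestFunction.grad3_comm {φ : R3 → ℂ} (hφ : IsTestFunction Ω φ) (i j : Fin 3) :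
    (fun x => _root_.grad3 (fun x => _root_.grad3 φ x i) x j) =
      fun x => _root_.grad3 (fun x => _root_.grad3 φ x j) x i :=
  funext fun x => grad3_grad3_comm (hφ.1.of_le (by norm_cast)) i j x

/-- The weak curl of `T_{2,λ}[g]`. -/
lemma hasWeakCurl_teodorescuComponents (hΩ : IsBoundedLiapunovDomain Ω)
    (hpq : p.HolderConjugate q) (hg : MemLp g (ENNReal.ofReal p) (volume.restrict Ω))
    (hd : MemLp d (ENNReal.ofReal p) (volume.restrict Ω)) (h : HasWeakDiv Ω g d) (lam : ℂ) :
    HasWeakCurl Ω (teodorescuComponents lam Ω g)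
      (g - lam • teodorescuComponents lam Ω g - gradDivPotential lam Ω g d) := by
  have hfin : IsFiniteMeasure (volume.restrict Ω) :=
    ⟨by simpa using hΩ.isBounded.measure_lt_top⟩
  have hp1 : 1 ≤ ENNReal.ofReal p := by simpa using hpq.lt.le
  have iT : IntegrableOn (teodorescuComponents lam Ω g) Ω :=
    (memLp_teodorescuComponents hΩ hpq hg lam).integrable hp1
  have iF : IntegrableOn (gradDivPotential lam Ω g d) Ω :=
    (memLp_gradDivPotential hΩ hpq hg hd lam).integrable hp1
  have ig : IntegrableOn g Ω := hg.integrable hp1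
  rw [hasWeakCurl_iff iT ((ig.sub (iT.smul lam)).sub iF)]
  intro φ hφ k
  have e : ∀ x, φ x * (g - lam • teodorescuComponents lam Ω g - gradDivPotential lam Ω g d) x k =
      φ x * g x k - lam * (φ x * teodorescuComponents lam Ω g x k) -
        φ x * gradDivPotential lam Ω g d x k := fun x => by
    simp only [Pi.sub_apply, Pi.smul_apply, smul_eq_mul]
    ring
  have j1 := hφ.integrableOn_mul (ig.eval k)
  have j2 := (hφ.integrableOn_mul (iT.eval k)).const_mul lam
  have j3 := hφ.integrableOn_mul (iF.eval k)
  have j4 : IntegrableOn (fun x => φ x * g x k -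
      lam * (φ x * teodorescuComponents lam Ω g x k)) Ω := j1.sub j2
  simp_rw [e]
  rw [integral_sub j4 j3, integral_sub j1 j2, integral_const_mul,
    integral_mul_eq_potentialPairing hΩ.isBounded hΩ.isOpen ig lam hφ,
    integral_mul_teodorescuComponents hΩ hpq hg lam hφ,
    integral_mul_gradDivPotential_eq hΩ hpq hg hd h lam hφ,
    integral_mul_teodorescuComponents hΩ hpq hg lam (hφ.grad3 _),
    integral_mul_teodorescuComponents hΩ hpq hg lam (hφ.grad3 _)]
  have s1 := hφ.grad3_comm 1 0
  have s2 := hφ.grad3_comm 2 0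
  have s3 := hφ.grad3_comm 2 1
  simp only [Fin.sum_univ_three]
  fin_cases k
  · simp [s1, s2]
    ring
  · simp [s1, s3]
    ring
  · simp [s2, s3]
    ring

end Teodorescu

/-! ### The right inverse -/

section RightInverse

variable {Ω : Set R3} {u v u' v' : R3 → C3}

lemma HasWeakCurl.congr_ae (h : HasWeakCurl Ω u v) (hu : IntegrableOn u Ω)
    (huu' : u =ᵐ[volume.restrict Ω] u') : HasWeakCurl Ω u' v := by
  refine ⟨IntegrableOn.locallyIntegrableOn (Integrable.congr hu huu'), h.2.1, fun φ hφ => ?_⟩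
  rw [h.2.2 φ hφ]
  congr 1
  refine integral_congr_ae ?_
  filter_upwards [huu'] with x hx
  rw [hx]

lemma HasWeakCurl.add_smul (h : HasWeakCurl Ω u v) (h' : HasWeakCurl Ω u' v') (c : ℂ)
    (hu : IntegrableOn u Ω) (hv : IntegrableOn v Ω) (hu' : IntegrableOn u' Ω)
    (hv' : IntegrableOn v' Ω) : HasWeakCurl Ω (u + c • u') (v + c • v') := by
  rw [hasWeakCurl_iff (hu.add (hu'.smul c)) (hv.add (hv'.smul c))]
  rw [hasWeakCurl_iff hu hv] at h
  rw [hasWeakCurl_iff hu' hv'] at h'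
  intro φ hφ k
  have key : ∀ {χ : R3 → ℂ}, IsTestFunction Ω χ → ∀ {f f' : R3 → C3}, IntegrableOn f Ω →
      IntegrableOn f' Ω → ∀ j, ∫ x in Ω, χ x * (f + c • f') x j =
        (∫ x in Ω, χ x * f x j) + c * ∫ x in Ω, χ x * f' x j := by
    intro χ hχ f f' hf hf' j
    rw [← integral_const_mul, ← integral_add (hχ.integrableOn_mul (hf.eval j))
      ((hχ.integrableOn_mul (hf'.eval j)).const_mul c)]
    congr 1
    ext x
    simp only [Pi.add_apply, Pi.smul_apply, smul_eq_mul]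
    ring
  rw [key hφ hv hv', key (hφ.grad3 _) hu hu', key (hφ.grad3 _) hu hu', h φ hφ k, h' φ hφ k]
  ring

/-- A weak curl is weakly divergence-free. -/
lemma HasWeakCurl.hasWeakDiv_zero (h : HasWeakCurl Ω u v) (hu : IntegrableOn u Ω)
    (hv : IntegrableOn v Ω) : HasWeakDiv Ω v 0 := by
  refine ⟨h.2.1, locallyIntegrableOn_zero, fun φ hφ => ?_⟩
  rw [hasWeakCurl_iff hu hv] at h
  rw [integral_finsetSum _ fun i _ => (hφ.grad3 i).integrableOn_mul (hv.eval i)]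
  have s1 := fun x => congrFun (hφ.grad3_comm 1 0) x
  have s2 := fun x => congrFun (hφ.grad3_comm 2 0) x
  have s3 := fun x => congrFun (hφ.grad3_comm 2 1) x
  simp_rw [fun i => h _ (hφ.grad3 i) i]
  simp [Fin.sum_univ_three, s1, s2, s3]
  ring

lemma HasWeakDiv.smul_sub {d : R3 → ℂ} (h : HasWeakDiv Ω u d) (h' : HasWeakDiv Ω v 0) (c : ℂ)
    (hu : IntegrableOn u Ω) (hv : IntegrableOn v Ω) :
    HasWeakDiv Ω (c • (u - v)) (c • d) := by
  refine ⟨IntegrableOn.locallyIntegrableOn ((hu.sub hv).smul c), h.2.1.smul c, fun φ hφ => ?_⟩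
  have e1 := h.2.2 φ hφ
  have e2 := h'.2.2 φ hφ
  have i : ∀ {f : R3 → C3}, IntegrableOn f Ω →
      IntegrableOn (fun x => ∑ i, grad3 φ x i * f x i) Ω := fun hf =>
    integrable_finsetSum _ fun i _ => (hφ.grad3 i).integrableOn_mul (hf.eval i)
  have a1 : ∀ x, φ x * (c • d) x = c * (φ x * d x) := fun x => by
    simp only [Pi.smul_apply, smul_eq_mul]; ring
  have a2 : ∀ x, ∑ i, grad3 φ x i * (c • (u - v)) x i =
      c * ((∑ i, grad3 φ x i * u x i) - ∑ i, grad3 φ x i * v x i) := fun x => by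
    rw [← Finset.sum_sub_distrib, Finset.mul_sum]
    refine Finset.sum_congr rfl fun i _ => ?_
    simp only [Pi.smul_apply, Pi.sub_apply, smul_eq_mul]
    ring
  simp_rw [a1, a2]
  rw [integral_const_mul, integral_const_mul, integral_sub (i hu) (i hv), e1]
  simp only [Pi.zero_apply, mul_zero, integral_zero, zero_eq_neg] at e2
  rw [e2]
  ring

variable {p q : ℝ} {g : R3 → C3} {d : R3 → ℂ}

lemma hasWeakCurl_gradDivPotential (hΩ : IsBoundedLiapunovDomain Ω)
    (hpq : p.HolderConjugate q) (hg : MemLp g (ENNReal.ofReal p) (volume.restrict Ω))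
    (hd : MemLp d (ENNReal.ofReal p) (volume.restrict Ω)) (h : HasWeakDiv Ω g d) (lam : ℂ) :
    HasWeakCurl Ω (gradDivPotential lam Ω g d) 0 := by
  have hfin : IsFiniteMeasure (volume.restrict Ω) :=
    ⟨by simpa using hΩ.isBounded.measure_lt_top⟩
  have hp1 : 1 ≤ ENNReal.ofReal p := by simpa using hpq.lt.le
  have iF : IntegrableOn (gradDivPotential lam Ω g d) Ω :=
    (memLp_gradDivPotential hΩ hpq hg hd lam).integrable hp1
  have i0 : IntegrableOn (0 : R3 → C3) Ω := integrableOn_zero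
  rw [hasWeakCurl_iff iF i0]
  intro φ hφ k
  rw [integral_mul_gradDivPotential_eq hΩ hpq hg hd h lam (hφ.grad3 _),
    integral_mul_gradDivPotential_eq hΩ hpq hg hd h lam (hφ.grad3 _), hφ.grad3_comm]
  simp

end RightInverse

theorem mainTheorem2 (Ω : Set R3) (hΩ : IsBoundedLiapunovDomain Ω) (lam : ℂ) (hlam : lam ≠ 0)
    (p : ℝ≥0∞) (hp : 1 < p) (hp' : p < ⊤) (g : R3 → C3) (hg : MemWdiv p Ω g) :
    -- the integral that defines `T_{2,λ}[g]` converges, and `T_{2,λ}[g]` has a weak curl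
    (∀ᵐ x ∂(volume.restrict Ω), IntegrableOn (teodorescuIntegrand lam g x) Ω) ∧
    HasWeakCurl Ω (teodorescuT2 lam Ω g) (weakCurl Ω (teodorescuT2 lam Ω g)) ∧
    -- `R_λ` maps the space into itself, into the domain of the weak curl
    MemWdiv p Ω (rightInverseR lam Ω g) ∧
    HasWeakCurl Ω (rightInverseR lam Ω g) (weakCurl Ω (rightInverseR lam Ω g)) ∧
    -- `(curl + λ) R_λ g = g`
    (fun x => weakCurl Ω (rightInverseR lam Ω g) x + lam • rightInverseR lam Ω g x)
      =ᵐ[volume.restrict Ω] g := by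
  obtain ⟨hg, d, hd, hdiv⟩ := hg
  obtain ⟨r, rfl⟩ : ∃ r : ℝ, p = ENNReal.ofReal r :=
    ⟨p.toReal, (ENNReal.ofReal_toReal hp'.ne).symm⟩
  have hr : 1 < r := by simpa using hp
  have hpq : r.HolderConjugate r.conjExponent := Real.HolderConjugate.conjExponent hr
  have hfin : IsFiniteMeasure (volume.restrict Ω) :=
    ⟨by simpa using hΩ.isBounded.measure_lt_top⟩
  have ae1 := ae_integrableOn_teodorescuIntegrand hΩ hpq hg lam
  have mT := memLp_teodorescuComponents hΩ hpq hg lam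
  have mF := memLp_gradDivPotential hΩ hpq hg hd lam
  have cT := hasWeakCurl_teodorescuComponents hΩ hpq hg hd hdiv lam
  have cF := hasWeakCurl_gradDivPotential hΩ hpq hg hd hdiv lam
  set T := teodorescuComponents lam Ω g
  set F := gradDivPotential lam Ω g d
  have mv : MemLp (g - lam • T - F) (ENNReal.ofReal r) (volume.restrict Ω) :=
    (hg.sub (mT.const_smul lam)).sub mF
  set v := g - lam • T - F with hv
  have int : ∀ {f : R3 → C3}, MemLp f (ENNReal.ofReal r) (volume.restrict Ω) →
      IntegrableOn f Ω := fun hf => hf.integrable hp.le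
  have cT' : HasWeakCurl Ω (teodorescuT2 lam Ω g) v :=
    cT.congr_ae (int mT) (ae1.mono fun x hx => hx.2.symm)
  have hw : weakCurl Ω (teodorescuT2 lam Ω g) =ᵐ[volume.restrict Ω] v :=
    cT'.weakCurl.ae_eq hΩ.isOpen cT'
  have hR : lam⁻¹ • (g - v) =ᵐ[volume.restrict Ω] rightInverseR lam Ω g := by
    filter_upwards [hw] with x hx
    simp [rightInverseR, hx]
  have hgv : lam⁻¹ • (g - v) = T + lam⁻¹ • F := by
    ext x k
    simp only [hv, Pi.smul_apply, Pi.sub_apply, Pi.add_apply, smul_eq_mul]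
    field_simp
    ring
  have mR : MemLp (lam⁻¹ • (g - v)) (ENNReal.ofReal r) (volume.restrict Ω) :=
    (hg.sub mv).const_smul _
  have cR : HasWeakCurl Ω (rightInverseR lam Ω g) v := by
    refine HasWeakCurl.congr_ae ?_ (int mR) hR
    rw [hgv]
    simpa using cT.add_smul cF lam⁻¹ (int mT) (int mv) (int mF) integrableOn_zero
  refine ⟨ae1.mono fun x hx => hx.1, cT'.weakCurl, ⟨mR.ae_eq hR, lam⁻¹ • d, hd.const_smul _, ?_⟩,
    cR.weakCurl, ?_⟩
  · have hD := hdiv.smul_sub (cT.hasWeakDiv_zero (int mT) (int mv)) lam⁻¹ (int hg) (int mv)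
    refine ⟨(int (mR.ae_eq hR)).locallyIntegrableOn, hD.2.1, fun φ hφ => ?_⟩
    rw [hD.2.2 φ hφ]
    congr 1
    refine integral_congr_ae ?_
    filter_upwards [hR] with x hx
    rw [hx]
  · filter_upwards [cR.weakCurl.ae_eq hΩ.isOpen cR, hR] with x h1 h2
    rw [h1, ← h2]
    simp [hlam]
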